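/- Let $p$ be a prime, $\mathcal O$ a complete discrete valuation ring of characteristic zero with algebraically closed residue field of characteristic $p$, and $\mathcal K$ its field of fractions. For a commutative ring $R$, an $R^*$-group is a group $\hat X$ with an injective homomorphism from $R^*$ to its center; its $R^*$-quotient is $X=\hat X/R^*$. An $R^*$-subgroup is a subgroup containing $R^*$. For a commutative $R$-algebra $S$, let $S_*\hat X=S\otimes_{SR^*}S\hat X$ be the group algebra of $\hat X$ over $S$ in which the elements of $R^*$ have become scalars. For an $R$-algebra $R'$, let $\hat X^{R'}$ be the central product of $R'^*$ and $\hat X$ over $R^*$. Let $\hat X^\circ$ be the group $\hat X$ with $\lambda\in R^*$ acting as $\lambda^{-1}$, and for $R^*$-groups $\hat X,\hat Y$ with the same $R^*$-quotient let $\hat X*\hat Y$ be the quotient of their fibre product over that quotient by $\{(\lambda,\lambda^{-1}):\lambda\in R^*\}$. Let ${\rm Irr}_{F}(\hat X)$ be the set of characters of the simple $F_*\hat X$-modules. A field $F$ is a splitting field for $\hat X$ if $F_*\hat X$ is a direct product of full matrix algebras over $F$. For $R=\mathcal O$, $F=\mathcal K$ (or $R=\hat{\mathcal O}$, $F=\hat{\mathcal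 K}$ below), let $Z_{\rm ch}(R_*\hat X)$ be the ideal of those $z\in Z(R_*\hat X)$ such that, for every symmetric $R$-linear form $\mu$ on $R_*\hat X$, the form $a\mapsto\mu(za)$ is an $R$-linear combination of the elements of ${\rm Irr}_F(\hat X)$. The defect ${\rm d}(\chi)$ of an absolutely irreducible character $\chi\in{\rm Irr}_F(\hat X)$ is the integer $d\ge 0$ such that $\frac{\chi}{\chi(1)}\bigl(Z_{\rm ch}(R_*\hat X)\bigr)=p^{d}R$. Let $\hat G$ be an $\mathcal O^*$-group with finite $\mathcal O^*$-quotient $G$, let $\hat N$ be a normal $\mathcal O^*$-subgroup, and let $\nu$ be an absolutely irreducible character of $\hat N$ over $\mathcal K$. Let $H$ and $\hat H$ be the stabilizers of $\nu$ in $G$ and $\hat G$, let $e_\nu$ be the primitive idempotent of $Z(\mathcal K_*\hat N)$ associated with $\nu$ (it exists), and let ${\rm Irr}_{\mathcal K}(\hat G,\nu)$ be the set of $\chi\in{\rm Irr}_{\mathcal K}(\hat G)$ such that $\nu$ is involved in the restriction of $\chi$ to $\hat N$. Let $\hat{\mathcal K}$ be a finite extension of $\mathcal K$ of degree divisible by $|G|$,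 $\hat{\mathcal O}$ its ring of integers, and $\hat{\hat G}=\hat G^{\hat{\mathcal O}}$, $\hat{\hat H}=\hat H^{\hat{\mathcal O}}$, $\hat{\hat N}=\hat N^{\hat{\mathcal O}}$. (0) There are an $\hat{\mathcal O}^*$-group $\,\hat{}H$ with $\hat{\mathcal O}^*$-quotient $H$, which contains $\hat{\hat N}$ compatibly with the inclusion of $N$ in $H$ and normalizes it, acting on it as $H$ does, and an $\hat{\mathcal O}^*$-group homomorphism $\rho\colon\hat{}H\to(\hat{\mathcal K}_*\hat{\hat N}e_\nu)^*$ lifting the action of $H$ on $\hat{\mathcal K}_*\hat{\hat N}e_\nu$ and extending the structural homomorphism from $\hat{\hat N}$. For any such $\,\hat{}H$ and $\rho$, let ${\rm Ext}(\nu)$ be the character of $\,\hat{}H$ determined by $\rho$, namely $y\mapsto\nu(\rho(y))$ with $\nu$ extended $\hat{\mathcal K}$-linearly. Set $H\hat{}=\hat{\hat H}*(\hat{}H)^\circ$, and identify $N$ with the normal subgroup of $H\hat{}$ formed by the classes of the pairs $(n,n)$ with $n\in\hat{\hat N}$. Then $\hat{\mathcal K}_*\hat{\hat N}e_\nu\otimes_{\hat{\mathcal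 K}}\hat{\mathcal K}_*(H\hat{}/N)$ is an $\hat{\hat H}$-interior algebra, through $h\mapsto\rho(y)\otimes\overline{(h,y)}$ for any $y\in\hat{}H$ over the image of $h$ in $H$. For such an algebra $B$, ${\rm Ind}_{\hat{\hat H}}^{\hat{\hat G}}(B)=\hat{\mathcal K}_*\hat{\hat G}\otimes_{\hat{\mathcal K}_*\hat{\hat H}}B\otimes_{\hat{\mathcal K}_*\hat{\hat H}}\hat{\mathcal K}_*\hat{\hat G}$ with the product $(x\otimes b\otimes y)(x'\otimes b'\otimes y')=x\otimes b\cdot yx'\cdot b'\otimes y'$ if $yx'\in\hat{\hat H}$ and $0$ otherwise ($x,y,x',y'\in\hat{\hat G}$), and with the structural map $x\mapsto\sum_{z\in G/H}xz\otimes1\otimes z^{-1}$ from $\hat{\hat G}$. (1) The element ${\rm Tr}_H^G(e_\nu)$, the sum of the conjugates of $e_\nu$ by representatives of $G/H$, is a central idempotent of $\hat{\mathcal K}_*\hat{\hat G}$, and there is an isomorphism of $\hat{\hat G}$-interior algebras $$\hat{\mathcal K}_*\hat{\hat G}\,{\rm Tr}_H^G(e_\nu)\cong{\rm Ind}_{\hat{\hat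 H}}^{\hat{\hat G}}\bigl(\hat{\mathcal K}_*\hat{\hat N}e_\nu\otimes_{\hat{\mathcal K}}\hat{\mathcal K}_*(H\hat{}/N)\bigr)$$ mapping $ye_\nu$ to $1\otimes(ye_\nu\otimes1)\otimes1$ for any $y\in\hat{\hat N}$. (2) If $\mathcal K$ is a splitting field for $\hat G$ then $\hat{\mathcal K}$ is a splitting field for $H\hat{}/N$, and there is a bijection ${\rm Irr}_{\hat{\mathcal K}}(H\hat{}/N)\cong{\rm Irr}_{\mathcal K}(\hat G,\nu)$, $\zeta\mapsto\chi$, where the extension of $\chi$ to $\hat{\hat G}$ (mapping the class of $(\lambda,x)$ to $\lambda\chi(x)$) is $${\rm Ind}_{\hat{\hat H}}^{\hat{\hat G}}\bigl({\rm Ext}(\nu)\otimes{\rm Res}(\zeta)\bigr),$$ ${\rm Res}(\zeta)$ being the character of $H\hat{}$ corresponding to $\zeta$ and ${\rm Ext}(\nu)\otimes{\rm Res}(\zeta)$ being viewed as a character of $\hat{\hat H}\cong\hat{}H*H\hat{}$. Moreover ${\rm d}(\chi)={\rm d}(\nu)+{\rm d}(\zeta)$. -/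

import Mathlib

universe u

open scoped TensorProduct

noncomputable section

/-! ### `R^*`-groups -/

/-- An `R^*`-group: a group with an injective homomorphism from `Rˣ` to its center. -/
structure StarGroup (R : Type u) [CommRing R] where
  carrier : Type u
  [group : Group carrier]
  unit : Rˣ →* carrier
  unit_injective : Function.Injective unit
  unit_central : ∀ (c : Rˣ) (x : carrier), unit c * x = x * unit c

namespace StarGroup

instance {R : Type u} [CommRing R] : CoeSort (StarGroup R) (Type u) := ⟨StarGroup.carrier⟩

attribute [instance] StarGroup.group

theorem normal_of_central {A : Type u} [Group A] (L : Subgroup A)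
    (h : ∀ l ∈ L, ∀ x : A, l * x = x * l) : L.Normal :=
  ⟨fun l hl x => by rw [← h l hl x, mul_inv_cancel_right]; exact hl⟩

section basic

variable {R : Type u} [CommRing R]

/-- The image of `Rˣ` in an `R^*`-group. -/
def units (X : StarGroup R) : Subgroup X := X.unit.range

instance units_normal (X : StarGroup R) : X.units.Normal :=
  normal_of_central _ (by rintro _ ⟨c, rfl⟩ x; exact X.unit_central c x)

/-- The `R^*`-quotient of an `R^*`-group. -/
abbrev quo (X : StarGroup R) : Type u := X.carrier ⧸ X.units

/-- Homomorphisms of `R^*`-groups. -/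
structure Hom (X Y : StarGroup R) extends X.carrier →* Y.carrier where
  map_unit : ∀ (c : Rˣ) (x : X), toFun (X.unit c * x) = Y.unit c * toFun x

theorem Hom.apply_unit {X Y : StarGroup R} (f : Hom X Y) (c : Rˣ) :
    f.toMonoidHom (X.unit c) = Y.unit c := by
  have h := f.map_unit c 1
  have h1 : f.toMonoidHom.toFun 1 = 1 := f.toMonoidHom.map_one
  rw [mul_one] at h
  exact h.trans (by rw [h1, mul_one])

/-- An `R^*`-subgroup, viewed as an `R^*`-group. -/
def sub (X : StarGroup R) (L : Subgroup X) (hL : X.units ≤ L) : StarGroup R where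
  carrier := L
  unit := X.unit.codRestrict L (fun c => hL ⟨c, rfl⟩)
  unit_injective := fun _ _ h => X.unit_injective (congrArg Subtype.val h)
  unit_central := fun c x => Subtype.ext (X.unit_central c x)

/-- The inclusion of an `R^*`-subgroup. -/
def subHom (X : StarGroup R) (L : Subgroup X) (hL : X.units ≤ L) : Hom (X.sub L hL) X where
  toMonoidHom := L.subtype
  map_unit := fun _ _ => rfl

/-- The inclusion between two `R^*`-subgroups. -/
def inclusion (X : StarGroup R) {L M : Subgroup X} (hL : X.units ≤ L) (hM : X.units ≤ M)
    (h : L ≤ M) : Hom (X.sub L hL) (X.sub M hM) where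
  toMonoidHom := Subgroup.inclusion h
  map_unit := fun _ _ => rfl

/-- `X°`: the same group, with `c` in `Rˣ` acting as `c⁻¹` does on `X` (the inverse central
extension of the `R^*`-quotient). -/
abbrev op (X : StarGroup R) : StarGroup R where
  carrier := X.carrier
  unit := X.unit.comp invMonoidHom
  unit_injective := fun _ _ h => inv_injective (X.unit_injective h)
  unit_central := fun c x => X.unit_central c⁻¹ x

/-- The subgroup of the direct product `X × Y` of the pairs with the same image in `Q`. -/
def pullback (X Y : StarGroup R) {Q : Type u} [Group Q] (p : X.carrier →* Q)
    (q : Y.carrier →* Q) : Subgroup (X.carrier × Y.carrier) :=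
  (p.comp (MonoidHom.fst _ _)).eqLocus (q.comp (MonoidHom.snd _ _))

/-- The inverse diagonal `c ↦ (c, c⁻¹)` in `pullback X Y p q`. -/
def inverseDiagonal (X Y : StarGroup R) {Q : Type u} [Group Q] (p : X.carrier →* Q)
    (q : Y.carrier →* Q) (hp : ∀ c, p (X.unit c) = 1) (hq : ∀ c, q (Y.unit c) = 1) :
    Rˣ →* pullback X Y p q :=
  (X.unit.prod (Y.unit.comp invMonoidHom)).codRestrict _ (fun c => by
    change p (X.unit c) = q (Y.unit c⁻¹)
    rw [hp, hq])

instance inverseDiagonal_normal (X Y : StarGroup R) {Q : Type u} [Group Q] (p : X.carrier →* Q)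
    (q : Y.carrier →* Q) (hp : ∀ c, p (X.unit c) = 1) (hq : ∀ c, q (Y.unit c) = 1) :
    (inverseDiagonal X Y p q hp hq).range.Normal :=
  normal_of_central _ (by
    rintro _ ⟨c, rfl⟩ x
    exact Subtype.ext (Prod.ext (X.unit_central c x.1.1) (Y.unit_central c⁻¹ x.1.2)))

/-- `X * Y`, for two `R^*`-groups `X`, `Y` whose `R^*`-quotients are identified through `p` and
`q` with the same group: the sum of the two central extensions. -/
def star (X Y : StarGroup R) {Q : Type u} [Group Q] (p : X.carrier →* Q)
    (q : Y.carrier →* Q) (hp : ∀ c, p (X.unit c) = 1) (hq : ∀ c, q (Y.unit c) = 1) :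
    StarGroup R where
  carrier := pullback X Y p q ⧸ (inverseDiagonal X Y p q hp hq).range
  unit := (QuotientGroup.mk' _).comp
    ((X.unit.prod 1).codRestrict (pullback X Y p q) (fun c => by
      change p (X.unit c) = q 1
      rw [hp, map_one]))
  unit_injective := by
    rw [injective_iff_map_eq_one]
    intro c hc
    obtain ⟨d, hd⟩ := (QuotientGroup.eq_one_iff _).1 hc
    have h1 : X.unit d = X.unit c := congrArg (fun z => z.1.1) hd
    have h2 : Y.unit d⁻¹ = 1 := congrArg (fun z => z.1.2) hd
    have h3 : d⁻¹ = 1 := Y.unit_injective (h2.trans (map_one _).symm)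
    rw [← X.unit_injective h1, ← inv_inv d, h3, inv_one]
  unit_central := by
    intro c x
    induction x using QuotientGroup.induction_on with
    | H x =>
      refine congrArg (QuotientGroup.mk' _) (Subtype.ext (Prod.ext ?_ ?_))
      · exact X.unit_central c x.1.1
      · change 1 * x.1.2 = x.1.2 * 1
        rw [one_mul, mul_one]

/-- The class in `X * Y` of a pair of elements. -/
def starMk (X Y : StarGroup R) {Q : Type u} [Group Q] (p : X.carrier →* Q)
    (q : Y.carrier →* Q) (hp : ∀ c, p (X.unit c) = 1) (hq : ∀ c, q (Y.unit c) = 1) :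
    pullback X Y p q →* star X Y p q hp hq :=
  QuotientGroup.mk' (inverseDiagonal X Y p q hp hq).range

theorem starMk_surjective (X Y : StarGroup R) {Q : Type u} [Group Q] (p : X.carrier →* Q)
    (q : Y.carrier →* Q) (hp : ∀ c, p (X.unit c) = 1) (hq : ∀ c, q (Y.unit c) = 1) :
    Function.Surjective (starMk X Y p q hp hq) := QuotientGroup.mk'_surjective _

theorem starMk_eq_unit (X Y : StarGroup R) {Q : Type u} [Group Q] (p : X.carrier →* Q)
    (q : Y.carrier →* Q) (hp : ∀ c, p (X.unit c) = 1) (hq : ∀ c, q (Y.unit c) = 1)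
    (z : pullback X Y p q) (c : Rˣ) :
    starMk X Y p q hp hq z = (star X Y p q hp hq).unit c ↔
      ∃ d : Rˣ, z.1.1 = X.unit (c * d) ∧ z.1.2 = Y.unit d⁻¹ := by
  constructor
  · intro h
    obtain ⟨d, hd⟩ := (QuotientGroup.eq (s := (inverseDiagonal X Y p q hp hq).range)).1 h
    have h1 : X.unit d = z.1.1⁻¹ * X.unit c := congrArg (fun z => z.1.1) hd
    have h2 : Y.unit d⁻¹ = z.1.2⁻¹ * 1 := congrArg (fun z => z.1.2) hd
    refine ⟨d⁻¹, ?_, ?_⟩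
    · rw [map_mul, map_inv, h1, mul_inv_rev, inv_inv, mul_inv_cancel_left]
    · rw [map_inv, h2, mul_one, inv_inv]
  · rintro ⟨d, h1, h2⟩
    refine (QuotientGroup.eq (s := (inverseDiagonal X Y p q hp hq).range)).2 ⟨d⁻¹, ?_⟩
    refine Subtype.ext (Prod.ext ?_ ?_)
    · change X.unit d⁻¹ = z.1.1⁻¹ * X.unit c
      rw [h1, ← map_inv, ← map_mul]
      congr 1
      group
    · change Y.unit d⁻¹⁻¹ = z.1.2⁻¹ * 1
      rw [h2, map_inv, mul_one]

/-- The quotient of an `R^*`-group by a normal subgroup meeting `Rˣ` trivially. -/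
def quotient (X : StarGroup R) (M : Subgroup X) [M.Normal]
    (hM : ∀ c, X.unit c ∈ M → c = 1) : StarGroup R where
  carrier := X.carrier ⧸ M
  unit := (QuotientGroup.mk' M).comp X.unit
  unit_injective := by
    rw [injective_iff_map_eq_one]
    intro c hc
    exact hM c ((QuotientGroup.eq_one_iff _).1 hc)
  unit_central := by
    intro c x
    induction x using QuotientGroup.induction_on with
    | H x => exact congrArg (QuotientGroup.mk' M) (X.unit_central c x)

end basic

section baseChange

variable {R : Type u} [CommRing R] (R' : Type u) [CommRing R'] [Algebra R R']

/-- The map `Rˣ → R'ˣ`. -/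
def unitsMap (R : Type u) [CommRing R] [Algebra R R'] : Rˣ →* R'ˣ :=
  Units.map (algebraMap R R' : R →* R')

/-- The homomorphism `c ↦ (c⁻¹, c)` from `Rˣ` to `R'ˣ × X`. -/
def antidiagonal (X : StarGroup R) : Rˣ →* R'ˣ × X.carrier :=
  ((unitsMap R' R).comp invMonoidHom).prod X.unit

instance antidiagonal_normal (X : StarGroup R) : (antidiagonal R' X).range.Normal :=
  normal_of_central _ (by
    rintro _ ⟨c, rfl⟩ x
    exact Prod.ext (mul_comm _ _) (X.unit_central c x.2))

/-- The `R'^*`-group `X^{R'}`: the central product of `R'ˣ` and `X` over `Rˣ`. -/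
def baseChange (X : StarGroup R) : StarGroup R' where
  carrier := (R'ˣ × X.carrier) ⧸ (antidiagonal R' X).range
  unit := (QuotientGroup.mk' _).comp (MonoidHom.inl _ _)
  unit_injective := by
    rw [injective_iff_map_eq_one]
    intro c hc
    obtain ⟨d, hd⟩ := (QuotientGroup.eq_one_iff _).1 hc
    have h1 : unitsMap R' R d⁻¹ = c := congrArg Prod.fst hd
    have h2 : X.unit d = 1 := congrArg Prod.snd hd
    have h3 : d = 1 := X.unit_injective (h2.trans (map_one _).symm)
    rw [← h1, h3, inv_one, map_one]
  unit_central := by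
    intro c x
    induction x using QuotientGroup.induction_on with
    | H x =>
      refine congrArg (QuotientGroup.mk' _) (Prod.ext (mul_comm _ _) ?_)
      change 1 * x.2 = x.2 * 1
      rw [one_mul, mul_one]

/-- The class of `(c, x)` in `X^{R'}`. -/
def bcMk (X : StarGroup R) : R'ˣ × X.carrier →* X.baseChange R' := QuotientGroup.mk' _

theorem bcMk_surjective (X : StarGroup R) : Function.Surjective (X.bcMk R') :=
  QuotientGroup.mk'_surjective _

theorem bcMk_unit (X : StarGroup R) (c : Rˣ) :
    X.bcMk R' (1, X.unit c) = (X.baseChange R').unit (unitsMap R' R c) := by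
  refine ((QuotientGroup.eq (s := (antidiagonal R' X).range)).2 ⟨c, ?_⟩).symm
  refine Prod.ext ?_ ?_
  · change unitsMap R' R c⁻¹ = (unitsMap R' R c)⁻¹ * 1
    rw [map_inv, mul_one]
  · change X.unit c = 1⁻¹ * X.unit c
    rw [inv_one, one_mul]

/-- The homomorphism `X → X^{R'}`. -/
def bcOf (X : StarGroup R) : X.carrier →* X.baseChange R' :=
  (X.bcMk R').comp (MonoidHom.inr _ _)

/-- Functoriality of `X ↦ X^{R'}`. -/
def bcMap {X Y : StarGroup R} (f : Hom X Y) : Hom (X.baseChange R') (Y.baseChange R') where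
  toMonoidHom := QuotientGroup.map _ _ ((MonoidHom.id _).prodMap f.toMonoidHom) (by
    rintro _ ⟨c, rfl⟩
    exact ⟨c, Prod.ext rfl (f.apply_unit c).symm⟩)
  map_unit := by
    intro c x
    induction x using QuotientGroup.induction_on with
    | H x =>
      refine congrArg (QuotientGroup.mk' _) (Prod.ext rfl ?_)
      change f.toMonoidHom (1 * x.2) = 1 * f.toMonoidHom x.2
      rw [one_mul, one_mul]

theorem bcMap_bcMk {X Y : StarGroup R} (f : Hom X Y) (c : R'ˣ) (x : X) :
    (bcMap R' f).toMonoidHom (X.bcMk R' (c, x)) = Y.bcMk R' (c, f.toMonoidHom x) := rfl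

theorem bcMap_injective {X Y : StarGroup R} (f : Hom X Y)
    (hf : Function.Injective f.toMonoidHom) :
    Function.Injective (bcMap R' f).toMonoidHom := by
  rw [injective_iff_map_eq_one]
  intro x hx
  obtain ⟨⟨c, x⟩, rfl⟩ := X.bcMk_surjective R' x
  rw [bcMap_bcMk] at hx
  obtain ⟨d, hd⟩ := (QuotientGroup.eq_one_iff _).1 hx
  have h1 : unitsMap R' R d⁻¹ = c := congrArg Prod.fst hd
  have h2 : Y.unit d = f.toMonoidHom x := congrArg Prod.snd hd
  refine (QuotientGroup.eq_one_iff _).2 ⟨d, Prod.ext h1 ?_⟩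
  exact hf ((f.apply_unit d).trans h2)

/-- If `X` has a finite `R^*`-quotient then the image of `L^{R'}` in `X^{R'}` has finite index,
for any `R^*`-subgroup `L` of `X`. -/
instance finiteIndex_range (X : StarGroup R) [Finite X.quo] (L : Subgroup X)
    (hL : X.units ≤ L) : (bcMap R' (X.subHom L hL)).toMonoidHom.range.FiniteIndex := by
  set J := (bcMap R' (X.subHom L hL)).toMonoidHom.range with hJ
  let g : X.quo → X.baseChange R' ⧸ J :=
    Quotient.lift (fun x : X.carrier => (QuotientGroup.mk (X.bcOf R' x) : _ ⧸ J)) (by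
      intro a b hab
      have hab : a⁻¹ * b ∈ X.units := QuotientGroup.leftRel_apply.1 hab
      refine QuotientGroup.eq.2 ?_
      rw [← map_inv, ← map_mul]
      exact ⟨X.sub L hL |>.bcOf R' ⟨a⁻¹ * b, hL hab⟩, rfl⟩)
  have hg : Function.Surjective g := by
    intro y
    induction y using QuotientGroup.induction_on with
    | H y =>
      obtain ⟨⟨c, x⟩, rfl⟩ := X.bcMk_surjective R' y
      refine ⟨QuotientGroup.mk x, QuotientGroup.eq.2 ?_⟩
      refine ⟨(X.sub L hL).bcMk R' (c, 1), ?_⟩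
      rw [bcMap_bcMk]
      change X.bcMk R' (c, 1) = (X.bcMk R' (1, x))⁻¹ * X.bcMk R' (c, x)
      rw [← map_inv, ← map_mul]
      congr 1
      exact Prod.ext (by simp) (by simp)
  have : Finite (X.baseChange R' ⧸ J) := Finite.of_surjective g hg
  exact Subgroup.finiteIndex_of_finite_quotient

end baseChange

end StarGroup

/-! ### The `R^*`-group algebra -/

/-- The relation identifying `c` in `Rˣ ⊆ X` with the scalar `c`. -/
inductive StarAlg.Rel {R : Type u} [CommRing R] (S : Type u) [CommRing S] [Algebra R S]
    (X : StarGroup R) : MonoidAlgebra S X.carrier → MonoidAlgebra S X.carrier → Prop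
  | unit (c : Rˣ) : StarAlg.Rel S X (MonoidAlgebra.of S X.carrier (X.unit c))
      (algebraMap S (MonoidAlgebra S X.carrier) (algebraMap R S c))

/-- `S_* X`: the group algebra of `X` over the commutative `R`-algebra `S`, in which the elements
of `Rˣ ⊆ X` have become scalars; this is the algebra `S ⊗_{S Rˣ} S X`. -/
def StarAlg {R : Type u} [CommRing R] (S : Type u) [CommRing S] [Algebra R S]
    (X : StarGroup R) : Type u :=
  RingQuot (StarAlg.Rel S X)

namespace StarAlg

section basic

variable {R : Type u} [CommRing R] (S : Type u) [CommRing S] [Algebra R S]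

instance (X : StarGroup R) : Ring (StarAlg S X) := inferInstanceAs (Ring (RingQuot _))

instance (X : StarGroup R) (T : Type u) [CommRing T] [Algebra T S] : Algebra T (StarAlg S X) :=
  inferInstanceAs (Algebra T (RingQuot _))

instance (X : StarGroup R) (T : Type u) [CommRing T] [Algebra T S] :
    IsScalarTower T S (StarAlg S X) :=
  inferInstanceAs (IsScalarTower T S (RingQuot _))

/-- The structural homomorphism from `X` to `S_* X`. -/
def of (X : StarGroup R) : X.carrier →* StarAlg S X :=
  ((RingQuot.mkAlgHom S (StarAlg.Rel S X) :
    MonoidAlgebra S X.carrier →ₐ[S] RingQuot (StarAlg.Rel S X)) :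
    MonoidAlgebra S X.carrier →* RingQuot (StarAlg.Rel S X)).comp (MonoidAlgebra.of S X.carrier)

theorem of_unit (X : StarGroup R) (c : Rˣ) :
    of S X (X.unit c) = algebraMap S (StarAlg S X) (algebraMap R S c) := by
  have h := RingQuot.mkAlgHom_rel S (StarAlg.Rel.unit (S := S) (X := X) c)
  rw [AlgHom.commutes] at h
  exact h

variable {S}

/-- The universal property of `S_* X`. -/
def lift {X : StarGroup R} {A : Type u} [Ring A] [Algebra S A] (f : X.carrier →* A)
    (hf : ∀ c : Rˣ, f (X.unit c) = algebraMap S A (algebraMap R S c)) : StarAlg S X →ₐ[S] A :=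
  RingQuot.liftAlgHom S ⟨MonoidAlgebra.lift S A X.carrier f, by
    rintro _ _ ⟨c⟩
    rw [MonoidAlgebra.lift_of, AlgHom.commutes, hf]⟩

theorem lift_of {X : StarGroup R} {A : Type u} [Ring A] [Algebra S A] (f : X.carrier →* A)
    (hf : ∀ c : Rˣ, f (X.unit c) = algebraMap S A (algebraMap R S c)) (x : X) :
    lift f hf (of S X x) = f x :=
  (RingQuot.liftAlgHom_mkAlgHom_apply S _ _ _).trans (MonoidAlgebra.lift_of _ _)

variable (S)

/-- Functoriality of `S_* X` in `X`. -/
def map {X Y : StarGroup R} (f : StarGroup.Hom X Y) : StarAlg S X →ₐ[S] StarAlg S Y :=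
  lift ((of S Y).comp f.toMonoidHom) (fun c => by
    change of S Y (f.toMonoidHom (X.unit c)) = _
    rw [f.apply_unit, of_unit])

/-- The canonical homomorphism `R_* X → S_* X`. -/
def scalar (X : StarGroup R) : StarAlg R X →ₐ[R] StarAlg S X :=
  lift (of S X) (fun c => by rw [of_unit]; exact (IsScalarTower.algebraMap_apply R S _ _).symm)

end basic

section baseChange

variable {R : Type u} [CommRing R] (R' : Type u) [CommRing R'] [Algebra R R']
  {S : Type u} [CommRing S] [Algebra R S] (S' : Type u) [CommRing S'] [Algebra R S']
  [Algebra S S'] [IsScalarTower R S S'] [Algebra R' S'] [IsScalarTower R R' S']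

/-- The canonical homomorphism `S_* X → S'_* X^{R'}`. -/
def ascend (X : StarGroup R) : StarAlg S X →ₐ[S] StarAlg S' (X.baseChange R') :=
  lift ((of S' (X.baseChange R')).comp (X.bcOf R')) (fun c => by
    change of S' _ (X.bcMk R' (1, X.unit c)) = _
    rw [StarGroup.bcMk_unit, of_unit]
    change algebraMap S' _ (algebraMap R' S' (algebraMap R R' c)) = _
    rw [← IsScalarTower.algebraMap_apply R R' S', IsScalarTower.algebraMap_apply R S S',
      ← IsScalarTower.algebraMap_apply S S' (StarAlg S' (X.baseChange R'))])

/-- The canonical homomorphism `S'_* X^{R'} → S' ⊗ S_* X`, mapping the class of `(c, x)` to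
`c ⊗ x`. -/
def descend (X : StarGroup R) : StarAlg S' (X.baseChange R') →ₐ[S'] S' ⊗[S] StarAlg S X :=
  lift (QuotientGroup.lift (StarGroup.antidiagonal R' X).range
    { toFun := fun z => algebraMap R' S' (z.1 : R') ⊗ₜ[S] of S X z.2
      map_one' := by simp [Algebra.TensorProduct.one_def]
      map_mul' := fun z w => by simp [Algebra.TensorProduct.tmul_mul_tmul] }
    (by
      rintro _ ⟨c, rfl⟩
      change algebraMap R' S' (algebraMap R R' (c⁻¹ : Rˣ)) ⊗ₜ[S] of S X (X.unit c) = 1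
      rw [of_unit, Algebra.algebraMap_eq_smul_one (A := StarAlg S X), TensorProduct.tmul_smul,
        TensorProduct.smul_tmul', Algebra.smul_def, ← IsScalarTower.algebraMap_apply R R' S',
        ← IsScalarTower.algebraMap_apply R S S', ← map_mul, Units.mul_inv, map_one,
        Algebra.TensorProduct.one_def]))
    (fun c => by
      change algebraMap R' S' (c : R') ⊗ₜ[S] of S X 1 = _
      rw [map_one, Algebra.TensorProduct.algebraMap_apply]
      rfl)

/-- The `S'`-linear extension to `S'_* X^{R'}` of an `S`-linear form on `S_* X`; it maps the class
of `(c, x)` to `c` times the value at `x`. -/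
def extendForm {X : StarGroup R} (f : StarAlg S X →ₗ[S] S) :
    StarAlg S' (X.baseChange R') →ₗ[S'] S' :=
  (TensorProduct.AlgebraTensorModule.rid S S' S').toLinearMap ∘ₗ f.baseChange S' ∘ₗ
    (descend R' S' X).toLinearMap

theorem extendForm_of {X : StarGroup R} (f : StarAlg S X →ₗ[S] S) (c : R'ˣ) (x : X) :
    extendForm R' S' f (of S' _ (X.bcMk R' (c, x))) =
      algebraMap R' S' c * algebraMap S S' (f (of S X x)) := by
  have h : descend R' S' X (of S' _ (X.bcMk R' (c, x))) =
      algebraMap R' S' (c : R') ⊗ₜ[S] of S X x := lift_of _ _ _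
  simp only [extendForm, LinearMap.comp_apply, AlgHom.toLinearMap_apply, h,
    LinearMap.baseChange_tmul, LinearEquiv.coe_coe, TensorProduct.AlgebraTensorModule.rid_tmul]
  rw [Algebra.smul_def, mul_comm]

end baseChange

end StarAlg

/-! ### Characters -/

section characters

variable {R : Type u} [CommRing R] (F : Type u) [Field F] [Algebra R F]

/-- The character of an `F_* X`-module, as a linear form on `F_* X`. -/
def moduleChar (X : StarGroup R) (V : Type u) [AddCommGroup V] [Module F V]
    [Module (StarAlg F X) V] [IsScalarTower F (StarAlg F X) V] : StarAlg F X →ₗ[F] F :=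
  LinearMap.trace F V ∘ₗ (Algebra.lsmul F F V).toLinearMap

variable {F}

/-- `χ` is the character of a finite-dimensional (possibly zero) `F_* X`-module. -/
def IsChar {X : StarGroup R} (χ : StarAlg F X →ₗ[F] F) : Prop :=
  ∃ (V : Type u) (_ : AddCommGroup V) (_ : Module F V) (_ : Module (StarAlg F X) V)
    (_ : IsScalarTower F (StarAlg F X) V),
    FiniteDimensional F V ∧ χ = moduleChar F X V

/-- `χ` is the character of a finite-dimensional simple `F_* X`-module. -/
def IsIrrChar {X : StarGroup R} (χ : StarAlg F X →ₗ[F] F) : Prop :=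
  ∃ (V : Type u) (_ : AddCommGroup V) (_ : Module F V) (_ : Module (StarAlg F X) V)
    (_ : IsScalarTower F (StarAlg F X) V),
    FiniteDimensional F V ∧ IsSimpleModule (StarAlg F X) V ∧ χ = moduleChar F X V

/-- `χ` is an absolutely irreducible character: it is afforded by a finite-dimensional simple
`F_* X`-module all of whose endomorphisms are scalars. -/
def IsAbsIrrChar {X : StarGroup R} (χ : StarAlg F X →ₗ[F] F) : Prop :=
  ∃ (V : Type u) (_ : AddCommGroup V) (_ : Module F V) (_ : Module (StarAlg F X) V)
    (_ : IsScalarTower F (StarAlg F X) V),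
    FiniteDimensional F V ∧ IsSimpleModule (StarAlg F X) V ∧
    (∀ f : V →ₗ[StarAlg F X] V, ∃ c : F, ∀ v, f v = c • v) ∧ χ = moduleChar F X V

theorem IsAbsIrrChar.mul_comm {X : StarGroup R} {χ : StarAlg F X →ₗ[F] F}
    (h : IsAbsIrrChar χ) (a b : StarAlg F X) : χ (a * b) = χ (b * a) := by
  obtain ⟨V, _, _, _, _, -, -, -, rfl⟩ := h
  simp only [moduleChar, LinearMap.comp_apply, AlgHom.toLinearMap_apply, map_mul]
  exact LinearMap.trace_mul_comm _ _ _

variable (F)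

/-- `Irr_F(X)`. -/
def Irr (X : StarGroup R) : Set (StarAlg F X →ₗ[F] F) := {χ | IsIrrChar χ}

/-- `F` is a splitting field for `X`: the algebra `F_* X` is a direct product of full matrix
algebras over `F`. -/
def IsSplittingFor (X : StarGroup R) : Prop :=
  ∃ (n : ℕ) (d : Fin n → ℕ),
    Nonempty (StarAlg F X ≃ₐ[F] ((i : Fin n) → Matrix (Fin (d i)) (Fin (d i)) F))

variable {F}

/-- `Irr_F(X, ν)`: the irreducible characters `χ` of `X` such that `ν` is involved in the
restriction of `χ` to the `R^*`-subgroup `N`. -/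
def IrrOver {X : StarGroup R} {N : Subgroup X} {hN : X.units ≤ N}
    (ν : StarAlg F (X.sub N hN) →ₗ[F] F) : Set (StarAlg F X →ₗ[F] F) :=
  {χ | IsIrrChar χ ∧ ∃ ψ : StarAlg F (X.sub N hN) →ₗ[F] F, IsChar ψ ∧
    χ ∘ₗ (StarAlg.map F (X.subHom N hN)).toLinearMap = ν + ψ}

/-- `e` is the primitive idempotent of the center of `F_* X` associated with the irreducible
character `ν`, namely the one acting as the identity on a module affording `ν`. -/
structure IsAssociatedIdempotent {X : StarGroup R} (ν : StarAlg F X →ₗ[F] F)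
    (e : StarAlg F X) : Prop where
  mem_center : e ∈ Subalgebra.center F (StarAlg F X)
  isIdempotentElem : IsIdempotentElem e
  ne_zero : e ≠ 0
  primitive : ∀ f ∈ Subalgebra.center F (StarAlg F X), IsIdempotentElem f → f * e = f →
    f = 0 ∨ f = e
  apply_eq : ν e = ν 1

/-- The image in `F'_* X^{R'}` of the idempotent associated with `ν` is an idempotent. -/
theorem IsAssociatedIdempotent.ascend {X : StarGroup R} {ν : StarAlg F X →ₗ[F] F}
    {e : StarAlg F X} (he : IsAssociatedIdempotent ν e) (R' : Type u) [CommRing R']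
    [Algebra R R'] (F' : Type u) [Field F'] [Algebra R F'] [Algebra F F'] [IsScalarTower R F F']
    [Algebra R' F'] [IsScalarTower R R' F'] :
    IsIdempotentElem (StarAlg.ascend R' F' X e) :=
  he.isIdempotentElem.map _

/-! ### The defect of a character -/

variable (F)

/-- The `R`-submodule spanned by `Irr_F(X)`, in the space of `F`-valued forms on `R_* X`. -/
def charSpan (X : StarGroup R) : Submodule R (StarAlg R X →ₗ[R] F) :=
  Submodule.span R {f | ∃ χ ∈ Irr F X,
    f = (χ.restrictScalars R) ∘ₗ (StarAlg.scalar F X).toLinearMap}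

/-- The ideal of the center of `R_* X` determined by the submodule spanned by the irreducible
characters in the module of symmetric `R`-linear forms on `R_* X`. -/
def zCh (X : StarGroup R) : Set (StarAlg R X) :=
  {z | z ∈ Subalgebra.center R (StarAlg R X) ∧
    ∀ μ : StarAlg R X →ₗ[R] R, (∀ a b, μ (a * b) = μ (b * a)) →
      (Algebra.linearMap R F) ∘ₗ μ ∘ₗ LinearMap.mulLeft R z ∈ charSpan F X}

variable {F}

/-- `d` is the defect of the irreducible character `χ` of `X` with respect to `p`: the image of
the ideal `zCh F X` by `χ / χ(1)` is `p ^ d R`. -/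
def HasDefect (p : ℕ) {X : StarGroup R} (χ : StarAlg F X →ₗ[F] F) (d : ℕ) : Prop :=
  (fun z => χ (StarAlg.scalar F X z) / χ 1) '' zCh F X =
    Set.range (fun r : R => (p : F) ^ d * algebraMap R F r)

end characters

/-! ### Corner algebras -/

section corner

variable {F A : Type u} [Field F] [Ring A] [Algebra F A] {e : A}

abbrev cornerModule (he : IsIdempotentElem e) : Module F he.Corner where
  smul c a := ⟨c • a.1, by
    obtain ⟨r, hr⟩ := a.2
    exact ⟨c • r, by simp only [← hr, mul_smul_comm, smul_mul_assoc]⟩⟩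
  one_smul a := Subtype.ext (one_smul _ _)
  mul_smul c d a := Subtype.ext (mul_smul _ _ _)
  smul_zero c := Subtype.ext (smul_zero _)
  smul_add c a b := Subtype.ext (smul_add _ _ _)
  add_smul c d a := Subtype.ext (add_smul _ _ _)
  zero_smul a := Subtype.ext (zero_smul _ _)

instance cornerAlgebra (he : IsIdempotentElem e) : Algebra F he.Corner :=
  letI := cornerModule (F := F) he
  Algebra.ofModule (fun _ _ _ => Subtype.ext (smul_mul_assoc _ _ _))
    (fun _ _ _ => Subtype.ext (mul_smul_comm _ _ _))

/-- The element `e a e` of the algebra `e A e`; for central `e` this is `a e` in `A e`. -/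
def toCorner (he : IsIdempotentElem e) (a : A) : he.Corner := ⟨e * a * e, a, rfl⟩

/-- The inclusion of `e A e` in `A`. -/
def cornerVal (he : IsIdempotentElem e) : he.Corner →ₗ[F] A where
  toFun a := a.1
  map_add' _ _ := rfl
  map_smul' _ _ := rfl

end corner

/-! ### Induced algebras -/

section induction

variable {F L X B : Type u} [Field F] [Group L] [Group X] [Ring B] [Algebra F B]

open Classical in
/-- The map `s : L → Bˣ` seen as a map on the image of `L` in `X`, extended by zero to `X`. -/
def extendZero (j : L →* X) (s : L →* Bˣ) (x : X) : B :=
  if h : ∃ l, j l = x then (s h.choose : B) else 0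

theorem extendZero_apply {j : L →* X} (hj : Function.Injective j) (s : L →* Bˣ) (l : L) :
    extendZero j s (j l) = s l := by
  have h : ∃ l', j l' = j l := ⟨l, rfl⟩
  rw [extendZero, dif_pos h, hj h.choose_spec]

theorem extendZero_of_notMem {j : L →* X} (s : L →* Bˣ) {x : X} (h : x ∉ j.range) :
    extendZero j s x = 0 := dif_neg h

theorem extendZero_mul_right {j : L →* X} (hj : Function.Injective j) (s : L →* Bˣ) (x : X)
    (l : L) : extendZero j s (x * j l) = extendZero j s x * s l := by
  by_cases h : x ∈ j.range
  · obtain ⟨m, rfl⟩ := h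
    rw [← map_mul, extendZero_apply hj, extendZero_apply hj, map_mul, Units.val_mul]
  · rw [extendZero_of_notMem s h, zero_mul, extendZero_of_notMem s]
    intro h'
    exact h ((j.range.mul_mem_cancel_right ⟨l, rfl⟩).1 h')

theorem extendZero_mul_left {j : L →* X} (hj : Function.Injective j) (s : L →* Bˣ) (x : X)
    (l : L) : extendZero j s (j l * x) = s l * extendZero j s x := by
  by_cases h : x ∈ j.range
  · obtain ⟨m, rfl⟩ := h
    rw [← map_mul, extendZero_apply hj, extendZero_apply hj, map_mul, Units.val_mul]
  · rw [extendZero_of_notMem s h, mul_zero, extendZero_of_notMem s]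
    intro h'
    exact h ((j.range.mul_mem_cancel_left ⟨l, rfl⟩).1 h')

/-- The algebra induced from `L` to `X` by the algebra `B` with the structural homomorphism `s`,
where `j` embeds `L` in `X` as a subgroup of finite index. An element of the tensor product
`(F X) ⊗_{F L} B ⊗_{F L} (F X)` is represented by a map `f : X × X → B` with
`f (u l, v m) = l⁻¹ f (u, v) m` for `l, m` in `L`: the element `x ⊗ b ⊗ y` is represented by the map
which sends `(u, v)` to `(u⁻¹ x) b (y v)` if `u⁻¹ x` and `y v` belong to `L`, and to `0` otherwise;
see `Ind.tmul`. The product is that of matrices indexed by `X / L`; see `Ind.tmul_mul_tmul`. -/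
def Ind (F : Type u) {L X B : Type u} [Field F] [Group L] [Group X] [Ring B] [Algebra F B]
    {j : L →* X} (_hj : Function.Injective j) (s : L →* Bˣ) : Submodule F (X → X → B) where
  carrier := {f | ∀ u v l m, f (u * j l) (v * j m) = (s l⁻¹ : B) * f u v * s m}
  add_mem' := fun {f g} hf hg u v l m => by
    change f _ _ + g _ _ = _ * (f u v + g u v) * _
    rw [hf, hg, mul_add, add_mul]
  zero_mem' := fun u v l m => by
    change (0 : B) = _ * 0 * _
    rw [mul_zero, zero_mul]
  smul_mem' := fun c f hf u v l m => by
    change c • f _ _ = _ * (c • f u v) * _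
    rw [hf, mul_smul_comm, smul_mul_assoc]

namespace Ind

variable {j : L →* X} {hj : Function.Injective j} {s : L →* Bˣ}

theorem map_mul_right (f : Ind F hj s) (u v : X) (m : L) :
    f.1 u (v * j m) = f.1 u v * s m := by
  have h := f.2 u v 1 m
  simpa using h

theorem map_mul_left (f : Ind F hj s) (u v : X) (l : L) :
    f.1 (u * j l) v = (s l⁻¹ : B) * f.1 u v := by
  have h := f.2 u v l 1
  simpa using h

/-- The summand in the matrix product depends only on the class of the middle index. -/
theorem mul_summand (f g : Ind F hj s) (u v z : X) (l : L) :
    f.1 u (z * j l) * g.1 (z * j l) v = f.1 u z * g.1 z v := by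
  rw [map_mul_right, map_mul_left, mul_assoc, ← mul_assoc (s l : B), ← Units.val_mul,
    ← map_mul, mul_inv_cancel, map_one, Units.val_one, one_mul]

theorem out_eq (j : L →* X) (z : X) :
    ∃ l : L, (QuotientGroup.mk z : X ⧸ j.range).out = z * j l := by
  obtain ⟨⟨_, l, rfl⟩, h⟩ := QuotientGroup.mk_out_eq_mul j.range z
  exact ⟨l, h⟩

theorem mul_summand_out (f g : Ind F hj s) (u v z : X) :
    f.1 u (QuotientGroup.mk z : X ⧸ j.range).out * g.1 (QuotientGroup.mk z : X ⧸ j.range).out v =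
      f.1 u z * g.1 z v := by
  obtain ⟨l, h⟩ := out_eq j z
  rw [h, mul_summand]

instance : Mul (Ind F hj s) where
  mul f g := ⟨fun u v => ∑ᶠ q : X ⧸ j.range, f.1 u q.out * g.1 q.out v, by
    intro u v l m
    simp only [map_mul_left, map_mul_right]
    have e : ∀ q : X ⧸ j.range, (s l⁻¹ : B) * f.1 u q.out * (g.1 q.out v * s m) =
        s l⁻¹ * ((f.1 u q.out * g.1 q.out v) * s m) := fun q => by simp only [mul_assoc]
    have h1 : ∀ q : X ⧸ j.range, q = q := fun _ => rfl
    by_cases hs : (Function.support fun q : X ⧸ j.range => f.1 u q.out * g.1 q.out v).Finite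
    · rw [mul_assoc, finsum_mul' _ _ hs, mul_finsum']
      · exact finsum_congr e
      · exact hs.subset (Function.support_mul_subset_left _ _)
    · rw [finsum_of_infinite_support hs, mul_zero, zero_mul, finsum_of_infinite_support]
      intro hs'
      refine hs (hs'.subset fun q hq h0 => hq ?_)
      have h0' : (s l⁻¹ : B) * f.1 u q.out * (g.1 q.out v * s m) = 0 := h0
      rw [e, Units.mul_right_eq_zero, Units.mul_left_eq_zero] at h0'
      exact h0'⟩

theorem mul_apply (f g : Ind F hj s) (u v : X) :
    (f * g).1 u v = ∑ᶠ q : X ⧸ j.range, f.1 u q.out * g.1 q.out v := rfl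

variable (F hj s) in
/-- The element `x ⊗ b ⊗ y` of the induced algebra. -/
def tmul (x : X) (b : B) (y : X) : Ind F hj s :=
  ⟨fun u v => extendZero j s (u⁻¹ * x) * b * extendZero j s (y * v), by
    intro u v l m
    change extendZero j s ((u * j l)⁻¹ * x) * b * extendZero j s (y * (v * j m)) = _
    rw [mul_inv_rev, ← map_inv, mul_assoc (j l⁻¹), extendZero_mul_left hj, ← mul_assoc y,
      extendZero_mul_right hj]
    simp only [mul_assoc]⟩

theorem tmul_mul_right_left (x y : X) (b : B) (l m : L) :
    tmul F hj s (x * j l) b (j m * y) = tmul F hj s x (s l * b * s m) y := by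
  refine Subtype.ext (funext fun u => funext fun v => ?_)
  change extendZero j s (u⁻¹ * (x * j l)) * b * extendZero j s (j m * y * v) =
    extendZero j s (u⁻¹ * x) * (s l * b * s m) * extendZero j s (y * v)
  rw [← mul_assoc u⁻¹, extendZero_mul_right hj, mul_assoc (j m), extendZero_mul_left hj]
  simp only [mul_assoc]

theorem tmul_mul_tmul (x y x' y' : X) (b b' : B) :
    tmul F hj s x b y * tmul F hj s x' b' y' =
      tmul F hj s x (b * extendZero j s (y * x') * b') y' := by
  refine Subtype.ext (funext fun u => funext fun v => ?_)
  rw [mul_apply, finsum_eq_single _ (QuotientGroup.mk x' : X ⧸ j.range), mul_summand_out]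
  · change extendZero j s (u⁻¹ * x) * b * extendZero j s (y * x') *
      (extendZero j s (x'⁻¹ * x') * b' * extendZero j s (y' * v)) =
      extendZero j s (u⁻¹ * x) * (b * extendZero j s (y * x') * b') * extendZero j s (y' * v)
    have h1 : extendZero j s (x'⁻¹ * x') = 1 := by
      rw [inv_mul_cancel, ← map_one j, extendZero_apply hj, map_one, Units.val_one]
    rw [h1]
    simp only [mul_assoc, one_mul]
  · intro q hq
    change _ * (extendZero j s (q.out⁻¹ * x') * b' * _) = 0
    rw [extendZero_of_notMem s, zero_mul, zero_mul, mul_zero]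
    intro h
    exact hq ((QuotientGroup.out_eq' q).symm.trans (QuotientGroup.eq.2 h))

variable (F hj s) in
/-- The image `x Tr(1 ⊗ 1 ⊗ 1)` of `x` in the induced algebra, where the trace is the sum of the
elements `z ⊗ 1 ⊗ z⁻¹` for `z` in `X / L`. -/
def str (x : X) : Ind F hj s :=
  ⟨fun u v => extendZero j s (u⁻¹ * x * v), by
    intro u v l m
    change extendZero j s ((u * j l)⁻¹ * x * (v * j m)) = _
    rw [mul_inv_rev, ← map_inv, ← mul_assoc, extendZero_mul_right hj, mul_assoc (j l⁻¹),
      mul_assoc (j l⁻¹), extendZero_mul_left hj]⟩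

instance : One (Ind F hj s) := ⟨str F hj s 1⟩

theorem str_mul (x : X) (f : Ind F hj s) (u v : X) :
    (str F hj s x * f).1 u v = f.1 (x⁻¹ * u) v := by
  rw [mul_apply, finsum_eq_single _ (QuotientGroup.mk (x⁻¹ * u) : X ⧸ j.range), mul_summand_out]
  · change extendZero j s (u⁻¹ * x * (x⁻¹ * u)) * _ = _
    have h : u⁻¹ * x * (x⁻¹ * u) = j 1 := by rw [map_one]; group
    rw [h, extendZero_apply hj, map_one, Units.val_one, one_mul]
  · intro q hq
    change extendZero j s (u⁻¹ * x * q.out) * _ = 0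
    rw [extendZero_of_notMem s, zero_mul]
    intro h
    refine hq ((QuotientGroup.out_eq' q).symm.trans (QuotientGroup.eq.2 ?_).symm)
    rwa [mul_inv_rev, inv_inv]

theorem mul_one' (f : Ind F hj s) : f * 1 = f := by
  refine Subtype.ext (funext fun u => funext fun v => ?_)
  rw [mul_apply, finsum_eq_single _ (QuotientGroup.mk v : X ⧸ j.range), mul_summand_out]
  · change _ * extendZero j s (v⁻¹ * 1 * v) = _
    have h : v⁻¹ * 1 * v = j 1 := by rw [map_one]; group
    rw [h, extendZero_apply hj, map_one, Units.val_one, mul_one]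
  · intro q hq
    change _ * extendZero j s (q.out⁻¹ * 1 * v) = 0
    rw [extendZero_of_notMem s, mul_zero]
    intro h
    refine hq ((QuotientGroup.out_eq' q).symm.trans (QuotientGroup.eq.2 ?_))
    rwa [mul_one] at h

instance [j.range.FiniteIndex] : Ring (Ind F hj s) where
  __ := (inferInstance : AddCommGroup (Ind F hj s))
  mul_assoc f g h := by
    refine Subtype.ext (funext fun u => funext fun v => ?_)
    let _ := Fintype.ofFinite (X ⧸ j.range)
    simp only [mul_apply, finsum_eq_sum_of_fintype, Finset.sum_mul, Finset.mul_sum]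
    rw [Finset.sum_comm]
    simp only [mul_assoc]
  one_mul f := by
    refine Subtype.ext (funext fun u => funext fun v => ?_)
    change (str F hj s 1 * f).1 u v = _
    rw [str_mul, inv_one, one_mul]
  mul_one f := mul_one' f
  left_distrib f g h := by
    refine Subtype.ext (funext fun u => funext fun v => ?_)
    let _ := Fintype.ofFinite (X ⧸ j.range)
    change (f * (g + h)).1 u v = (f * g).1 u v + (f * h).1 u v
    simp only [mul_apply, finsum_eq_sum_of_fintype]
    rw [← Finset.sum_add_distrib]
    exact Finset.sum_congr rfl fun q _ => mul_add _ _ _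
  right_distrib f g h := by
    refine Subtype.ext (funext fun u => funext fun v => ?_)
    let _ := Fintype.ofFinite (X ⧸ j.range)
    change ((f + g) * h).1 u v = (f * h).1 u v + (g * h).1 u v
    simp only [mul_apply, finsum_eq_sum_of_fintype]
    rw [← Finset.sum_add_distrib]
    exact Finset.sum_congr rfl fun q _ => add_mul _ _ _
  zero_mul f := by
    refine Subtype.ext (funext fun u => funext fun v => ?_)
    change ((0 : Ind F hj s) * f).1 u v = 0
    rw [mul_apply]
    exact (finsum_congr fun q => zero_mul _).trans finsum_zero
  mul_zero f := by
    refine Subtype.ext (funext fun u => funext fun v => ?_)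
    change (f * (0 : Ind F hj s)).1 u v = 0
    rw [mul_apply]
    exact (finsum_congr fun q => mul_zero _).trans finsum_zero

instance [j.range.FiniteIndex] : Algebra F (Ind F hj s) :=
  Algebra.ofModule
    (fun c f g => by
      refine Subtype.ext (funext fun u => funext fun v => ?_)
      let _ := Fintype.ofFinite (X ⧸ j.range)
      change ((c • f) * g).1 u v = c • (f * g).1 u v
      simp only [mul_apply, finsum_eq_sum_of_fintype]
      rw [Finset.smul_sum]
      exact Finset.sum_congr rfl fun q _ => smul_mul_assoc _ _ _)
    (fun c f g => by
      refine Subtype.ext (funext fun u => funext fun v => ?_)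
      let _ := Fintype.ofFinite (X ⧸ j.range)
      change (f * (c • g)).1 u v = c • (f * g).1 u v
      simp only [mul_apply, finsum_eq_sum_of_fintype]
      rw [Finset.smul_sum]
      exact Finset.sum_congr rfl fun q _ => mul_smul_comm _ _ _)

end Ind

open Classical in
/-- The class function on `X` induced by the class function `f` on its subgroup `L` (embedded by
`j`): the sum over `z` in `X / L` of the values of `f` at `z⁻¹ x z`, where `f` is extended by zero. -/
def inducedFun (j : L →* X) (f : L → F) (x : X) : F :=
  ∑ᶠ z : X ⧸ j.range, if h : ∃ l, j l = z.out⁻¹ * x * z.out then f h.choose else 0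

end induction

/-! ### The extension of the stabilizer attached to an idempotent -/

/-- Let `i : N → H` be the inclusion of a normal `R^*`-subgroup and `e` an idempotent of `F_* N`
fixed by `H`. This is an `R^*`-group `grp` with the same `R^*`-quotient as `H`, containing `N` and
normalizing it (the conjugation action on `N` being that of `H`), together with an `R^*`-group
homomorphism `rho` from it to the invertible elements of `F_* N e`, lifting the action of `H` on
`F_* N e` and extending the structural homomorphism from `N`. -/
structure CliffordExtension {R : Type u} [CommRing R] {F : Type u} [Field F] [Algebra R F]
    {N H : StarGroup R} (i : StarGroup.Hom N H) {e : StarAlg F N}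
    (he : IsIdempotentElem e) where
  grp : StarGroup R
  proj : grp.carrier →* H.quo
  proj_surjective : Function.Surjective proj
  ker_proj : proj.ker = grp.units
  emb : StarGroup.Hom N grp
  emb_injective : Function.Injective emb.toMonoidHom
  proj_emb : ∀ n : N, proj (emb.toMonoidHom n) = QuotientGroup.mk (i.toMonoidHom n)
  normalizes : ∀ (y : grp) (h : H) (n n' : N), proj y = QuotientGroup.mk h →
    i.toMonoidHom n' = h * i.toMonoidHom n * h⁻¹ →
    y * emb.toMonoidHom n * y⁻¹ = emb.toMonoidHom n'
  rho : grp.carrier →* (he.Corner)ˣ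
  rho_unit : ∀ c : Rˣ, (rho (grp.unit c) : he.Corner) = algebraMap F he.Corner (algebraMap R F c)
  rho_emb : ∀ n : N, (rho (emb.toMonoidHom n) : he.Corner) = toCorner he (StarAlg.of F N n)
  rho_conj : ∀ (y : grp) (h : H) (n n' : N), proj y = QuotientGroup.mk h →
    i.toMonoidHom n' = h * i.toMonoidHom n * h⁻¹ →
    (rho y : he.Corner) * toCorner he (StarAlg.of F N n) * ((rho y)⁻¹ : (he.Corner)ˣ) =
      toCorner he (StarAlg.of F N n')

namespace CliffordExtension

variable {R : Type u} [CommRing R] {F : Type u} [Field F] [Algebra R F]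
  {N H : StarGroup R} {i : StarGroup.Hom N H} {e : StarAlg F N} {he : IsIdempotentElem e}
  (E : CliffordExtension i he)

theorem proj_unit (c : Rˣ) : E.proj (E.grp.unit c) = 1 := by
  have h : E.grp.unit c ∈ E.proj.ker := by rw [E.ker_proj]; exact ⟨c, rfl⟩
  exact h

theorem mk_unit (c : Rˣ) : QuotientGroup.mk' H.units (H.unit c) = 1 :=
  (QuotientGroup.eq_one_iff _).2 ⟨c, rfl⟩

/-- The pairs of elements of `H` and `grp` with the same image in the common `R^*`-quotient. -/
abbrev pairs : Subgroup (H.carrier × E.grp.op.carrier) :=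
  StarGroup.pullback H E.grp.op (QuotientGroup.mk' H.units) E.proj

/-- The `R^*`-group `H * grp°`. -/
def diff : StarGroup R :=
  StarGroup.star H E.grp.op (QuotientGroup.mk' H.units) E.proj mk_unit
    (fun c => E.proj_unit c⁻¹)

/-- The class in `H * grp°` of a pair of elements. -/
def diffMk : E.pairs →* E.diff :=
  StarGroup.starMk H E.grp.op (QuotientGroup.mk' H.units) E.proj mk_unit
    (fun c => E.proj_unit c⁻¹)

theorem diffMk_surjective : Function.Surjective E.diffMk :=
  StarGroup.starMk_surjective _ _ _ _ _ _

theorem diffMk_eq_unit (z : E.pairs) (c : Rˣ) : E.diffMk z = E.diff.unit c ↔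
    ∃ d : Rˣ, z.1.1 = H.unit (c * d) ∧ z.1.2 = E.grp.unit d := by
  refine (StarGroup.starMk_eq_unit H E.grp.op (QuotientGroup.mk' H.units) E.proj mk_unit
    (fun c => E.proj_unit c⁻¹) z c).trans (exists_congr fun d => and_congr_right fun _ => ?_)
  change _ = E.grp.unit d⁻¹⁻¹ ↔ _
  rw [inv_inv]

/-- The pair of images of an element of `N`. -/
def embPair : N.carrier →* E.pairs :=
  (i.toMonoidHom.prod (show N.carrier →* E.grp.op.carrier from E.emb.toMonoidHom)).codRestrict _
    (fun n => (E.proj_emb n).symm)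

/-- The canonical homomorphism from `N` to `H * grp°`; it is trivial on `Rˣ`, so that its image
is the `R^*`-quotient of `N`. -/
def embDiff : N.carrier →* E.diff := E.diffMk.comp E.embPair

/-- The pair formed by `h` and an element `y` of `grp` over it. -/
def pair (h : H) (y : E.grp) (hy : E.proj y = QuotientGroup.mk h) : E.pairs := ⟨(h, y), hy.symm⟩

theorem mem_range_embDiff (hi : i.toMonoidHom.range.Normal) (a : E.diff)
    (ha : a ∈ E.embDiff.range) (x : E.diff) : x * a * x⁻¹ ∈ E.embDiff.range := by
  obtain ⟨n, rfl⟩ := ha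
  obtain ⟨z, rfl⟩ := E.diffMk_surjective x
  obtain ⟨n', hn'⟩ := hi.conj_mem _ ⟨n, rfl⟩ z.1.1
  refine ⟨n', ?_⟩
  change E.diffMk (E.embPair n') = E.diffMk z * E.diffMk (E.embPair n) * (E.diffMk z)⁻¹
  rw [← map_inv, ← map_mul, ← map_mul]
  refine congrArg E.diffMk (Subtype.ext (Prod.ext hn' ?_))
  exact (E.normalizes z.1.2 z.1.1 n n' z.2.symm hn').symm

instance embDiff_normal [hi : i.toMonoidHom.range.Normal] : E.embDiff.range.Normal :=
  ⟨fun a ha x => E.mem_range_embDiff hi a ha x⟩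

theorem eq_one_of_unit_mem (c : Rˣ) (hc : E.diff.unit c ∈ E.embDiff.range) : c = 1 := by
  obtain ⟨n, hn⟩ := hc
  obtain ⟨d, h1, h2⟩ := (E.diffMk_eq_unit (E.embPair n) c).1 hn
  have h3 : n = N.unit d := E.emb_injective (h2.trans (E.emb.apply_unit d).symm)
  have h4 : H.unit d = H.unit (c * d) := by rw [← i.apply_unit, ← h3]; exact h1
  exact (right_eq_mul.1 (H.unit_injective h4))

/-- The `R^*`-group `(H * grp°) / N`, where `N` stands for the `R^*`-quotient of `N`. -/
def red [i.toMonoidHom.range.Normal] : StarGroup R :=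
  E.diff.quotient E.embDiff.range E.eq_one_of_unit_mem

/-- The class in `(H * grp°) / N` of a pair of elements. -/
def redMk [i.toMonoidHom.range.Normal] : E.pairs →* E.red :=
  (QuotientGroup.mk' E.embDiff.range).comp E.diffMk

/-- The algebra `F_* N e ⊗ F_* ((H * grp°) / N)`. -/
def tensorAlg [i.toMonoidHom.range.Normal] : Type u := he.Corner ⊗[F] StarAlg F E.red

instance [i.toMonoidHom.range.Normal] : Ring E.tensorAlg :=
  inferInstanceAs (Ring (he.Corner ⊗[F] StarAlg F E.red))

instance [i.toMonoidHom.range.Normal] : Algebra F E.tensorAlg :=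
  inferInstanceAs (Algebra F (he.Corner ⊗[F] StarAlg F E.red))

/-- The tensor product of two elements. -/
def tensorMk [i.toMonoidHom.range.Normal] (a : he.Corner) (b : StarAlg F E.red) : E.tensorAlg :=
  a ⊗ₜ[F] b

theorem tensorMk_mul [i.toMonoidHom.range.Normal] (a a' : he.Corner) (b b' : StarAlg F E.red) :
    E.tensorMk (a * a') (b * b') = E.tensorMk a b * E.tensorMk a' b' :=
  (Algebra.TensorProduct.tmul_mul_tmul a a' b b').symm

theorem tensorMk_one [i.toMonoidHom.range.Normal] : E.tensorMk 1 1 = 1 := rfl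

/-- The element `n e ⊗ 1` of `F_* N e ⊗ F_* ((H * grp°) / N)`. -/
def baseElem [i.toMonoidHom.range.Normal] (n : N) : E.tensorAlg :=
  E.tensorMk (toCorner he (StarAlg.of F N n)) 1

/-- The homomorphism mapping a pair `(h, y)` to the tensor product of the images of `y` and of the
class of `(h, y)`. -/
def pairsHom [i.toMonoidHom.range.Normal] : E.pairs →* E.tensorAlg where
  toFun z := E.tensorMk (E.rho z.1.2 : he.Corner) (StarAlg.of F E.red (E.redMk z))
  map_one' := by
    have h : ((1 : E.pairs).1.2 : E.grp) = 1 := rfl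
    rw [h, map_one, map_one, map_one, Units.val_one, tensorMk_one]
  map_mul' z w := by
    have h : ((z * w).1.2 : E.grp) = (z.1.2 : E.grp) * (w.1.2 : E.grp) := rfl
    rw [h, map_mul, map_mul, map_mul, Units.val_mul, tensorMk_mul]

/-- The first projection. -/
def pairsFst : E.pairs →* H.carrier := (MonoidHom.fst _ _).comp E.pairs.subtype

theorem pairsFst_surjective : Function.Surjective E.pairsFst := fun h => by
  obtain ⟨y, hy⟩ := E.proj_surjective (QuotientGroup.mk h)
  exact ⟨E.pair h y hy, rfl⟩

theorem redMk_of_fst_eq_one [i.toMonoidHom.range.Normal] (z : E.pairs) (hz : z.1.1 = 1) :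
    ∃ c : Rˣ, z.1.2 = E.grp.unit c ∧ E.redMk z = E.red.unit c⁻¹ := by
  have h : E.proj z.1.2 = 1 := by
    have h1 : QuotientGroup.mk' H.units z.1.1 = E.proj z.1.2 := z.2
    rw [← h1, hz, map_one]
  have h2 : z.1.2 ∈ E.grp.units := by rw [← E.ker_proj]; exact h
  obtain ⟨c, hc⟩ := h2
  refine ⟨c, hc.symm, congrArg (QuotientGroup.mk' E.embDiff.range) ?_⟩
  exact (E.diffMk_eq_unit z c⁻¹).2 ⟨c, by rw [hz, inv_mul_cancel, map_one], hc.symm⟩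

theorem pairsHom_eq_one [i.toMonoidHom.range.Normal] (z : E.pairs) (hz : z.1.1 = 1) :
    E.pairsHom z = 1 := by
  obtain ⟨c, h1, h2⟩ := E.redMk_of_fst_eq_one z hz
  change (E.rho z.1.2 : he.Corner) ⊗ₜ[F] StarAlg.of F E.red (E.redMk z) = 1 ⊗ₜ[F] 1
  rw [h1, h2, E.rho_unit, StarAlg.of_unit, Algebra.algebraMap_eq_smul_one (A := he.Corner),
    Algebra.algebraMap_eq_smul_one (A := StarAlg F E.red), TensorProduct.smul_tmul_smul, ← map_mul, Units.mul_inv,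
    map_one, one_smul]

/-- The structural homomorphism of the `H`-interior algebra `F_* N e ⊗ F_* ((H * grp°) / N)`: it
maps `h` to the tensor product of the images of `y` and of the class of `(h, y)`, for any `y` in
`grp` over `h`. -/
def struct [i.toMonoidHom.range.Normal] : H.carrier →* (E.tensorAlg)ˣ :=
  MonoidHom.liftOfSurjective E.pairsFst E.pairsFst_surjective
    ⟨E.pairsHom.toHomUnits, fun z hz => Units.ext (E.pairsHom_eq_one z hz)⟩

theorem struct_apply [i.toMonoidHom.range.Normal] (h : H) (y : E.grp)
    (hy : E.proj y = QuotientGroup.mk h) :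
    (E.struct h : E.tensorAlg) =
      E.tensorMk (E.rho y : he.Corner) (StarAlg.of F E.red (E.redMk (E.pair h y hy))) :=
  congrArg Units.val (MonoidHom.liftOfRightInverse_comp_apply E.pairsFst _ _ _
    (E.pair h y hy))

/-- The character `Ext` of `grp` afforded by `rho` and by the simple `F_* N e`-module with
character `ν`. -/
def extChar (ν : StarAlg F N →ₗ[F] F) (y : E.grp) : F := ν (cornerVal (F := F) he (E.rho y : he.Corner))

/-- The tensor product, a character of `grp * (H * grp°) ≅ H`, of the character `Ext` of `grp` and
of the restriction to `H * grp°` of a character `ζ` of `(H * grp°) / N`; its value at `h` is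
the product of the values at `y` and at the class of `(h, y)`, for any `y` in `grp` over `h`. -/
def extTensorRes [i.toMonoidHom.range.Normal] (ν : StarAlg F N →ₗ[F] F)
    (ζ : StarAlg F E.red →ₗ[F] F) (h : H) : F :=
  E.extChar ν (E.proj_surjective (QuotientGroup.mk h)).choose *
    ζ (StarAlg.of F E.red (E.redMk (E.pair h _ (E.proj_surjective _).choose_spec)))

/-- The value does not depend on the choice of `y`. -/
theorem extTensorRes_apply [i.toMonoidHom.range.Normal] (ν : StarAlg F N →ₗ[F] F)
    (ζ : StarAlg F E.red →ₗ[F] F) (h : H) (y : E.grp) (hy : E.proj y = QuotientGroup.mk h) :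
    E.extTensorRes ν ζ h =
      E.extChar ν y * ζ (StarAlg.of F E.red (E.redMk (E.pair h y hy))) := by
  have key : ∀ (y : E.grp) (hy : E.proj y = QuotientGroup.mk h),
      E.extChar ν y * ζ (StarAlg.of F E.red (E.redMk (E.pair h y hy))) =
        TensorProduct.lid F F (TensorProduct.map (ν ∘ₗ cornerVal (F := F) he) ζ
          (show he.Corner ⊗[F] StarAlg F E.red from (E.struct h : E.tensorAlg))) :=
      fun y hy => by
    rw [E.struct_apply h y hy]
    rfl
  exact (key _ _).trans (key y hy).symm

end CliffordExtension

/-! ### The stabilizer of a character of a normal subgroup -/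

namespace StarGroup

section stabilizer

variable {R : Type u} [CommRing R] {F : Type u} [Field F] [Algebra R F]
  {G : StarGroup R} {N : Subgroup G} [hNn : N.Normal] {hN : G.units ≤ N}

/-- The element `g n g⁻¹` of the normal subgroup `N`. -/
def conj (hN : G.units ≤ N) (g : G) (n : G.sub N hN) : G.sub N hN :=
  ⟨g * n.1 * g⁻¹, hNn.conj_mem n.1 n.2 g⟩

/-- The stabilizer in `G` of the character `ν` of the normal subgroup `N`. -/
def stab (ν : StarAlg F (G.sub N hN) →ₗ[F] F) : Subgroup G where
  carrier := {g | ∀ n, ν (StarAlg.of F _ (conj hN g n)) = ν (StarAlg.of F _ n)}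
  one_mem' := fun n => by
    have h : conj hN 1 n = n := Subtype.ext (by simp [conj])
    rw [h]
  mul_mem' := fun {a b} ha hb n => by
    have h : conj hN (a * b) n = conj hN a (conj hN b n) :=
      Subtype.ext (by simp [conj, mul_assoc])
    rw [h, ha, hb]
  inv_mem' := fun {a} ha n => by
    have h : n = conj hN a (conj hN a⁻¹ n) := Subtype.ext (by simp [conj, mul_assoc])
    conv_rhs => rw [h, ha]

theorem le_stab {ν : StarAlg F (G.sub N hN) →ₗ[F] F} (hν : IsAbsIrrChar ν) : N ≤ stab ν := by
  intro g hg n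
  have h : conj hN g n = (show G.sub N hN from ⟨g, hg⟩) * n *
      (show G.sub N hN from ⟨g, hg⟩)⁻¹ := rfl
  rw [h, map_mul, hν.mul_comm, ← map_mul, inv_mul_cancel_left]

theorem units_le_stab (ν : StarAlg F (G.sub N hN) →ₗ[F] F) : G.units ≤ stab ν := by
  rintro _ ⟨c, rfl⟩ n
  have h : conj hN (G.unit c) n = n := Subtype.ext (by
    change G.unit c * n.1 * (G.unit c)⁻¹ = n.1
    rw [G.unit_central, mul_inv_cancel_right])
  rw [h]

variable (R' : Type u) [CommRing R'] [Algebra R R']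

/-- The inclusion of `N^{R'}` in `H^{R'}` where `H` is the stabilizer of `ν`. -/
def stabIncl {ν : StarAlg F (G.sub N hN) →ₗ[F] F} (hν : IsAbsIrrChar ν) :
    Hom ((G.sub N hN).baseChange R') ((G.sub (stab ν) (units_le_stab ν)).baseChange R') :=
  bcMap R' (G.inclusion hN (units_le_stab ν) (le_stab hν))

instance stabIncl_normal {ν : StarAlg F (G.sub N hN) →ₗ[F] F} (hν : IsAbsIrrChar ν) :
    (stabIncl R' hν).toMonoidHom.range.Normal := by
  refine ⟨?_⟩
  rintro _ ⟨n, rfl⟩ h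
  obtain ⟨⟨c, n⟩, rfl⟩ := bcMk_surjective R' _ n
  obtain ⟨⟨d, h⟩, rfl⟩ := bcMk_surjective R' _ h
  refine ⟨bcMk R' _ (c, conj hN h.1 n), ?_⟩
  refine (bcMap_bcMk R' _ _ _).trans ?_
  refine Eq.trans ?_ (congrArg (fun z => bcMk R' _ (d, h) * z * (bcMk R' _ (d, h))⁻¹)
    (bcMap_bcMk R' (G.inclusion hN (units_le_stab ν) (le_stab hν)) c n).symm)
  rw [← map_inv, ← map_mul, ← map_mul]
  congr 1
  refine Prod.ext ?_ rfl
  change c = d * c * d⁻¹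
  rw [mul_comm d c, mul_inv_cancel_right]

/-- The inclusion of `H^{R'}` in `G^{R'}`. -/
abbrev stabHom (ν : StarAlg F (G.sub N hN) →ₗ[F] F) :
    Hom ((G.sub (stab ν) (units_le_stab ν)).baseChange R') (G.baseChange R') :=
  bcMap R' (G.subHom (stab ν) (units_le_stab ν))

theorem stabHom_injective (ν : StarAlg F (G.sub N hN) →ₗ[F] F) :
    Function.Injective (stabHom R' ν).toMonoidHom :=
  bcMap_injective R' _ Subtype.val_injective

variable {R'} in
/-- The image of `e` in `F'_* G^{R'}`. -/
def idemIn (F' : Type u) [Field F'] [Algebra R F'] [Algebra F F'] [IsScalarTower R F F']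
    [Algebra R' F'] [IsScalarTower R R' F'] (e : StarAlg F (G.sub N hN)) :
    StarAlg F' (G.baseChange R') :=
  StarAlg.map F' (bcMap R' (G.subHom N hN)) (StarAlg.ascend R' F' (G.sub N hN) e)

/-- The trace `Tr_H^G(e)` in `F'_* G^{R'}`: the sum of the conjugates of `e` by a set of
representatives of `G / H`, where `H` is the stabilizer of `ν`. -/
def idemTrace (F' : Type u) [Field F'] [Algebra R F'] [Algebra F F'] [IsScalarTower R F F']
    [Algebra R' F'] [IsScalarTower R R' F'] (ν : StarAlg F (G.sub N hN) →ₗ[F] F)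
    (e : StarAlg F (G.sub N hN)) : StarAlg F' (G.baseChange R') :=
  ∑ᶠ q : G.carrier ⧸ stab ν, StarAlg.of F' _ (G.bcOf R' q.out) * idemIn F' e *
    StarAlg.of F' _ (G.bcOf R' q.out⁻¹)

end stabilizer

end StarGroup

end

open scoped Matrix

noncomputable section

/-! ### Idempotent matrices -/

/-! Two notions carry the argument: the symmetrizing form of a twisted group algebra, and the matrix
blocks of an algebra. Below, |X| is the order of the `R^*`-quotient of X.

The form `StarAlg.unitForm`, the coefficient of 1, is nondegenerate with dual bases x and x⁻¹. So
`StarAlg.dual` turns linear forms into elements, and symmetric forms into central elements. A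
`MatBlock` is a direct factor which is a full matrix algebra. By Burnside's theorem and Schur's
relation `dual_trace_apply`, an absolutely irreducible character in characteristic zero is the trace
form of a block (`IsAbsIrrChar.exists_block`), and the central idempotent of this block is the one
associated with the character.

Existence of the extension of H. An element g of the stabilizer twists the representation of N into
an equivalent one, so it acts through some b in GL_n(K), and with m = |G| the power b^m is a scalar
c. The residue field being algebraically closed, the extension K'/K is totally ramified; as m
divides its degree, some l satisfies l^m c ∈ O'ˣ (`exists_pow_mul_eq_unit`). Then lb has its
determinant in O'ˣ. The pairs formed by an element of H and such a matrix inducing the same action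
on N form the required group: over 1 one finds the scalars with n-th power in O'ˣ, which are those
of O'ˣ (`MatBlock.exists_cliffordExtension`).

The isomorphism with the induced algebra. The conjugates of e by elements outside H are orthogonal
to e, so Tr(e) is a central idempotent. The structural map from the group algebra to the induced
algebra sends e to 1 ⊗ 1 ⊗ 1 and Tr(e) to 1, and it is surjective. Injectivity on the direct factor
comes from a comparison of forms: the form induced by ν ⊗ `unitForm` pulls back to a nonzero
multiple of a ↦ `unitForm`(Tr(e) a), which is nondegenerate there (`CliffordExtension.form_toInd`).

The correspondence of characters. If ε is a diagonal matrix unit of the block of ν, then c ↦ 1 ⊗ (ε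
⊗ c) ⊗ 1 identifies the algebra of (H * grp°)/N with a corner of the induced algebra, hence with a
corner of the algebra of G. A decomposition in blocks passes to corners, some blocks possibly
becoming zero. A symmetric form on the induced algebra is determined by its restriction to this
corner (`CliffordExtension.form_unique`), so the character of a block of G is the form induced by ν
⊗ ζ, which is the asserted formula.

The defects. Testing against `unitForm` in one direction, and using the element dual to χ in the
other, one finds that the image of the ideal is (|X|/χ(1))R (`MatBlock.image_zCh`). Integers prime
to p are units of R, so the defect is the p-adic valuation of |X|/χ(1). Additivity follows from χ(1)
= |G:H| ν(1) ζ(1) and |G| = |G:H| |N| |H/N|. -/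

theorem Matrix.exists_rank_factorization {F : Type*} [Field F] {d : ℕ}
    (ε : Matrix (Fin d) (Fin d) F) (hε : IsIdempotentElem ε) :
    ∃ (r : ℕ) (P : Matrix (Fin d) (Fin r) F) (Q : Matrix (Fin r) (Fin d) F),
      Q * P = 1 ∧ P * Q = ε := by
  let f : (Fin d → F) →ₗ[F] (Fin d → F) := Matrix.toLin' ε
  have hf : ∀ v, f (f v) = f v := fun v => by
    simp only [f, Matrix.toLin'_apply, Matrix.mulVec_mulVec]
    rw [hε.eq]
  -- `P` embeds the range of ε in the coordinates of a basis, and `Q` is ε followed by these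
  -- coordinates; `Q * P = 1` because ε is the identity on its range.
  let b := Module.finBasis F (LinearMap.range f)
  let P : (Fin (Module.finrank F (LinearMap.range f)) → F) →ₗ[F] (Fin d → F) :=
    (LinearMap.range f).subtype ∘ₗ b.equivFun.symm.toLinearMap
  let Q : (Fin d → F) →ₗ[F] (Fin (Module.finrank F (LinearMap.range f)) → F) :=
    b.equivFun.toLinearMap ∘ₗ f.rangeRestrict
  refine ⟨_, LinearMap.toMatrix' P, LinearMap.toMatrix' Q, ?_, ?_⟩
  · rw [← LinearMap.toMatrix'_comp]
    have : Q ∘ₗ P = LinearMap.id := by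
      ext1 v
      ext1
      simp only [Q, P, LinearMap.comp_apply, LinearEquiv.coe_coe, LinearMap.id_apply,
        Submodule.subtype_apply]
      have h : ∀ x : LinearMap.range f, f.rangeRestrict x.1 = x := by
        rintro ⟨_, w, rfl⟩
        exact Subtype.ext (hf w)
      rw [h, LinearEquiv.apply_symm_apply]
    rw [this, LinearMap.toMatrix'_id]
  · rw [← LinearMap.toMatrix'_comp]
    have : P ∘ₗ Q = f := by
      refine LinearMap.ext fun v => ?_
      simp [P, Q]
    rw [this, LinearMap.toMatrix'_toLin']

/-! ### Matrix blocks of an algebra -/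

/-- A direct factor of the algebra `A` which is a matrix algebra: the projection `π` and
the section `σ` onto a two-sided ideal. -/
structure MatBlock (F A : Type*) [Field F] [Ring A] [Algebra F A] (n : ℕ) where
  π : A →ₐ[F] Matrix (Fin n) (Fin n) F
  σ : Matrix (Fin n) (Fin n) F →ₗ[F] A
  π_σ : ∀ m, π (σ m) = m
  mul_σ : ∀ a m, a * σ m = σ (π a * m)
  σ_mul : ∀ m a, σ m * a = σ (m * π a)

namespace MatBlock

variable {F A : Type*} [Field F] [Ring A] [Algebra F A] {n : ℕ} (β : MatBlock F A n)

/-- The central idempotent of a block. -/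
def e : A := β.σ 1

/-- The trace form of a block. -/
def char : A →ₗ[F] F := Matrix.traceLinearMap (Fin n) F F ∘ₗ β.π.toLinearMap

theorem char_apply (a : A) : β.char a = (β.π a).trace := rfl

theorem char_mul_comm (a b : A) : β.char (a * b) = β.char (b * a) := by
  rw [char_apply, char_apply, map_mul, map_mul, Matrix.trace_mul_comm]

theorem char_one : β.char 1 = n := by
  rw [char_apply, map_one, Matrix.trace_one, Fintype.card_fin]

theorem π_e : β.π β.e = 1 := β.π_σ 1

theorem mul_e (a : A) : a * β.e = β.σ (β.π a) := by rw [e, β.mul_σ, mul_one]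

theorem e_mul (a : A) : β.e * a = β.σ (β.π a) := by rw [e, β.σ_mul, one_mul]

theorem σ_mul_σ (m m' : Matrix (Fin n) (Fin n) F) : β.σ m * β.σ m' = β.σ (m * m') := by
  rw [β.mul_σ, β.π_σ]

theorem e_mem_center : β.e ∈ Subalgebra.center F A :=
  Subalgebra.mem_center_iff.2 fun a => by rw [mul_e, e_mul]

theorem e_isIdempotentElem : IsIdempotentElem β.e := by
  rw [IsIdempotentElem, mul_e, π_e]; rfl

theorem char_e : β.char β.e = n := by
  rw [char_apply, π_e, Matrix.trace_one, Fintype.card_fin]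

/-- A central element acts on a block as a scalar. -/
theorem exists_scalar_of_central {z : A} (hz : z ∈ Subalgebra.center F A) :
    ∃ c : F, β.π z = algebraMap F _ c := by
  have h : β.π z ∈ Subalgebra.center F (Matrix (Fin n) (Fin n) F) := by
    rw [Subalgebra.mem_center_iff]
    intro m
    rw [← β.π_σ m, ← map_mul, ← map_mul, Subalgebra.mem_center_iff.1 hz]
  rw [Algebra.IsCentral.center_eq_bot] at h
  obtain ⟨c, hc⟩ := h
  exact ⟨c, hc.symm⟩

/-- A central idempotent acts on a block as `0` or `1`. -/
theorem central_idempotent {z : A} (hz : z ∈ Subalgebra.center F A) (hi : IsIdempotentElem z) :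
    β.π z = 0 ∨ β.π z = 1 := by
  obtain ⟨c, hc⟩ := β.exists_scalar_of_central hz
  rcases n.eq_zero_or_pos with rfl | hn
  · exact Or.inl (Subsingleton.elim _ _)
  · have : NeZero n := ⟨hn.ne'⟩
    have h : algebraMap F (Matrix (Fin n) (Fin n) F) (c * c) = algebraMap F _ c := by
      rw [map_mul, ← hc, ← map_mul, hi.eq]
    have h2 : IsIdempotentElem c := FaithfulSMul.algebraMap_injective _ _ h
    rcases IsIdempotentElem.iff_eq_zero_or_one.1 h2 with rfl | rfl
    · left; rw [hc, map_zero]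
    · right; rw [hc, map_one]

section module

variable {M : Type*} [AddCommGroup M] [Module F M] [Module A M] [IsScalarTower F A M]

/-- A module on which the idempotent of a block does not vanish has the simple module of the block
as a direct summand. -/
theorem exists_summand (m₀ : M) (hm : β.e • m₀ ≠ 0) :
    ∃ (ι : (Fin n → F) →ₗ[F] M) (p : M →ₗ[F] (Fin n → F)),
      (∀ a v, ι (β.π a *ᵥ v) = a • ι v) ∧ (∀ (a : A) m, p (a • m) = β.π a *ᵥ p m) ∧
      ∀ v, p (ι v) = v := by
  -- The idempotent of the block is the sum of the images of the diagonal matrix units, so one of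
  -- them does not kill `m₀`.
  obtain ⟨i, hi⟩ : ∃ i, β.σ (Matrix.single i i 1) • m₀ ≠ 0 := by
    by_contra! h
    refine hm ?_
    have h1 : (1 : Matrix (Fin n) (Fin n) F) = ∑ i, Matrix.single i i 1 := by
      rw [Matrix.sum_single_one]
    rw [e, h1, map_sum, Finset.sum_smul]
    exact Finset.sum_eq_zero fun i _ => h i
  obtain ⟨l, hl⟩ : ∃ l : Module.Dual F M, l (β.σ (Matrix.single i i 1) • m₀) ≠ 0 := by
    by_contra! h
    exact hi ((Module.forall_dual_apply_eq_zero_iff F _).1 h)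
  set c := l (β.σ (Matrix.single i i 1) • m₀) with hc
  -- The vector v becomes the matrix with i-th column v and zeros elsewhere, applied to `m₀`;
  -- matrices supported on one column form the simple module of the block.
  let ι : (Fin n → F) →ₗ[F] M :=
    { toFun := fun v => β.σ (Matrix.vecMulVec v (Pi.single i 1)) • m₀
      map_add' := fun v w => by rw [Matrix.add_vecMulVec, map_add, add_smul]
      map_smul' := fun c v => by
        rw [Matrix.smul_vecMulVec, map_smul, smul_assoc, RingHom.id_apply] }
  -- The j-th coordinate is a matrix coefficient against `l` through the unit E_ij; the factor `c⁻¹`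
  -- makes `p ∘ ι` the identity.
  let p : M →ₗ[F] (Fin n → F) :=
    { toFun := fun m j => c⁻¹ * l (β.σ (Matrix.single i j 1) • m)
      map_add' := fun v w => by
        funext j
        simp only [smul_add, map_add, mul_add, Pi.add_apply]
      map_smul' := fun c v => by
        funext j
        simp only [RingHom.id_apply, Pi.smul_apply, smul_eq_mul]
        rw [← algebraMap_smul A c v, ← mul_smul, ← Algebra.commutes, mul_smul, algebraMap_smul,
          map_smul, smul_eq_mul, mul_left_comm] }
  refine ⟨ι, p, fun a v => ?_, fun a m => ?_, fun v => ?_⟩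
  · change β.σ _ • m₀ = a • β.σ _ • m₀
    rw [← mul_smul, β.mul_σ, Matrix.mul_vecMulVec]
  · funext j
    change c⁻¹ * l (β.σ _ • a • m) = ∑ k, β.π a j k * (c⁻¹ * l (β.σ _ • m))
    have h : Matrix.single i j 1 * β.π a = ∑ k, β.π a j k • Matrix.single i k (1 : F) := by
      ext r s
      simp only [Matrix.sum_apply, Matrix.smul_apply, Matrix.single_apply, smul_eq_mul]
      by_cases hr : i = r
      · subst hr
        simp
      · rw [Matrix.single_mul_apply_of_ne]
        · simp [hr]
        · exact fun h => hr h.symm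
    rw [← mul_smul, β.σ_mul, h, map_sum, Finset.sum_smul, map_sum, Finset.mul_sum]
    refine Finset.sum_congr rfl fun k _ => ?_
    rw [β.σ.map_smul, smul_assoc, l.map_smul, smul_eq_mul, mul_left_comm]
  · funext j
    change c⁻¹ * l (β.σ _ • β.σ _ • m₀) = v j
    have h : Matrix.single i j (1 : F) * Matrix.vecMulVec v (Pi.single i 1) =
        v j • Matrix.single i i 1 := by
      ext r s
      by_cases hr : i = r
      · subst hr
        simp [Matrix.vecMulVec_apply, Matrix.single_apply, Pi.single_apply, eq_comm]
      · rw [Matrix.single_mul_apply_of_ne]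
        · simp [hr]
        · exact fun h => hr h.symm
    rw [← mul_smul, β.σ_mul_σ, h, β.σ.map_smul, smul_assoc, l.map_smul, ← hc, smul_eq_mul, mul_comm,
      mul_inv_cancel_right₀ hl]

/-- A simple module on which the idempotent of a block does not vanish affords the
trace form of the block. -/
theorem trace_eq_of_isSimpleModule [IsSimpleModule A M] (m₀ : M) (hm : β.e • m₀ ≠ 0) (a : A) :
    LinearMap.trace F M (Algebra.lsmul F F M a) = β.char a := by
  obtain ⟨ι, p, hι, -, hpι⟩ := β.exists_summand m₀ hm
  have hinj : Function.Injective ι := Function.LeftInverse.injective hpι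
  let S : Submodule A M :=
    { carrier := LinearMap.range ι
      add_mem' := fun ha hb => (LinearMap.range ι).add_mem ha hb
      zero_mem' := (LinearMap.range ι).zero_mem
      smul_mem' := by
        rintro a _ ⟨v, rfl⟩
        exact ⟨_, hι a v⟩ }
  have hS : S = ⊤ := by
    refine (eq_bot_or_eq_top S).resolve_left fun h => ?_
    have h0 : ∀ v : Fin n → F, v = 0 := fun v => by
      have : ι v ∈ S := ⟨v, rfl⟩
      rw [h, Submodule.mem_bot] at this
      exact hinj (this.trans (map_zero ι).symm)
    have h1 : (1 : Matrix (Fin n) (Fin n) F) = 0 := by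
      ext i j
      have := congrFun (h0 (Pi.single i 1)) i
      simp at this
    apply hm
    rw [e, h1, map_zero, zero_smul]
  have hsurj : Function.Surjective ι := fun m => by
    have : m ∈ S := hS ▸ Submodule.mem_top
    exact this
  let E : (Fin n → F) ≃ₗ[F] M := LinearEquiv.ofBijective ι ⟨hinj, hsurj⟩
  have h : Algebra.lsmul F F M a = E.conj (Matrix.toLin' (β.π a)) := by
    refine LinearMap.ext fun m => ?_
    obtain ⟨v, rfl⟩ := E.surjective m
    rw [LinearEquiv.conj_apply_apply, LinearEquiv.symm_apply_apply, Matrix.toLin'_apply]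
    exact (hι a v).symm
  rw [h, LinearMap.trace_conj', Matrix.trace_toLin'_eq]
  rfl

end module

/-- Another matrix representation on which the idempotent of a block does not vanish
contains the block. -/
theorem exists_intertwiner {m : ℕ} (ρ : A →ₐ[F] Matrix (Fin m) (Fin m) F) (h : ρ β.e ≠ 0) :
    ∃ (b : Matrix (Fin m) (Fin n) F) (c : Matrix (Fin n) (Fin m) F), c * b = 1 ∧
      (∀ a, b * β.π a = ρ a * b) := by
  let _ : Module A (Fin m → F) := Module.compHom _ (Matrix.toLinAlgEquiv'.toAlgHom.comp ρ).toRingHom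
  have hs : ∀ (a : A) (v : Fin m → F), a • v = ρ a *ᵥ v := fun a v => rfl
  have : IsScalarTower F A (Fin m → F) := ⟨fun c a v => by
    rw [hs, hs, map_smul, Matrix.smul_mulVec]⟩
  obtain ⟨v, hv⟩ : ∃ v : Fin m → F, β.e • v ≠ 0 := by
    by_contra! h'
    refine h (Matrix.toLin'.injective (LinearMap.ext fun v => ?_))
    rw [map_zero, LinearMap.zero_apply, Matrix.toLin'_apply]
    exact h' v
  obtain ⟨ι, p, hι, -, hpι⟩ := β.exists_summand v hv
  refine ⟨LinearMap.toMatrix' ι, LinearMap.toMatrix' p, ?_, fun a => ?_⟩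
  · rw [← LinearMap.toMatrix'_comp, ← LinearMap.toMatrix'_id]
    exact congrArg _ (LinearMap.ext hpι)
  · apply Matrix.toLin'.injective
    rw [Matrix.toLin'_mul, Matrix.toLin'_mul, Matrix.toLin'_toMatrix']
    refine LinearMap.ext fun v => ?_
    simp only [LinearMap.comp_apply, Matrix.toLin'_apply]
    rw [hι, hs]

end MatBlock

/-! ### Reindexing sums over cosets -/

section cosets

variable {A A' M : Type*} [Group A] [Group A'] [AddCommMonoid M] {L : Subgroup A}
  {L' : Subgroup A'}

/-- `g` need not be a homomorphism: `hg` makes it well defined and injective on cosets, and `hs`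
makes it surjective. It serves for translations, for inversion, for base change and for arbitrary
choices of lifts. -/
theorem exists_quotient_equiv (g : A → A') (hg : ∀ a b, (g a)⁻¹ * g b ∈ L' ↔ a⁻¹ * b ∈ L)
    (hs : ∀ y, ∃ a, (g a)⁻¹ * y ∈ L') :
    ∃ E : A ⧸ L ≃ A' ⧸ L', ∀ a : A, E (QuotientGroup.mk a) = QuotientGroup.mk (g a) := by
  let f : A ⧸ L → A' ⧸ L' := Quotient.lift (fun a => (QuotientGroup.mk (g a) : A' ⧸ L'))
    fun a b h => QuotientGroup.eq.2 ((hg a b).2 (QuotientGroup.leftRel_apply.1 h))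
  refine ⟨Equiv.ofBijective f ⟨?_, ?_⟩, fun a => rfl⟩
  · intro a b
    induction a using QuotientGroup.induction_on with
    | H a =>
      induction b using QuotientGroup.induction_on with
      | H b => exact fun h => QuotientGroup.eq.2 ((hg a b).1 (QuotientGroup.eq.1 h))
  · intro y
    induction y using QuotientGroup.induction_on with
    | H y =>
      obtain ⟨a, ha⟩ := hs y
      exact ⟨QuotientGroup.mk a, QuotientGroup.eq.2 ha⟩

omit [AddCommMonoid M] in
theorem apply_out_of_invariant {φ : A → M} (hφ : ∀ x, ∀ l ∈ L, φ (x * l) = φ x) (x : A) :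
    φ (QuotientGroup.mk x : A ⧸ L).out = φ x := by
  obtain ⟨⟨l, hl⟩, h⟩ := QuotientGroup.mk_out_eq_mul L x
  rw [h]
  exact hφ x l hl

/-- `g` need not carry the chosen representatives of one side to those of the other; the invariance
of `φ` absorbs the difference. -/
theorem finsum_quotient_out (g : A → A') (hg : ∀ a b, (g a)⁻¹ * g b ∈ L' ↔ a⁻¹ * b ∈ L)
    (hs : ∀ y, ∃ a, (g a)⁻¹ * y ∈ L') {φ : A' → M} (hφ : ∀ x, ∀ l ∈ L', φ (x * l) = φ x) :
    ∑ᶠ q : A ⧸ L, φ (g q.out) = ∑ᶠ q : A' ⧸ L', φ q.out := by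
  obtain ⟨E, hE⟩ := exists_quotient_equiv g hg hs
  refine finsum_eq_of_bijective E E.bijective fun q => ?_
  conv_rhs => rw [← QuotientGroup.out_eq' q, hE]
  exact (apply_out_of_invariant hφ _).symm

theorem finsum_quotient_mul_left (x : A) {φ : A → M} (hφ : ∀ x, ∀ l ∈ L, φ (x * l) = φ x) :
    ∑ᶠ q : A ⧸ L, φ (x * q.out) = ∑ᶠ q : A ⧸ L, φ q.out :=
  finsum_quotient_out (x * ·) (fun a b => by rw [mul_inv_rev, mul_assoc, inv_mul_cancel_left])
    (fun y => ⟨x⁻¹ * y, by rw [mul_inv_cancel_left, inv_mul_cancel]; exact L.one_mem⟩) hφ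

theorem finsum_quotient_mul_right [L.Normal] (x : A) {φ : A → M}
    (hφ : ∀ x, ∀ l ∈ L, φ (x * l) = φ x) :
    ∑ᶠ q : A ⧸ L, φ (q.out * x) = ∑ᶠ q : A ⧸ L, φ q.out :=
  finsum_quotient_out (· * x)
    (fun a b => by
      rw [mul_inv_rev, mul_assoc, ← mul_assoc a⁻¹]
      refine ⟨fun h => ?_, fun h => ?_⟩
      · have h' := Subgroup.Normal.conj_mem ‹L.Normal› _ h x
        rwa [mul_inv_cancel_left, mul_inv_cancel_right] at h'
      · have h' := Subgroup.Normal.conj_mem ‹L.Normal› _ h x⁻¹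
        rwa [inv_inv, mul_assoc] at h')
    (fun y => ⟨y * x⁻¹, by rw [inv_mul_cancel_right, inv_mul_cancel]; exact L.one_mem⟩) hφ

theorem finsum_quotient_eq_single {φ : A → M} (hφ : ∀ x, ∀ l ∈ L, φ (x * l) = φ x) (x : A)
    (h0 : ∀ y, x⁻¹ * y ∉ L → φ y = 0) : ∑ᶠ q : A ⧸ L, φ q.out = φ x := by
  rw [finsum_eq_single _ (QuotientGroup.mk x : A ⧸ L), apply_out_of_invariant hφ]
  intro q hq
  refine h0 _ fun h => hq ?_
  rw [← QuotientGroup.out_eq' q]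
  exact (QuotientGroup.eq.2 h).symm

end cosets

/-! ### Spanning and induction principles for twisted group algebras -/

namespace StarAlg

variable {R : Type u} [CommRing R] {S : Type u} [CommRing S] [Algebra R S] {X : StarGroup R}

theorem span_of : Submodule.span S (Set.range (of S X)) = ⊤ := by
  rw [eq_top_iff]
  rintro a -
  obtain ⟨b, rfl⟩ := RingQuot.mkAlgHom_surjective S (Rel S X) a
  induction b using MonoidAlgebra.induction_on with
  | of x => exact Submodule.subset_span ⟨x, rfl⟩
  | add a b ha hb =>
    rw [map_add]
    exact Submodule.add_mem _ ha hb
  | smul c a ha =>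
    rw [map_smul]
    exact Submodule.smul_mem _ _ ha

@[elab_as_elim]
theorem induction_on {P : StarAlg S X → Prop} (a : StarAlg S X) (hof : ∀ x, P (of S X x))
    (hadd : ∀ a b, P a → P b → P (a + b)) (hsmul : ∀ (c : S) a, P a → P (c • a)) : P a := by
  have h : a ∈ Submodule.span S (Set.range (of S X)) := by rw [span_of]; trivial
  induction h using Submodule.span_induction with
  | mem a ha => obtain ⟨x, rfl⟩ := ha; exact hof x
  | zero => simpa using hsmul 0 _ (hof 1)
  | add a b _ _ ha hb => exact hadd a b ha hb
  | smul c a _ ha => exact hsmul c a ha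

theorem hom_ext {M : Type*} [AddCommMonoid M] [Module S M] {f g : StarAlg S X →ₗ[S] M}
    (h : ∀ x, f (of S X x) = g (of S X x)) : f = g := by
  refine LinearMap.ext fun a => ?_
  induction a using induction_on with
  | hof x => exact h x
  | hadd a b ha hb => rw [map_add, map_add, ha, hb]
  | hsmul c a ha => rw [map_smul, map_smul, ha]

theorem of_mul_unit (x : X) (c : Rˣ) :
    of S X (x * X.unit c) = algebraMap R S c • of S X x := by
  rw [map_mul, of_unit, ← Algebra.commutes, Algebra.smul_def]

theorem of_unit_mul (x : X) (c : Rˣ) :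
    of S X (X.unit c * x) = algebraMap R S c • of S X x := by
  rw [map_mul, of_unit, Algebra.smul_def]

theorem map_of {Y : StarGroup R} (f : StarGroup.Hom X Y) (x : X) :
    map S f (of S X x) = of S Y (f.toMonoidHom x) := lift_of _ _ _

theorem scalar_of (x : X) : scalar S X (of R X x) = of S X x := lift_of _ _ _

theorem mem_center_iff {T : Type u} [CommRing T] [Algebra T S] {a : StarAlg S X} :
    a ∈ Subalgebra.center T (StarAlg S X) ↔ ∀ x, of S X x * a = a * of S X x := by
  rw [Subalgebra.mem_center_iff]
  refine ⟨fun h x => h _, fun h b => ?_⟩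
  induction b using induction_on with
  | hof x => exact h x
  | hadd b c hb hc => rw [add_mul, mul_add, hb, hc]
  | hsmul c b hb => rw [smul_mul_assoc, mul_smul_comm, hb]

/-! ### The symmetrizing form -/

variable (S X)

/-- The functions `f` on `X` with `f (y c) = c⁻¹ f y` for `c` in `Rˣ`. -/
def regularModule : Submodule S (X → S) where
  carrier := {f | ∀ y c, f (y * X.unit c) = algebraMap R S (c⁻¹ : Rˣ) * f y}
  add_mem' := fun {f g} hf hg y c => by rw [Pi.add_apply, hf, hg, ← mul_add, Pi.add_apply]
  zero_mem' := fun y c => by rw [Pi.zero_apply, Pi.zero_apply, mul_zero]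
  smul_mem' := fun d f hf y c => by
    rw [Pi.smul_apply, hf, Pi.smul_apply, smul_eq_mul, smul_eq_mul, mul_left_comm]

/-- Left translation of functions. -/
def regularRep : X.carrier →* Module.End S (regularModule S X) where
  toFun x :=
    { toFun := fun f => ⟨fun y => f.1 (x⁻¹ * y), fun y c => by
        change f.1 (x⁻¹ * (y * X.unit c)) = _
        rw [← mul_assoc]
        exact f.2 _ c⟩
      map_add' := fun f g => rfl
      map_smul' := fun c f => rfl }
  map_one' := LinearMap.ext fun f => Subtype.ext (funext fun y => by simp)
  map_mul' x x' := LinearMap.ext fun f => Subtype.ext (funext fun y => by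
    simp [mul_assoc])

theorem regularRep_unit (c : Rˣ) : regularRep S X (X.unit c) = algebraMap S _ (algebraMap R S c) :=
  LinearMap.ext fun f => Subtype.ext (funext fun y => by
    change f.1 ((X.unit c)⁻¹ * y) = algebraMap R S c * f.1 y
    rw [← map_inv, X.unit_central, f.2, inv_inv])

open Classical in
/-- The function supported on `Rˣ` with the value `1` at `1`. -/
def unitFun : regularModule S X :=
  ⟨fun y => if h : ∃ c, X.unit c = y then algebraMap R S (h.choose⁻¹ : Rˣ) else 0, by
    intro y c
    change dite _ _ _ = _ * dite _ _ _
    by_cases h : ∃ d, X.unit d = y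
    · obtain ⟨d, rfl⟩ := h
      have h1 : ∃ d', X.unit d' = X.unit d := ⟨d, rfl⟩
      have h2 : ∃ d', X.unit d' = X.unit d * X.unit c := ⟨d * c, map_mul _ _ _⟩
      have e1 : h1.choose = d := X.unit_injective h1.choose_spec
      have e2 : h2.choose = d * c := X.unit_injective (h2.choose_spec.trans (map_mul _ _ _).symm)
      rw [dif_pos h1, dif_pos h2, e1, e2, mul_inv_rev, Units.val_mul, map_mul]
    · rw [dif_neg h, dif_neg, mul_zero]
      rintro ⟨d, hd⟩
      exact h ⟨d * c⁻¹, by rw [map_mul, hd, map_inv, mul_inv_cancel_right]⟩⟩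

/-- The linear form on `S_* X` taking the value `1` at `1` and vanishing on the elements of `X`
outside `Rˣ`. -/
def unitForm : StarAlg S X →ₗ[S] S :=
  -- The algebra is given by generators and relations; its action on functions on `X` produces a
  -- form with prescribed values, namely the value at 1 of the translate of `unitFun`.
  LinearMap.proj 1 ∘ₗ (regularModule S X).subtype ∘ₗ LinearMap.applyₗ (unitFun S X) ∘ₗ
    (lift (A := Module.End S (regularModule S X)) (regularRep S X)
      (regularRep_unit S X)).toLinearMap

theorem unitForm_of (x : X) : unitForm S X (of S X x) = (unitFun S X).1 x⁻¹ := by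
  have h : (lift (regularRep S X) (regularRep_unit S X)) (of S X x) = regularRep S X x :=
    lift_of _ _ _
  change ((lift (A := Module.End S (regularModule S X)) (regularRep S X) (regularRep_unit S X)
    (of S X x)) (unitFun S X)).1 1 = _
  rw [h]
  change (unitFun S X).1 (x⁻¹ * 1) = _
  rw [mul_one]

variable {X}

theorem unitForm_of_unit (c : Rˣ) : unitForm S X (of S X (X.unit c)) = algebraMap R S c := by
  have h1 : ∃ d, X.unit d = (X.unit c)⁻¹ := ⟨c⁻¹, map_inv _ _⟩
  have e1 : h1.choose = c⁻¹ := X.unit_injective (h1.choose_spec.trans (map_inv _ _).symm)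
  rw [unitForm_of]
  refine (dif_pos h1).trans ?_
  rw [e1, inv_inv]

theorem unitForm_one : unitForm S X 1 = 1 := by
  have h := unitForm_of_unit S (X := X) 1
  rwa [X.unit.map_one, (of S X).map_one, Units.val_one, (algebraMap R S).map_one] at h

theorem unitForm_of_notMem {x : X} (hx : x ∉ X.units) : unitForm S X (of S X x) = 0 := by
  rw [unitForm_of]
  refine dif_neg ?_
  rintro ⟨c, hc⟩
  exact hx ⟨c⁻¹, by rw [map_inv, hc, inv_inv]⟩

/-- If xy lies in the central subgroup `Rˣ` then yx = xy; otherwise neither product lies in it and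
both values are 0. -/
theorem unitForm_mul_comm (a b : StarAlg S X) : unitForm S X (a * b) = unitForm S X (b * a) := by
  induction a using induction_on with
  | hadd a a' ha ha' => rw [add_mul, mul_add, map_add, map_add, ha, ha']
  | hsmul c a ha => rw [smul_mul_assoc, mul_smul_comm, map_smul, map_smul, ha]
  | hof x =>
    induction b using induction_on with
    | hadd a a' ha ha' => rw [add_mul, mul_add, map_add, map_add, ha, ha']
    | hsmul c a ha => rw [smul_mul_assoc, mul_smul_comm, map_smul, map_smul, ha]
    | hof y =>
      rw [← map_mul, ← map_mul]
      by_cases h : x * y ∈ X.units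
      · obtain ⟨c, hc⟩ := h
        have h' : y * x = X.unit c := by
          rw [← mul_right_inj x, ← mul_assoc, ← hc, X.unit_central]
        rw [← hc, h']
      · rw [unitForm_of_notMem _ h, unitForm_of_notMem]
        exact fun h' => h ((X.units_normal.mem_comm_iff).1 h')

theorem unitForm_scalar (a : StarAlg R X) :
    unitForm S X (scalar S X a) = algebraMap R S (unitForm R X a) := by
  induction a using induction_on with
  | hadd a b ha hb => simp only [map_add, ha, hb]
  | hsmul c a ha =>
    rw [map_smul (scalar S X), (unitForm R X).map_smul, smul_eq_mul, map_mul, ← ha,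
      ← algebraMap_smul S, (unitForm S X).map_smul, smul_eq_mul]
  | hof x =>
    rw [scalar_of]
    by_cases h : x ∈ X.units
    · obtain ⟨c, rfl⟩ := h
      rw [unitForm_of_unit, unitForm_of_unit]
      rfl
    · rw [unitForm_of_notMem _ h, unitForm_of_notMem _ h, map_zero]

variable (X) [Finite X.quo]

/-- The element `∑ l (x⁻¹) x` of `S_* X` representing the linear form `l` with respect to
the form `unitForm`. -/
def dual : (StarAlg S X →ₗ[S] S) →ₗ[S] StarAlg S X :=
  letI := Fintype.ofFinite X.quo
  ∑ q : X.quo, (LinearMap.applyₗ (R := S) (of S X q.out⁻¹)).smulRight (of S X q.out)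

variable {X S}

theorem dual_apply (l : StarAlg S X →ₗ[S] S) :
    dual S X l = ∑ᶠ q : X.quo, l (of S X q.out⁻¹) • of S X q.out := by
  let _ := Fintype.ofFinite X.quo
  rw [finsum_eq_sum_of_fintype, dual, LinearMap.sum_apply]
  rfl

-- The factors c⁻¹ and c cancel, so each term of the sum defining `dual` depends only on the class
-- of `x`.
omit [Finite X.quo] in
theorem dual_summand_invariant (l : StarAlg S X →ₗ[S] S) (x : X) (u : X) (hu : u ∈ X.units) :
    l (of S X (x * u)⁻¹) • of S X (x * u) = l (of S X x⁻¹) • of S X x := by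
  obtain ⟨c, rfl⟩ := hu
  rw [mul_inv_rev, ← map_inv, of_mul_unit, of_unit_mul, map_smul, smul_smul, smul_eq_mul,
    mul_right_comm, ← map_mul, Units.inv_mul, map_one, one_mul]

/-- Reindexing the sum by left translation. Together with `dual_mul`, this makes `dual` a map of
bimodules, from which centrality of duals follows. -/
theorem mul_dual (a : StarAlg S X) (l : StarAlg S X →ₗ[S] S) :
    a * dual S X l = dual S X (l ∘ₗ LinearMap.mulRight S a) := by
  induction a using induction_on with
  | hadd a b ha hb =>
    rw [add_mul, ha, hb, ← map_add]
    congr 1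
    exact LinearMap.ext fun b => by simp [mul_add]
  | hsmul c a ha =>
    rw [smul_mul_assoc, ha, ← map_smul]
    congr 1
    exact LinearMap.ext fun b => by simp
  | hof x =>
    rw [dual_apply, dual_apply, ← finsum_quotient_mul_left x
      (φ := fun y => (l ∘ₗ LinearMap.mulRight S (of S X x)) (of S X y⁻¹) • of S X y)
      (fun y u hu => dual_summand_invariant _ y u hu)]
    let _ := Fintype.ofFinite X.quo
    rw [finsum_eq_sum_of_fintype, finsum_eq_sum_of_fintype, Finset.mul_sum]
    refine Finset.sum_congr rfl fun q _ => ?_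
    rw [mul_smul_comm, ← map_mul, LinearMap.comp_apply, LinearMap.mulRight_apply, ← map_mul,
      mul_inv_rev, inv_mul_cancel_right]

theorem dual_mul (a : StarAlg S X) (l : StarAlg S X →ₗ[S] S) :
    dual S X l * a = dual S X (l ∘ₗ LinearMap.mulLeft S a) := by
  induction a using induction_on with
  | hadd a b ha hb =>
    rw [mul_add, ha, hb, ← map_add]
    congr 1
    exact LinearMap.ext fun b => by simp [add_mul]
  | hsmul c a ha =>
    rw [mul_smul_comm, ha, ← map_smul]
    congr 1
    exact LinearMap.ext fun b => by simp
  | hof x =>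
    rw [dual_apply, dual_apply, ← finsum_quotient_mul_right x
      (φ := fun y => (l ∘ₗ LinearMap.mulLeft S (of S X x)) (of S X y⁻¹) • of S X y)
      (fun y u hu => dual_summand_invariant _ y u hu)]
    let _ := Fintype.ofFinite X.quo
    rw [finsum_eq_sum_of_fintype, finsum_eq_sum_of_fintype, Finset.sum_mul]
    refine Finset.sum_congr rfl fun q _ => ?_
    rw [smul_mul_assoc, ← map_mul, LinearMap.comp_apply, LinearMap.mulLeft_apply, ← map_mul,
      mul_inv_rev, mul_inv_cancel_left]

theorem dual_unitForm : dual S X (unitForm S X) = 1 := by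
  rw [dual_apply, finsum_quotient_eq_single
    (φ := fun y => unitForm S X (of S X y⁻¹) • of S X y)
    (fun y u hu => dual_summand_invariant _ y u hu) 1]
  · rw [inv_one, map_one, unitForm_one, one_smul]
  · intro y hy
    rw [unitForm_of_notMem, zero_smul]
    rwa [inv_one, one_mul, ← inv_mem_iff] at hy

theorem dual_unitForm_mulRight (a : StarAlg S X) :
    dual S X (unitForm S X ∘ₗ LinearMap.mulRight S a) = a := by
  rw [← mul_dual, dual_unitForm, mul_one]

/-- Apply `l` to the expansion a = ∑ unitForm(x⁻¹ a) x and reindex by x ↦ x⁻¹. -/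
theorem unitForm_dual_mul (l : StarAlg S X →ₗ[S] S) (a : StarAlg S X) :
    unitForm S X (dual S X l * a) = l a := by
  let _ := Fintype.ofFinite X.quo
  have h1 := congrArg l (dual_unitForm_mulRight a)
  have h2 : ∑ᶠ q : X.quo, unitForm S X (of S X q.out⁻¹⁻¹ * a) * l (of S X q.out⁻¹) =
      ∑ᶠ q : X.quo, unitForm S X (of S X q.out⁻¹ * a) * l (of S X q.out) := by
    refine finsum_quotient_out (L' := X.units)
      (φ := fun y => unitForm S X (of S X y⁻¹ * a) * l (of S X y)) (fun y => y⁻¹)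
      (fun y z => ?_) (fun y => ⟨y⁻¹, by rw [inv_inv, inv_mul_cancel]; exact one_mem _⟩)
      (fun x u hu => ?_)
    · rw [inv_inv, ← inv_mem_iff, mul_inv_rev, inv_inv, X.units_normal.mem_comm_iff]
    · have h := congrArg l (dual_summand_invariant (unitForm S X ∘ₗ LinearMap.mulRight S a) x u hu)
      rwa [map_smul, map_smul] at h
  rw [dual_apply, finsum_eq_sum_of_fintype, map_sum] at h1
  rw [← h1, dual_apply, finsum_eq_sum_of_fintype, Finset.sum_mul, map_sum]
  rw [finsum_eq_sum_of_fintype, finsum_eq_sum_of_fintype] at h2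
  refine Eq.trans ?_ (h2.trans ?_)
  · refine Finset.sum_congr rfl fun q _ => ?_
    rw [smul_mul_assoc, map_smul, smul_eq_mul, mul_comm, inv_inv]
  · refine Finset.sum_congr rfl fun q _ => ?_
    rw [map_smul, smul_eq_mul]
    rfl

/-- Nondegeneracy: `dual` recovers `a` from the form b ↦ unitForm(b a). -/
theorem eq_zero_of_unitForm_mul (a : StarAlg S X) (h : ∀ b, unitForm S X (b * a) = 0) :
    a = 0 := by
  rw [← dual_unitForm_mulRight a, show unitForm S X ∘ₗ LinearMap.mulRight S a = 0 from
    LinearMap.ext h, map_zero]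

theorem dual_mem_center {l : StarAlg S X →ₗ[S] S} (hl : ∀ a b, l (a * b) = l (b * a)) :
    dual S X l ∈ Subalgebra.center S (StarAlg S X) := by
  refine Subalgebra.mem_center_iff.2 fun a => ?_
  rw [mul_dual, dual_mul]
  congr 1
  exact LinearMap.ext fun b => hl b a

instance : Module.Finite S (StarAlg S X) := by
  let _ := Fintype.ofFinite X.quo
  refine Module.Finite.of_surjective (Fintype.linearCombination S
    (fun q : X.quo => of S X q.out)) fun a => ?_
  refine ⟨fun q => unitForm S X (of S X q.out⁻¹ * a), ?_⟩
  conv_rhs => rw [← dual_unitForm_mulRight a, dual_apply, finsum_eq_sum_of_fintype]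
  rfl

end StarAlg

/-! ### Blocks of a twisted group algebra -/

section ofSurjective

variable {R : Type u} [CommRing R] {F : Type u} [Field F] [CharZero F] [Algebra R F]
  {X : StarGroup R} [Finite X.quo] {n : ℕ}

/-- Schur's relation. By the bimodule property the left side is s m for a single scalar s. Expanding
it as ∑ tr(m π(x⁻¹)) π(x), and adding over i the (i, j) entries obtained for m = E_ij, gives n s = ∑
(π(x⁻¹) π(x))_jj = |X|. -/
theorem dual_trace_apply (π : StarAlg F X →ₐ[F] Matrix (Fin n) (Fin n) F)
    (hπ : Function.Surjective π) (hn : n ≠ 0) (m : Matrix (Fin n) (Fin n) F) :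
    π (StarAlg.dual F X (Matrix.traceLinearMap (Fin n) F F ∘ₗ LinearMap.mulLeft F m ∘ₗ
      π.toLinearMap)) = ((Nat.card X.quo : F) / n) • m := by
  let _ := Fintype.ofFinite X.quo
  set D : Matrix (Fin n) (Fin n) F → StarAlg F X := fun m =>
    StarAlg.dual F X (Matrix.traceLinearMap (Fin n) F F ∘ₗ LinearMap.mulLeft F m ∘ₗ
      π.toLinearMap) with hD
  have h1 : ∀ a m, a * D m = D (π a * m) := fun a m => by
    rw [hD]
    dsimp only
    rw [StarAlg.mul_dual]
    congr 1
    refine LinearMap.ext fun b => ?_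
    simp only [LinearMap.comp_apply, LinearMap.mulRight_apply, LinearMap.mulLeft_apply,
      AlgHom.toLinearMap_apply, map_mul, Matrix.traceLinearMap_apply]
    rw [← mul_assoc, Matrix.trace_mul_comm, mul_assoc]
  have h2 : ∀ a m, D m * a = D (m * π a) := fun a m => by
    rw [hD]
    dsimp only
    rw [StarAlg.dual_mul]
    congr 1
    refine LinearMap.ext fun b => ?_
    simp only [LinearMap.comp_apply, LinearMap.mulLeft_apply,
      AlgHom.toLinearMap_apply, map_mul, Matrix.traceLinearMap_apply, mul_assoc]
  obtain ⟨s, hs⟩ : ∃ s : F, π (D 1) = algebraMap F _ s := by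
    have h : π (D 1) ∈ Subalgebra.center F (Matrix (Fin n) (Fin n) F) := by
      rw [Subalgebra.mem_center_iff]
      intro m
      obtain ⟨a, rfl⟩ := hπ m
      rw [← map_mul, ← map_mul, h1, h2, mul_one, one_mul]
    rw [Algebra.IsCentral.center_eq_bot] at h
    obtain ⟨c, hc⟩ := h
    exact ⟨c, hc.symm⟩
  have h3 : ∀ m, π (D m) = s • m := fun m => by
    obtain ⟨a, rfl⟩ := hπ m
    have h := h1 a 1
    rw [mul_one] at h
    rw [← h, map_mul, hs, ← Algebra.commutes, Algebra.smul_def]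
  have h4 : ∀ m, π (D m) = ∑ q : X.quo, (m * π (StarAlg.of F X q.out⁻¹)).trace •
      π (StarAlg.of F X q.out) := fun m => by
    rw [hD]
    dsimp only
    rw [StarAlg.dual_apply, finsum_eq_sum_of_fintype, map_sum]
    refine Finset.sum_congr rfl fun q _ => ?_
    rw [map_smul]
    rfl
  obtain ⟨j⟩ : Nonempty (Fin n) := ⟨⟨0, Nat.pos_of_ne_zero hn⟩⟩
  have h5 : ∑ i, π (D (Matrix.single i j 1)) i j = Nat.card X.quo := by
    simp only [h4, Matrix.sum_apply, Matrix.smul_apply, smul_eq_mul]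
    rw [Finset.sum_comm, Nat.card_eq_fintype_card, Fintype.card_eq_sum_ones, Nat.cast_sum]
    refine Finset.sum_congr rfl fun q _ => ?_
    have h6 : (π (StarAlg.of F X q.out⁻¹) * π (StarAlg.of F X q.out)) j j = 1 := by
      rw [← map_mul, ← map_mul, inv_mul_cancel, map_one, map_one, Matrix.one_apply_eq]
    rw [Nat.cast_one]
    refine Eq.trans ?_ h6
    rw [Matrix.mul_apply]
    refine Finset.sum_congr rfl fun i _ => ?_
    rw [Matrix.trace_single_mul, one_smul]
  have h7 : (n : F) * s = Nat.card X.quo := by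
    rw [← h5]
    simp [h3]
  have hn' : (n : F) ≠ 0 := Nat.cast_ne_zero.2 hn
  rw [h3, ← h7, mul_div_cancel_left₀ _ hn']

/-- A surjective matrix representation of a twisted group algebra in characteristic zero is a
block. -/
def MatBlock.ofSurjective (π : StarAlg F X →ₐ[F] Matrix (Fin n) (Fin n) F)
    (hπ : Function.Surjective π) (hn : n ≠ 0) : MatBlock F (StarAlg F X) n where
  π := π
  -- The factor is the inverse of the scalar |X| / n of Schur's relation, which makes `σ` a section
  -- of `π`.
  σ := ((n : F) / Nat.card X.quo) • (StarAlg.dual F X ∘ₗ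
    { toFun := fun m => Matrix.traceLinearMap (Fin n) F F ∘ₗ LinearMap.mulLeft F m ∘ₗ
        π.toLinearMap
      map_add' := fun m m' => LinearMap.ext fun a => by simp [add_mul]
      map_smul' := fun c m => LinearMap.ext fun a => by simp })
  π_σ m := by
    have h1 : (n : F) ≠ 0 := Nat.cast_ne_zero.2 hn
    have h2 : (Nat.card X.quo : F) ≠ 0 := Nat.cast_ne_zero.2 Nat.card_pos.ne'
    rw [LinearMap.smul_apply, map_smul, LinearMap.comp_apply]
    refine (congrArg _ (dual_trace_apply π hπ hn m)).trans ?_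
    rw [smul_smul, div_mul_div_cancel₀ h2, div_self h1, one_smul]
  mul_σ a m := by
    simp only [LinearMap.smul_apply, LinearMap.comp_apply, LinearMap.coe_mk, AddHom.coe_mk]
    rw [mul_smul_comm, StarAlg.mul_dual]
    congr 2
    refine LinearMap.ext fun b => ?_
    simp only [LinearMap.comp_apply, LinearMap.mulRight_apply, LinearMap.mulLeft_apply,
      AlgHom.toLinearMap_apply, map_mul, Matrix.traceLinearMap_apply]
    rw [← mul_assoc, Matrix.trace_mul_comm, mul_assoc]
  σ_mul m a := by
    simp only [LinearMap.smul_apply, LinearMap.comp_apply, LinearMap.coe_mk, AddHom.coe_mk]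
    rw [smul_mul_assoc, StarAlg.dual_mul]
    congr 2
    refine LinearMap.ext fun b => ?_
    simp only [LinearMap.comp_apply, LinearMap.mulLeft_apply,
      AlgHom.toLinearMap_apply, map_mul, Matrix.traceLinearMap_apply, mul_assoc]

/-- The symmetrizing form on the direct factor given by a block. -/
theorem MatBlock.unitForm_e_mul (β : MatBlock F (StarAlg F X) n) (hn : n ≠ 0)
    (a : StarAlg F X) :
    (Nat.card X.quo : F) / n * StarAlg.unitForm F X (β.e * a) = β.char a := by
  -- By Schur's relation for m = 1, the element dual to the character acts on the block as |X| / n;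
  -- by `h3` it is its own product with `β.e`, so it is (|X| / n) `β.e`.
  have h : β.e * StarAlg.dual F X β.char = ((Nat.card X.quo : F) / n) • β.e := by
    have h1 := dual_trace_apply β.π (fun m => ⟨β.σ m, β.π_σ m⟩) hn 1
    have h2 : Matrix.traceLinearMap (Fin n) F F ∘ₗ LinearMap.mulLeft F 1 ∘ₗ β.π.toLinearMap =
        β.char := LinearMap.ext fun a => by
      simp [MatBlock.char_apply]
    rw [h2] at h1
    rw [β.e_mul, h1, map_smul]
    rfl
  have h3 : β.e * StarAlg.dual F X β.char = StarAlg.dual F X β.char := by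
    rw [StarAlg.mul_dual]
    congr 1
    refine LinearMap.ext fun b => ?_
    rw [LinearMap.comp_apply, LinearMap.mulRight_apply, β.char_apply, β.char_apply, map_mul,
      β.π_e, mul_one]
  rw [← StarAlg.unitForm_dual_mul β.char a, ← h3, h, smul_mul_assoc, map_smul, smul_eq_mul]

end ofSurjective

/-! ### Characters and blocks -/

section characters

variable {R : Type u} [CommRing R] {F : Type u} [Field F] [Algebra R F] {X : StarGroup R}

theorem moduleChar_apply (V : Type u) [AddCommGroup V] [Module F V]
    [Module (StarAlg F X) V] [IsScalarTower F (StarAlg F X) V] (a : StarAlg F X) :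
    moduleChar F X V a = LinearMap.trace F V (Algebra.lsmul F F V a) := rfl

/-- Burnside's theorem: an absolutely simple module defines a surjection onto the
endomorphism algebra. -/
theorem lsmul_surjective_of_scalar_endomorphisms {A V : Type*} [Ring A] [Algebra F A]
    [AddCommGroup V] [Module F V] [Module A V] [IsScalarTower F A V] [FiniteDimensional F V]
    [IsSimpleModule A V] (h : ∀ f : V →ₗ[A] V, ∃ c : F, ∀ v, f v = c • v) :
    Function.Surjective (Algebra.lsmul F F V : A →ₐ[F] Module.End F V) := by
  intro f
  -- Every `A`-endomorphism is a scalar, hence commutes with `f`; the density theorem then provides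
  -- an element of `A` agreeing with `f` on a basis.
  let g : Module.End (Module.End A V) V :=
    { toFun := f
      map_add' := map_add f
      map_smul' := fun k v => by
        obtain ⟨c, hc⟩ := h k
        change f (k v) = k (f v)
        rw [hc, hc, map_smul] }
  let b := Module.finBasis F V
  classical
  obtain ⟨a, ha⟩ := jacobson_density g (Finset.univ.image b)
  refine ⟨a, b.ext fun i => ?_⟩
  exact (ha (b i) (Finset.mem_image_of_mem _ (Finset.mem_univ i))).symm

/-- Burnside's theorem makes the representation surjective onto the matrices, and in characteristic
zero a surjective representation splits off as a direct factor. -/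
theorem IsAbsIrrChar.exists_block [CharZero F] [Finite X.quo] {χ : StarAlg F X →ₗ[F] F}
    (h : IsAbsIrrChar χ) :
    ∃ (n : ℕ) (_ : n ≠ 0) (β : MatBlock F (StarAlg F X) n), χ = β.char := by
  obtain ⟨V, _, _, _, _, _, _, hs, rfl⟩ := h
  have hsurj := lsmul_surjective_of_scalar_endomorphisms (F := F) hs
  let b := Module.finBasis F V
  have hnt : Nontrivial V := IsSimpleModule.nontrivial (StarAlg F X) V
  refine ⟨Module.finrank F V, Module.finrank_pos.ne', MatBlock.ofSurjective
    ((LinearMap.toMatrixAlgEquiv b).toAlgHom.comp (Algebra.lsmul F F V))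
    ((LinearMap.toMatrixAlgEquiv b).surjective.comp hsurj) Module.finrank_pos.ne', ?_⟩
  refine LinearMap.ext fun a => ?_
  rw [moduleChar_apply, LinearMap.trace_eq_matrix_trace F b]
  rfl

/-- The column space affords the trace form; it is simple because matrices move a nonzero column to
any other. -/
theorem MatBlock.isIrrChar_char {n : ℕ} (β : MatBlock F (StarAlg F X) n) (hn : n ≠ 0) :
    IsIrrChar β.char := by
  let _ : Module (StarAlg F X) (Fin n → F) :=
    Module.compHom _ (Matrix.toLinAlgEquiv'.toAlgHom.comp β.π).toRingHom
  have hs : ∀ (a : StarAlg F X) (v : Fin n → F), a • v = β.π a *ᵥ v := fun a v => rfl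
  have : IsScalarTower F (StarAlg F X) (Fin n → F) := ⟨fun c a v => by
    rw [hs, hs, map_smul, Matrix.smul_mulVec]⟩
  refine ⟨Fin n → F, inferInstance, inferInstance, inferInstance, inferInstance, inferInstance,
    ?_, ?_⟩
  · have : Nonempty (Fin n) := ⟨⟨0, Nat.pos_of_ne_zero hn⟩⟩
    refine (isSimpleModule_iff_toSpanSingleton_surjective (R := StarAlg F X)).2
      ⟨inferInstance, fun v hv w => ?_⟩
    obtain ⟨i, hi⟩ : ∃ i, v i ≠ 0 := by
      by_contra! h
      exact hv (funext h)
    refine ⟨β.σ (Matrix.vecMulVec w (Pi.single i (v i)⁻¹)), ?_⟩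
    rw [LinearMap.toSpanSingleton_apply, hs, β.π_σ, Matrix.vecMulVec_mulVec]
    simp [hi]
  · refine LinearMap.ext fun a => ?_
    rw [moduleChar_apply]
    have : Algebra.lsmul F F (Fin n → F) a = Matrix.toLin' (β.π a) := LinearMap.ext fun v => rfl
    rw [this, Matrix.trace_toLin'_eq]
    rfl

/-- Either the idempotent of the block moves a vector of the simple module, which is then the column
space of the block, or it annihilates the module. -/
theorem IsIrrChar.eq_char_or {χ : StarAlg F X →ₗ[F] F} (h : IsIrrChar χ) {n : ℕ}
    (β : MatBlock F (StarAlg F X) n) : χ = β.char ∨ ∀ a, χ (β.e * a) = 0 := by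
  obtain ⟨V, _, _, _, _, _, _, rfl⟩ := h
  by_cases h : ∃ v : V, β.e • v ≠ 0
  · obtain ⟨v, hv⟩ := h
    exact Or.inl (LinearMap.ext fun a => β.trace_eq_of_isSimpleModule v hv a)
  · push Not at h
    refine Or.inr fun a => ?_
    have h0 : Algebra.lsmul F F V (β.e * a) = 0 := LinearMap.ext fun v => by
      change (β.e * a) • v = 0
      rw [Subalgebra.mem_center_iff.1 β.e_mem_center a |>.symm, mul_smul, h, smul_zero]
    rw [moduleChar_apply, h0, map_zero]

theorem MatBlock.isAssociatedIdempotent {n : ℕ} (β : MatBlock F (StarAlg F X) n) (hn : n ≠ 0) :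
    IsAssociatedIdempotent β.char β.e where
  mem_center := β.e_mem_center
  isIdempotentElem := β.e_isIdempotentElem
  ne_zero h := by
    have h1 := β.π_e
    rw [h, map_zero] at h1
    have : Nonempty (Fin n) := ⟨⟨0, Nat.pos_of_ne_zero hn⟩⟩
    exact zero_ne_one h1
  primitive f hf hi hfe := by
    rw [β.mul_e] at hfe
    rcases β.central_idempotent hf hi with h | h
    · left; rw [← hfe, h, map_zero]
    · right; rw [← hfe, h]; rfl
  apply_eq := by rw [β.char_e, β.char_one]

/-- Since ν(e) = ν(1) is not zero, the central idempotent `e` acts on the block as 1, so that `β.e *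
e = β.e`; primitivity of `e` concludes. -/
theorem IsAssociatedIdempotent.eq_e [CharZero F] {n : ℕ} {β : MatBlock F (StarAlg F X) n}
    (hn : n ≠ 0) {e : StarAlg F X} (h : IsAssociatedIdempotent β.char e) : e = β.e := by
  have h1 : β.π e = 1 := by
    refine (β.central_idempotent h.mem_center h.isIdempotentElem).resolve_left fun h0 => ?_
    have h2 := h.apply_eq
    rw [β.char_one, β.char_apply, h0, Matrix.trace_zero] at h2
    exact Nat.cast_ne_zero.2 hn h2.symm
  have h2 : β.e * e = β.e := by rw [β.e_mul, h1]; rfl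
  rcases h.primitive β.e β.e_mem_center β.e_isIdempotentElem h2 with h3 | h3
  · exact absurd h3 (β.isAssociatedIdempotent hn).ne_zero
  · exact h3.symm

/-- The trace of a projection is its rank. In characteristic zero, the values of characters on an
idempotent therefore cannot cancel. -/
theorem IsChar.exists_natCast_eq {ψ : StarAlg F X →ₗ[F] F} (h : IsChar ψ) {e : StarAlg F X}
    (he : IsIdempotentElem e) : ∃ k : ℕ, ψ e = k := by
  obtain ⟨V, _, _, _, _, _, rfl⟩ := h
  have h1 : IsIdempotentElem (Algebra.lsmul F F V e) := he.map (Algebra.lsmul F F V)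
  exact ⟨_, (LinearMap.IsIdempotentElem.isProj_range _ h1).trace⟩

/-- The column space of the block is a direct summand of the restricted module, and the kernel of
the projection onto it affords the remaining character. -/
theorem MatBlock.isChar_restrict {Y : StarGroup R} (f : StarAlg F X →ₐ[F] StarAlg F Y) {n : ℕ}
    (β : MatBlock F (StarAlg F X) n) {χ : StarAlg F Y →ₗ[F] F} (hχ : IsIrrChar χ)
    (h : χ (f β.e) ≠ 0) : ∃ ψ, IsChar ψ ∧ χ ∘ₗ f.toLinearMap = β.char + ψ := by
  obtain ⟨V, _, _, _, _, _, _, rfl⟩ := hχ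
  let _ : Module (StarAlg F X) V := Module.compHom V f.toRingHom
  have hs : ∀ (a : StarAlg F X) (v : V), a • v = f a • v := fun a v => rfl
  have : IsScalarTower F (StarAlg F X) V := ⟨fun c a v => by
    rw [hs, hs, map_smul, smul_assoc]⟩
  obtain ⟨v, hv⟩ : ∃ v : V, β.e • v ≠ 0 := by
    by_contra! h'
    refine h ?_
    have h0 : Algebra.lsmul F F V (f β.e) = 0 := LinearMap.ext fun v => h' v
    rw [moduleChar_apply, h0, map_zero]
  obtain ⟨ι, p, hι, hp, hpι⟩ := β.exists_summand v hv
  let W : Submodule (StarAlg F X) V :=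
    { carrier := LinearMap.ker p
      add_mem' := fun ha hb => (LinearMap.ker p).add_mem ha hb
      zero_mem' := (LinearMap.ker p).zero_mem
      smul_mem' := fun a w hw => by
        change p (a • w) = 0
        rw [hp, show p w = 0 from hw, Matrix.mulVec_zero] }
  refine ⟨moduleChar F X W, ⟨W, inferInstance, inferInstance, inferInstance, inferInstance,
    inferInstanceAs (FiniteDimensional F (LinearMap.ker p)), rfl⟩, ?_⟩
  refine LinearMap.ext fun a => ?_
  let E : ((Fin n → F) × W) ≃ₗ[F] V :=
    { toFun := fun z => ι z.1 + z.2.1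
      map_add' := fun z w => by
        change ι (z.1 + w.1) + (z.2.1 + w.2.1) = _
        rw [map_add]
        abel
      map_smul' := fun c z => by
        change ι (c • z.1) + (c • z.2.1) = c • _
        rw [map_smul, smul_add]
      invFun := fun v => ⟨p v, ⟨v - ι (p v), by
        change p _ = 0
        rw [map_sub, hpι, sub_self]⟩⟩
      left_inv := fun z => by
        have h1 : p (ι z.1 + z.2.1) = z.1 := by
          rw [map_add, hpι, show p z.2.1 = 0 from z.2.2, add_zero]
        refine Prod.ext h1 (Subtype.ext ?_)
        change ι z.1 + z.2.1 - ι (p (ι z.1 + z.2.1)) = z.2.1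
        rw [h1, add_sub_cancel_left]
      right_inv := fun v => add_sub_cancel _ _ }
  have h1 : Algebra.lsmul F F V (f a) =
      E.conj ((Matrix.toLin' (β.π a)).prodMap (Algebra.lsmul F F W a)) := by
    refine LinearMap.ext fun v => ?_
    obtain ⟨z, rfl⟩ := E.surjective v
    rw [LinearEquiv.conj_apply_apply, LinearEquiv.symm_apply_apply]
    change f a • (ι z.1 + z.2.1) = ι (Matrix.toLin' (β.π a) z.1) + a • z.2.1
    rw [smul_add, Matrix.toLin'_apply, hι]
    rfl
  change LinearMap.trace F V (Algebra.lsmul F F V (f a)) = _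
  rw [h1, LinearMap.trace_conj', LinearMap.trace_prodMap', Matrix.trace_toLin'_eq]
  rfl

/-- If the block character is involved, the value at the idempotent is n plus a natural number.
Conversely, a nonzero value means that the idempotent acts nontrivially, and then the column space
splits off. -/
theorem MatBlock.mem_irrOver_iff [CharZero F] {N : Subgroup X} {hN : X.units ≤ N} {n : ℕ}
    (hn : n ≠ 0) (β : MatBlock F (StarAlg F (X.sub N hN)) n) {χ : StarAlg F X →ₗ[F] F}
    (hχ : IsIrrChar χ) :
    χ ∈ IrrOver β.char ↔ χ (StarAlg.map F (X.subHom N hN) β.e) ≠ 0 := by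
  refine ⟨?_, fun h => ⟨hχ, β.isChar_restrict _ hχ h⟩⟩
  rintro ⟨-, ψ, hψ, h⟩
  obtain ⟨k, hk⟩ := hψ.exists_natCast_eq β.e_isIdempotentElem
  have h1 := LinearMap.congr_fun h β.e
  rw [LinearMap.add_apply, hk, β.char_e, ← Nat.cast_add] at h1
  refine h1.trans_ne (Nat.cast_ne_zero.2 (by omega))

end characters

/-! ### Split algebras -/

section split

variable {F A : Type*} [Field F] [Ring A] [Algebra F A] {k : ℕ} {d : Fin k → ℕ}

/-- The blocks of a direct product of matrix algebras. -/
def MatBlock.ofPi (Θ : A ≃ₐ[F] ((i : Fin k) → Matrix (Fin (d i)) (Fin (d i)) F)) (i : Fin k) :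
    MatBlock F A (d i) where
  π := (Pi.evalAlgHom F _ i).comp Θ.toAlgHom
  σ := Θ.symm.toLinearMap ∘ₗ LinearMap.single F (fun i => Matrix (Fin (d i)) (Fin (d i)) F) i
  π_σ m := by
    change Θ (Θ.symm (Pi.single i m)) i = m
    rw [AlgEquiv.apply_symm_apply, Pi.single_eq_same]
  mul_σ a m := by
    apply Θ.injective
    change Θ (a * Θ.symm (Pi.single i m)) = Θ (Θ.symm (Pi.single i (Θ a i * m)))
    rw [map_mul, AlgEquiv.apply_symm_apply, AlgEquiv.apply_symm_apply, ← Pi.single_mul_right]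
  σ_mul m a := by
    apply Θ.injective
    change Θ (Θ.symm (Pi.single i m) * a) = Θ (Θ.symm (Pi.single i (m * Θ a i)))
    rw [map_mul, AlgEquiv.apply_symm_apply, AlgEquiv.apply_symm_apply, ← Pi.single_mul_left]

/-- A family of blocks decomposing an algebra. -/
structure MatBlock.IsDecomposition (β : (i : Fin k) → MatBlock F A (d i)) : Prop where
  sum_e : ∑ i, (β i).e = 1
  π_e : ∀ i j, i ≠ j → (β i).π (β j).e = 0

theorem MatBlock.isDecomposition_ofPi
    (Θ : A ≃ₐ[F] ((i : Fin k) → Matrix (Fin (d i)) (Fin (d i)) F)) :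
    MatBlock.IsDecomposition (MatBlock.ofPi Θ) where
  sum_e := by
    apply Θ.injective
    rw [map_sum, map_one]
    have h : ∀ i, Θ (MatBlock.ofPi Θ i).e = Pi.single i 1 := fun i => Θ.apply_symm_apply _
    simp only [h]
    exact Finset.univ_sum_single (1 : (i : Fin k) → Matrix (Fin (d i)) (Fin (d i)) F)
  π_e i j h := by
    change Θ (Θ.symm (Pi.single j 1)) i = 0
    rw [AlgEquiv.apply_symm_apply, Pi.single_eq_of_ne h]

end split

/-- The idempotents add up to 1 and χ(1) ≠ 0, so one of them acts nontrivially. A decomposition may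
contain blocks of size zero, whence the condition on `d i`. -/
theorem MatBlock.IsDecomposition.exists_eq_char {R : Type u} [CommRing R] {F : Type u} [Field F]
    [CharZero F] [Algebra R F] {X : StarGroup R} {k : ℕ} {d : Fin k → ℕ}
    {β : (i : Fin k) → MatBlock F (StarAlg F X) (d i)} (hβ : MatBlock.IsDecomposition β)
    {χ : StarAlg F X →ₗ[F] F} (hχ : IsIrrChar χ) : ∃ i, d i ≠ 0 ∧ χ = (β i).char := by
  have h1 : χ 1 ≠ 0 := by
    obtain ⟨V, _, _, _, _, _, _, rfl⟩ := hχ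
    have : Nontrivial V := IsSimpleModule.nontrivial (StarAlg F X) V
    rw [moduleChar_apply, map_one, LinearMap.trace_one]
    exact Nat.cast_ne_zero.2 Module.finrank_pos.ne'
  obtain ⟨i, hi⟩ : ∃ i, χ (β i).e ≠ 0 := by
    by_contra! h
    refine h1 ?_
    rw [← hβ.sum_e, map_sum]
    exact Finset.sum_eq_zero fun i _ => h i
  have h2 : χ = (β i).char := (hχ.eq_char_or (β i)).resolve_right fun h => hi (by
    have := h 1
    rwa [mul_one] at this)
  refine ⟨i, fun h0 => h1 ?_, h2⟩
  rw [h2, (β i).char_one, h0, Nat.cast_zero]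

theorem MatBlock.IsDecomposition.char_injective {F A : Type*} [Field F] [CharZero F] [Ring A]
    [Algebra F A] {k : ℕ} {d : Fin k → ℕ}
    {β : (i : Fin k) → MatBlock F A (d i)} (hβ : MatBlock.IsDecomposition β)
    {i j : Fin k} (hi : d i ≠ 0) (h : (β i).char = (β j).char) : i = j := by
  by_contra hij
  have h1 := LinearMap.congr_fun h (β i).e
  rw [(β i).char_e, (β j).char_apply, hβ.π_e _ _ (Ne.symm hij), Matrix.trace_zero] at h1
  exact Nat.cast_ne_zero.2 hi h1

/-! ### Defects -/

/-- Over an algebraic closure the trace is the sum of the eigenvalues, and these are roots of any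
monic polynomial over `R` annihilating the matrix. -/
theorem Matrix.isIntegral_trace {R F : Type*} [CommRing R] [Field F] [Algebra R F] {n : ℕ}
    {M : Matrix (Fin n) (Fin n) F} (hM : IsIntegral R M) : IsIntegral R M.trace := by
  obtain ⟨q, hq, hqM⟩ := hM
  let Ω := AlgebraicClosure F
  refine (isIntegral_algebraMap_iff (A := F) (B := Ω) (algebraMap F Ω).injective).1 ?_
  have h1 : algebraMap F Ω M.trace = ((M.map (algebraMap F Ω)).charpoly.roots).sum := by
    rw [← Matrix.trace_eq_sum_roots_charpoly_of_splits (IsAlgClosed.splits _)]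
    exact AddMonoidHom.map_trace (algebraMap F Ω) M
  rw [h1]
  refine IsIntegral.multiset_sum fun μ hμ => ?_
  have h2 : (Matrix.toLin' (M.map (algebraMap F Ω))).charpoly.IsRoot μ := by
    rw [Matrix.charpoly_toLin']
    exact Polynomial.isRoot_of_mem_roots hμ
  obtain ⟨v, hv⟩ := ((Module.End.hasEigenvalue_iff_isRoot_charpoly _ _).2 h2).exists_hasEigenvector
  refine ⟨q, hq, ?_⟩
  have h3 := Module.End.aeval_apply_of_hasEigenvector (p := q.map (algebraMap R Ω)) hv
  have h4 : Polynomial.aeval (Matrix.toLin' (M.map (algebraMap F Ω)))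
      (q.map (algebraMap R Ω)) = 0 := by
    have e : Polynomial.aeval (M.map (algebraMap F Ω)) (q.map (algebraMap R Ω)) = 0 := by
      rw [Polynomial.aeval_map_algebraMap]
      have := congrArg (fun m : Matrix (Fin n) (Fin n) F => m.map (algebraMap F Ω)) hqM
      have h5 : Polynomial.aeval M q = 0 := hqM
      have h6 := Polynomial.aeval_algHom_apply ((Algebra.ofId F Ω).mapMatrix.restrictScalars R) M q
      rw [h5, map_zero] at h6
      exact h6
    have h7 := Polynomial.aeval_algHom_apply
      (Matrix.toLinAlgEquiv' (R := Ω) (n := Fin n)).toAlgHom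
      (M.map (algebraMap F Ω)) (q.map (algebraMap R Ω))
    rw [e, map_zero] at h7
    exact h7
  rw [h4, LinearMap.zero_apply] at h3
  have h8 := (smul_eq_zero.1 h3.symm).resolve_right hv.2
  rwa [Polynomial.eval_map] at h8

section defect

variable {R : Type u} [CommRing R] {F : Type u} [Field F] [Algebra R F] {X : StarGroup R}

theorem StarAlg.scalar_mem_center {z : StarAlg R X} (hz : z ∈ Subalgebra.center R (StarAlg R X)) :
    StarAlg.scalar F X z ∈ Subalgebra.center F (StarAlg F X) :=
  StarAlg.mem_center_iff.2 fun x => by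
    rw [← StarAlg.scalar_of, ← map_mul, ← map_mul, StarAlg.mem_center_iff.1 hz]

variable [Finite X.quo] {n : ℕ} (β : MatBlock F (StarAlg F X) n)

theorem MatBlock.isIntegral_π_scalar (a : StarAlg R X) :
    IsIntegral R (β.π (StarAlg.scalar F X a)) :=
  (IsIntegral.of_finite R a).map ((β.π.restrictScalars R).comp (StarAlg.scalar F X))

variable [IsDomain R] [IsFractionRing R F] [IsIntegrallyClosed R]

-- `StarAlg R X` is finite over `R`, so the scalar by which a central element acts is integral over
-- the integrally closed ring `R`.
omit [IsDomain R] in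
theorem MatBlock.exists_central_value (hn : n ≠ 0) {z : StarAlg R X}
    (hz : z ∈ Subalgebra.center R (StarAlg R X)) :
    ∃ r : R, β.π (StarAlg.scalar F X z) = algebraMap F _ (algebraMap R F r) := by
  obtain ⟨c, hc⟩ := β.exists_scalar_of_central (StarAlg.scalar_mem_center (F := F) hz)
  have h := β.isIntegral_π_scalar z
  have : Nonempty (Fin n) := ⟨⟨0, Nat.pos_of_ne_zero hn⟩⟩
  rw [hc, isIntegral_algebraMap_iff (FaithfulSMul.algebraMap_injective _ _)] at h
  obtain ⟨r, rfl⟩ := IsIntegrallyClosed.isIntegral_iff.1 h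
  exact ⟨r, hc⟩

omit [IsDomain R] in
/-- The trace form of a block takes integral values on `R_* X`. -/
theorem MatBlock.exists_integral_form : ∃ l : StarAlg R X →ₗ[R] R,
    ∀ a, algebraMap R F (l a) = β.char (StarAlg.scalar F X a) := by
  have h : ∀ a, ∃ r : R, algebraMap R F r = β.char (StarAlg.scalar F X a) := fun a =>
    IsIntegrallyClosed.isIntegral_iff.1 (Matrix.isIntegral_trace (β.isIntegral_π_scalar a))
  choose l hl using h
  have hinj := IsFractionRing.injective R F
  refine ⟨⟨⟨l, fun a b => hinj ?_⟩, fun c a => hinj ?_⟩, hl⟩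
  · rw [map_add, hl, hl, hl, map_add, map_add]
  · rw [RingHom.id_apply, smul_eq_mul, map_mul, hl, hl, map_smul, ← algebraMap_smul F, map_smul,
      smul_eq_mul]

variable [CharZero F]

-- It is enough to test `z` on the form `unitForm`. On the block, unitForm(z ·) is c times the block
-- character with c in `R`, as a combination of irreducible characters; by `unitForm_e_mul` it is
-- also the scalar of `z` times n / |X| times this character.
omit [IsDomain R] in
theorem MatBlock.zCh_value (hn : n ≠ 0) {z : StarAlg R X} (hz : z ∈ zCh F X) :
    ∃ c : R, β.π (StarAlg.scalar F X z) =
      algebraMap F _ ((Nat.card X.quo : F) / n * algebraMap R F c) := by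
  -- Each form in the span extends to `F_* X`, and on the block only the coefficient of `β.char`
  -- survives, the other irreducible characters vanishing there.
  have key : ∀ f ∈ charSpan F X, ∃ (g : StarAlg F X →ₗ[F] F) (c : R),
      (∀ a, f a = g (StarAlg.scalar F X a)) ∧ ∀ a, g (β.e * a) = algebraMap R F c * β.char a := by
    intro f hf
    induction hf using Submodule.span_induction with
    | mem f hf =>
      obtain ⟨χ, hχ, rfl⟩ := hf
      rcases IsIrrChar.eq_char_or hχ β with rfl | h
      · refine ⟨β.char, 1, fun a => rfl, fun a => ?_⟩
        rw [map_one, one_mul, β.char_apply, map_mul, β.π_e, one_mul]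
        rfl
      · exact ⟨χ, 0, fun a => rfl, fun a => by rw [h, map_zero, zero_mul]⟩
    | zero => exact ⟨0, 0, fun a => rfl, fun a => by rw [map_zero, zero_mul]; rfl⟩
    | add f f' _ _ h h' =>
      obtain ⟨g, c, h1, h2⟩ := h
      obtain ⟨g', c', h1', h2'⟩ := h'
      refine ⟨g + g', c + c', fun a => ?_, fun a => ?_⟩
      · rw [LinearMap.add_apply, h1, h1']; rfl
      · rw [LinearMap.add_apply, h2, h2', map_add, add_mul]
    | smul r f _ h =>
      obtain ⟨g, c, h1, h2⟩ := h
      refine ⟨algebraMap R F r • g, r * c, fun a => ?_, fun a => ?_⟩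
      · rw [LinearMap.smul_apply, h1, LinearMap.smul_apply, algebraMap_smul]
      · rw [LinearMap.smul_apply, h2, map_mul, smul_eq_mul, mul_assoc]
  obtain ⟨g, c, hg, hc⟩ := key _ (hz.2 (StarAlg.unitForm R X) (StarAlg.unitForm_mul_comm R))
  obtain ⟨r, hr⟩ := β.exists_central_value hn hz.1
  refine ⟨c, ?_⟩
  rw [hr]
  congr 1
  have h1 : StarAlg.unitForm F X ∘ₗ LinearMap.mulLeft F (StarAlg.scalar F X z) = g := by
    refine StarAlg.hom_ext fun x => ?_
    rw [LinearMap.comp_apply, LinearMap.mulLeft_apply, ← StarAlg.scalar_of, ← map_mul,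
      StarAlg.unitForm_scalar, ← hg]
    rfl
  have h2 := LinearMap.congr_fun h1 (β.e * 1)
  rw [hc, LinearMap.comp_apply, LinearMap.mulLeft_apply, ← mul_assoc, β.mul_e, hr,
    Algebra.algebraMap_eq_smul_one, map_smul, smul_mul_assoc, map_smul, smul_eq_mul] at h2
  have h3 := β.unitForm_e_mul hn 1
  have hn' : (n : F) ≠ 0 := Nat.cast_ne_zero.2 hn
  rw [β.char_one] at h2 h3
  change algebraMap R F r * StarAlg.unitForm F X (β.e * 1) = _ at h2
  have h4 : StarAlg.unitForm F X (β.e * 1) ≠ 0 := fun h => by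
    rw [h, mul_zero] at h3
    exact hn' h3.symm
  apply mul_right_cancel₀ h4
  rw [h2, mul_right_comm, h3, mul_comm]

-- Take `w` dual to the character, which is integral on `R_* X`. For a symmetric μ one has μ(w a) =
-- χ(dual(μ) a), and the central element dual(μ) acts on the block by a scalar of `R`, so μ(w ·) is
-- an `R`-multiple of χ. The value of `w` comes from `unitForm_e_mul`.
omit [IsDomain R] in
theorem MatBlock.exists_mem_zCh (hn : n ≠ 0) : ∃ w : StarAlg R X, (∀ r : R, r • w ∈ zCh F X) ∧
    β.π (StarAlg.scalar F X w) = algebraMap F _ ((Nat.card X.quo : F) / n) := by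
  obtain ⟨l, hl⟩ := β.exists_integral_form (R := R)
  have hinj := IsFractionRing.injective R F
  have hw : StarAlg.dual R X l ∈ Subalgebra.center R (StarAlg R X) :=
    StarAlg.dual_mem_center fun a b => hinj (by
      rw [hl, hl, map_mul (StarAlg.scalar F X), map_mul (StarAlg.scalar F X), β.char_mul_comm])
  refine ⟨StarAlg.dual R X l, fun r => ⟨Subalgebra.smul_mem _ hw r, fun μ hμ => ?_⟩, ?_⟩
  · obtain ⟨s, hs⟩ := β.exists_central_value hn (StarAlg.dual_mem_center hμ)
    have h1 : Algebra.linearMap R F ∘ₗ μ ∘ₗ LinearMap.mulLeft R (r • StarAlg.dual R X l) =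
        (r * s) • ((β.char.restrictScalars R) ∘ₗ (StarAlg.scalar F X).toLinearMap) := by
      refine LinearMap.ext fun a => ?_
      have h2 : μ (StarAlg.dual R X l * a) = l (StarAlg.dual R X μ * a) := by
        rw [← StarAlg.unitForm_dual_mul μ, ← StarAlg.unitForm_dual_mul l, ← mul_assoc, ← mul_assoc,
          Subalgebra.mem_center_iff.1 hw]
      simp only [LinearMap.comp_apply, LinearMap.mulLeft_apply, LinearMap.smul_apply,
        AlgHom.toLinearMap_apply, LinearMap.restrictScalars_apply, smul_mul_assoc, map_smul, h2,
        Algebra.linearMap_apply, hl]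
      rw [mul_smul]
      congr 1
      rw [map_mul, β.char_apply, map_mul, hs, Algebra.algebraMap_eq_smul_one, smul_mul_assoc,
        one_mul, Matrix.trace_smul, algebraMap_smul]
      rfl
    rw [h1]
    exact Submodule.smul_mem _ _ (Submodule.subset_span ⟨_, β.isIrrChar_char hn, rfl⟩)
  · obtain ⟨r, hr⟩ := β.exists_central_value hn hw
    rw [hr]
    congr 1
    have h1 : StarAlg.unitForm F X ∘ₗ LinearMap.mulLeft F (StarAlg.scalar F X
        (StarAlg.dual R X l)) = β.char := by
      refine StarAlg.hom_ext fun x => ?_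
      rw [LinearMap.comp_apply, LinearMap.mulLeft_apply, ← StarAlg.scalar_of, ← map_mul,
        StarAlg.unitForm_scalar, StarAlg.unitForm_dual_mul, hl]
    have h2 := LinearMap.congr_fun h1 (β.e * 1)
    rw [LinearMap.comp_apply, LinearMap.mulLeft_apply, ← mul_assoc, β.mul_e, hr,
      Algebra.algebraMap_eq_smul_one, map_smul, smul_mul_assoc, map_smul, smul_eq_mul, mul_one β.e,
      β.char_e] at h2
    have h3 := β.unitForm_e_mul hn 1
    have hn' : (n : F) ≠ 0 := Nat.cast_ne_zero.2 hn
    rw [β.char_one, mul_one] at h3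
    change algebraMap R F r * StarAlg.unitForm F X (β.e * 1) = _ at h2
    rw [mul_one] at h2
    have h4 : StarAlg.unitForm F X β.e ≠ 0 := fun h => by
      rw [h, mul_zero] at h3
      exact hn' h3.symm
    apply mul_right_cancel₀ h4
    rw [h2, h3]

omit [IsDomain R] in
theorem MatBlock.image_zCh (hn : n ≠ 0) :
    (fun z => β.char (StarAlg.scalar F X z) / β.char 1) '' zCh F X =
      Set.range (fun r : R => (Nat.card X.quo : F) / n * algebraMap R F r) := by
  have hn' : (n : F) ≠ 0 := Nat.cast_ne_zero.2 hn
  have h0 : ∀ (z : StarAlg R X) (c : F), β.π (StarAlg.scalar F X z) = algebraMap F _ c →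
      β.char (StarAlg.scalar F X z) / β.char 1 = c := fun z c h => by
    rw [β.char_one, β.char_apply, h, Algebra.algebraMap_eq_smul_one, Matrix.trace_smul,
      Matrix.trace_one, Fintype.card_fin, smul_eq_mul, mul_div_cancel_right₀ _ hn']
  ext x
  constructor
  · rintro ⟨z, hz, rfl⟩
    obtain ⟨c, hc⟩ := β.zCh_value hn hz
    exact ⟨c, (h0 z _ hc).symm⟩
  · rintro ⟨r, rfl⟩
    obtain ⟨w, hw, hw'⟩ := β.exists_mem_zCh (R := R) hn
    refine ⟨r • w, hw r, h0 _ _ ?_⟩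
    rw [map_smul, ← algebraMap_smul F, map_smul, hw']
    dsimp only
    rw [mul_comm, map_mul]
    exact Algebra.smul_def _ _

/-- The defect of an absolutely irreducible character `χ` of `X` is the exponent of the `p`-part
of `|X| / χ(1)`. -/
theorem MatBlock.exists_hasDefect (hn : n ≠ 0) (p : ℕ) [hpp : Fact p.Prime]
    (hp : ¬ IsUnit (p : R)) (hu : ∀ m : ℕ, ¬ p ∣ m → IsUnit (m : R)) :
    ∃ d, HasDefect p β.char d ∧ padicValNat p n + d = padicValNat p (Nat.card X.quo) := by
  have hinj := IsFractionRing.injective R F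
  have : CharZero R := (algebraMap R F).charZero
  have hX : Nat.card X.quo ≠ 0 := Nat.card_pos.ne'
  have hn' : (n : F) ≠ 0 := Nat.cast_ne_zero.2 hn
  have hp0 : (p : R) ≠ 0 := Nat.cast_ne_zero.2 hpp.out.ne_zero
  -- The quotient |X| / n lies in `R`, being the value of the central character at a central element
  -- of `R_* X`.
  obtain ⟨r, hr⟩ : ∃ r : R, algebraMap R F r = (Nat.card X.quo : F) / n := by
    obtain ⟨w, hw, hw'⟩ := β.exists_mem_zCh (R := R) hn
    have h1 := hw 1
    rw [one_smul] at h1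
    obtain ⟨r, hr⟩ := β.exists_central_value hn h1.1
    have : Nonempty (Fin n) := ⟨⟨0, Nat.pos_of_ne_zero hn⟩⟩
    exact ⟨r, FaithfulSMul.algebraMap_injective F (Matrix (Fin n) (Fin n) F) (hr.symm.trans hw')⟩
  obtain ⟨a, u, hup, hu'⟩ := Nat.exists_eq_pow_mul_and_not_dvd hX p hpp.out.ne_one
  obtain ⟨b, v, hvp, hv'⟩ := Nat.exists_eq_pow_mul_and_not_dvd hn p hpp.out.ne_one
  have hval : ∀ k m : ℕ, ¬ p ∣ m → padicValNat p (p ^ k * m) = k := fun k m hm => by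
    have hm0 : m ≠ 0 := fun h => hm (h ▸ dvd_zero p)
    rw [padicValNat.mul (pow_ne_zero _ hpp.out.ne_zero) hm0, padicValNat.prime_pow,
      padicValNat.eq_zero_of_not_dvd hm, add_zero]
  have h1 : r * (p ^ b * v) = p ^ a * u := hinj (by
    have h2 : (n : F) = p ^ b * v := by rw [hv']; push_cast; rfl
    have h3 : (Nat.card X.quo : F) = p ^ a * u := by rw [hu']; push_cast; rfl
    rw [map_mul, hr]
    simp only [map_mul, map_pow, map_natCast]
    rw [← h2, ← h3, div_mul_cancel₀ _ hn'])
  -- Otherwise the unit `u` would be a multiple of `p`.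
  have hba : b ≤ a := by
    by_contra! hab
    obtain ⟨c, rfl⟩ := Nat.exists_eq_add_of_lt hab
    have h2 : (p : R) * (r * (p ^ c * v)) = u := by
      apply mul_left_cancel₀ (pow_ne_zero a hp0)
      rw [← h1]
      ring
    exact hp (isUnit_of_mul_isUnit_left (h2 ▸ hu u hup))
  obtain ⟨d, rfl⟩ := Nat.exists_eq_add_of_le hba
  refine ⟨d, ?_, by rw [hu', hval _ _ hup, hv', hval _ _ hvp]⟩
  obtain ⟨u', hu'⟩ := hu u hup
  obtain ⟨v', hv'⟩ := hu v hvp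
  -- The prime-to-p parts of |X| and n are units of `R`, so |X| / n and p ^ d generate the same
  -- `R`-submodule.
  have h2 : r = p ^ d * u' * (v'⁻¹ : Rˣ) := by
    rw [Units.eq_mul_inv_iff_mul_eq]
    apply mul_left_cancel₀ (pow_ne_zero b hp0)
    rw [hu', hv', ← mul_assoc (_ ^ b), ← mul_assoc (_ ^ b), ← pow_add, ← h1]
    ring
  rw [HasDefect, β.image_zCh hn, ← hr, h2]
  ext x
  constructor
  · rintro ⟨s, rfl⟩
    refine ⟨u' * (v'⁻¹ : Rˣ) * s, ?_⟩
    simp only [map_mul, map_pow, map_natCast]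
    ring
  · rintro ⟨s, rfl⟩
    refine ⟨v' * (u'⁻¹ : Rˣ) * s, ?_⟩
    dsimp only
    rw [← map_mul, ← map_natCast (algebraMap R F), ← map_pow, ← map_mul]
    congr 1
    have e1 : (u' : R) * (u'⁻¹ : Rˣ) = 1 := u'.mul_inv
    have e2 : ((v'⁻¹ : Rˣ) : R) * v' = 1 := v'.inv_mul
    calc _ = (p : R) ^ d * (u' * (u'⁻¹ : Rˣ)) * ((v'⁻¹ : Rˣ) * v') * s := by ring
      _ = _ := by rw [e1, e2, mul_one, mul_one]

end defect

/-! ### Finite extensions of complete discrete valuation rings -/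

/-- A finite free algebra over an `I`-adically complete ring is `I`-adically complete. -/
theorem isAdicComplete_of_finite_free {O A : Type*} [CommRing O] (I : Ideal O) [IsAdicComplete I O]
    [CommRing A] [Algebra O A] [Module.Finite O A] [Module.Free O A] :
    IsAdicComplete (I.map (algebraMap O A)) A := by
  rw [IsAdicComplete.map_algebraMap_iff]
  let ι := Module.Free.ChooseBasisIndex O A
  let b : Module.Basis ι O A := Module.Free.chooseBasis O A
  -- In terms of a basis the filtration is coordinatewise, so separation and completeness are
  -- inherited from `O`.
  have hmem : ∀ (k : ℕ) (x : A), x ∈ (I ^ k • ⊤ : Submodule O A) ↔ ∀ i, b.repr x i ∈ I ^ k := by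
    intro k x
    constructor
    · intro hx i
      induction hx using Submodule.smul_induction_on' with
      | smul r hr n _ =>
        rw [map_smul, Finsupp.smul_apply, smul_eq_mul]
        exact Ideal.mul_mem_right _ _ hr
      | add x _ y _ hx hy =>
        rw [map_add, Finsupp.add_apply]
        exact Ideal.add_mem _ hx hy
    · intro h
      rw [← b.sum_repr x]
      exact Submodule.sum_mem _ fun i _ => Submodule.smul_mem_smul (h i) trivial
  have hO : ∀ (k : ℕ), (I ^ k • ⊤ : Submodule O O) = I ^ k := fun k => by
    rw [smul_eq_mul, Ideal.mul_top]
  refine { haus' := fun x hx => ?_, prec' := fun f hf => ?_ }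
  · refine b.ext_elem fun i => ?_
    rw [map_zero, Finsupp.zero_apply]
    refine IsHausdorff.haus' (I := I) _ fun k => ?_
    have := hx k
    rw [SModEq.zero, hmem] at this
    rw [SModEq.zero, hO]
    exact this i
  · have h : ∀ i, ∃ L : O, ∀ k, b.repr (f k) i ≡ L [SMOD (I ^ k • ⊤ : Submodule O O)] :=
      fun i => IsPrecomplete.prec' (I := I) _ fun {m n} hmn => by
        have := hf hmn
        rw [SModEq.sub_mem, hmem] at this
        rw [SModEq.sub_mem, hO]
        simpa using this i
    choose L hL using h
    refine ⟨∑ i, L i • b i, fun k => ?_⟩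
    rw [SModEq.sub_mem, hmem]
    intro i
    have := hL i k
    rw [SModEq.sub_mem, hO] at this
    rwa [map_sub, Finsupp.sub_apply, b.repr_sum_self]

/-- An Artinian ring without nontrivial idempotents is local. -/
theorem isLocalRing_of_isArtinianRing_of_idempotents {A : Type*} [CommRing A] [Nontrivial A]
    [IsArtinianRing A] (h : ∀ x : A, x * x = x → x = 0 ∨ x = 1) : IsLocalRing A := by
  refine IsLocalRing.of_isUnit_or_isUnit_one_sub_self fun x => ?_
  obtain ⟨n, y, hy⟩ := IsArtinian.exists_pow_succ_smul_dvd x (1 : A)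
  rw [smul_eq_mul, smul_eq_mul, mul_one, Nat.succ_eq_add_one] at hy
  have h1 : ∀ k, x ^ (n + 1) = x ^ (n + 1) * (x * y) ^ k := by
    intro k
    induction k with
    | zero => rw [pow_zero, mul_one]
    | succ k ih =>
      conv_lhs => rw [ih, pow_succ x n, ← hy]
      ring
  -- Since x ^ (n + 1) y = x ^ n, a power of xy is idempotent; if it is 0 then x is nilpotent, and
  -- if it is 1 then x is invertible.
  have h2 : (x * y) ^ (n + 1) * (x * y) ^ (n + 1) = (x * y) ^ (n + 1) := by
    conv_rhs => rw [mul_pow, h1 (n + 1)]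
    rw [mul_pow]
    ring
  rcases h _ h2 with h0 | h0
  · right
    have h3 : x ^ (n + 1) = 0 := by rw [h1 (n + 1), h0, mul_zero]
    exact IsNilpotent.isUnit_one_sub ⟨_, h3⟩
  · left
    rw [pow_succ, mul_comm, mul_assoc] at h0
    exact IsUnit.of_mul_eq_one _ h0

/-- A finite free domain over a complete local ring is local. -/
theorem isLocalRing_of_finite_free {O A : Type*} [CommRing O] [IsLocalRing O]
    [IsAdicComplete (IsLocalRing.maximalIdeal O) O] [CommRing A] [IsDomain A] [Algebra O A]
    [Module.Finite O A] [Module.Free O A] : IsLocalRing A := by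
  let J := (IsLocalRing.maximalIdeal O).map (algebraMap O A)
  have hJ : IsAdicComplete J A := isAdicComplete_of_finite_free _
  have hjac : J ≤ (⊥ : Ideal A).jacobson := IsAdicComplete.le_jacobson_bot J
  have hJ1 : J ≠ ⊤ := fun h => by
    have h1 := hjac (h ▸ Submodule.mem_top : (1 : A) ∈ J)
    rw [Ideal.mem_jacobson_bot] at h1
    have := h1 (-1)
    rw [one_mul, neg_add_cancel] at this
    exact not_isUnit_zero this
  have : Nontrivial (A ⧸ J) := Ideal.Quotient.nontrivial_iff.2 hJ1
  have : IsLocalHom (Ideal.Quotient.mk J) := isLocalHom_of_le_jacobson_bot J hjac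
  have : IsArtinianRing (A ⧸ J) := by
    have : Module.Finite (O ⧸ IsLocalRing.maximalIdeal O) (A ⧸ J) :=
      Module.Finite.of_restrictScalars_finite O _ _
    let _ := Ideal.Quotient.field (IsLocalRing.maximalIdeal O)
    exact IsArtinianRing.of_finite (O ⧸ IsLocalRing.maximalIdeal O) (A ⧸ J)
  have : IsLocalRing (A ⧸ J) := by
    refine isLocalRing_of_isArtinianRing_of_idempotents fun x hx => ?_
    obtain ⟨a, rfl⟩ := Ideal.Quotient.mk_surjective x
    have hmonic : (Polynomial.X ^ 2 - Polynomial.X : Polynomial A).Monic := by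
      exact Polynomial.monic_X_pow_sub (by simp)
    -- An idempotent of `A ⧸ J` is a root of X² − X. It lifts to a root in `A` by Hensel's lemma,
    -- and in a domain the only roots are 0 and 1.
    obtain ⟨b, hb, hab⟩ := HenselianRing.is_henselian (I := J) _ hmonic a
      (by
        rw [← Ideal.Quotient.eq_zero_iff_mem]
        simp [sq, hx])
      (by
        -- The derivative 2a − 1 is its own inverse modulo `J`, since (2a − 1)² − 1 = 4(a² − a).
        refine IsUnit.of_mul_eq_one (Ideal.Quotient.mk J
          ((Polynomial.X ^ 2 - Polynomial.X : Polynomial A).derivative.eval a)) ?_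
        rw [← map_mul, ← sub_eq_zero, ← (Ideal.Quotient.mk J).map_one, ← map_sub]
        have e : Ideal.Quotient.mk J (a * a - a) = 0 := by rw [map_sub, map_mul, hx, sub_self]
        have e2 : (Polynomial.X ^ 2 - Polynomial.X : Polynomial A).derivative.eval a = 2 * a - 1 := by
          simp [one_add_one_eq_two]
        rw [e2, show (2 * a - 1) * (2 * a - 1) - 1 = 4 * (a * a - a) by ring, map_mul, e,
          mul_zero])
    have hb' : b = 0 ∨ b = 1 := by
      have h1 : b * (b - 1) = 0 := by
        have : b ^ 2 - b = 0 := by simpa using hb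
        linear_combination this
      rcases mul_eq_zero.1 h1 with h | h
      · exact Or.inl h
      · exact Or.inr (sub_eq_zero.1 h)
    have hab' : Ideal.Quotient.mk J a = Ideal.Quotient.mk J b := (Ideal.Quotient.eq.2 hab).symm
    rcases hb' with rfl | rfl
    · exact Or.inl (by rw [hab', map_zero])
    · exact Or.inr (by rw [hab', map_one])
  exact RingHom.domain_isLocalRing (Ideal.Quotient.mk J)

section ramification

variable {O : Type*} [CommRing O] [IsDomain O] [IsDiscreteValuationRing O]
  [IsAdicComplete (IsLocalRing.maximalIdeal O) O] [CharZero O]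
  (K : Type*) [Field K] [Algebra O K] [IsFractionRing O K]
  (K' : Type*) [Field K'] [Algebra K K'] [Algebra O K'] [IsScalarTower O K K']
  [FiniteDimensional K K']
  (O' : Type*) [CommRing O'] [Algebra O O'] [Algebra O' K'] [IsScalarTower O O' K']
  [IsIntegralClosure O' O K']

include O K K'

/-- The ring of integers of a finite extension of the field of fractions of a complete discrete
valuation ring of characteristic zero is a discrete valuation ring. -/
theorem isDiscreteValuationRing_integralClosure :
    ∃ _ : IsDomain O', IsDiscreteValuationRing O' ∧ IsFractionRing O' K' ∧ Module.Finite O O' := by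
  have : CharZero K := charZero_of_injective_algebraMap (IsFractionRing.injective O K)
  have hd : IsDomain O' := (IsIntegralClosure.algebraMap_injective O' O K').isDomain
  have hf : IsFractionRing O' K' := IsIntegralClosure.isFractionRing_of_finite_extension O K K' O'
  have hfin : Module.Finite O O' := IsIntegralClosure.finite O K K' O'
  have hinj : Function.Injective (algebraMap O K') := by
    rw [IsScalarTower.algebraMap_eq O K K']
    exact (algebraMap K K').injective.comp (IsFractionRing.injective O K)
  have : FaithfulSMul O K' := (faithfulSMul_iff_algebraMap_injective _ _).2 hinj
  have hfree : Module.Free O O' := IsIntegralClosure.module_free O K K' O'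
  have hloc : IsLocalRing O' := isLocalRing_of_finite_free (O := O)
  have hded : IsDedekindDomain O' := IsIntegralClosure.isDedekindDomain O K K' O'
  have hinj' : Function.Injective (algebraMap O O') := by
    rw [IsScalarTower.algebraMap_eq O O' K', RingHom.coe_comp] at hinj
    exact hinj.of_comp
  have hnf : ¬ IsField O' := fun h => by
    have : Algebra.IsIntegral O O' := inferInstance
    exact IsDiscreteValuationRing.not_isField O
      (isField_of_isIntegral_of_isField hinj' h)
  exact ⟨hd, ((IsDiscreteValuationRing.TFAE O' hnf).out 0 2).2 hded, hf, hfin⟩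

variable [IsAlgClosed (IsLocalRing.ResidueField O)]

/-- When the residue field is algebraically closed the extension is totally ramified. -/
theorem exists_totally_ramified_uniformizer : ∃ (π : O) (ϖ : O') (u : O'ˣ), Irreducible π ∧
    ϖ ≠ 0 ∧ algebraMap O O' π * u = ϖ ^ Module.finrank K K' := by
  obtain ⟨_, _, _, _⟩ := isDiscreteValuationRing_integralClosure (O := O) K K' O'
  have hinj : Function.Injective (algebraMap O K') := by
    rw [IsScalarTower.algebraMap_eq O K K']
    exact (algebraMap K K').injective.comp (IsFractionRing.injective O K)
  have hinj' : Function.Injective (algebraMap O O') := by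
    rw [IsScalarTower.algebraMap_eq O O' K', RingHom.coe_comp] at hinj
    exact hinj.of_comp
  obtain ⟨π, hπ⟩ := IsDiscreteValuationRing.exists_irreducible O
  obtain ⟨ϖ, hϖ⟩ := IsDiscreteValuationRing.exists_irreducible O'
  have h0 : algebraMap O O' π ≠ 0 := fun h => hπ.ne_zero (hinj' (h.trans (map_zero _).symm))
  -- It remains to see that `j` is the degree. As `O'` is local, the degree is the ramification
  -- index, equal to `j`, times the residue degree, equal to 1 because the residue field of `O` is
  -- algebraically closed.
  obtain ⟨j, u, hu⟩ := IsDiscreteValuationRing.eq_unit_mul_pow_irreducible h0 hϖ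
  refine ⟨π, ϖ, u⁻¹, hπ, hϖ.ne_zero, ?_⟩
  rw [hu, mul_right_comm, Units.mul_inv, one_mul]
  congr 1
  set p := IsLocalRing.maximalIdeal O with hp
  set P := IsLocalRing.maximalIdeal O' with hP
  have hp0 : p ≠ ⊥ := IsDiscreteValuationRing.not_a_field O
  have : Algebra.IsIntegral O O' := inferInstance
  have hPp : P.LiesOver p := ⟨(IsLocalRing.eq_maximalIdeal
    (Ideal.isMaximal_comap_of_isIntegral_of_isMaximal (R := O) P)).symm⟩
  have hmap : p.map (algebraMap O O') = P ^ j := by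
    rw [hp, hP, hπ.maximalIdeal_eq, hϖ.maximalIdeal_eq, Ideal.map_span, Set.image_singleton,
      Ideal.span_singleton_pow, hu, Ideal.span_singleton_mul_left_unit u.isUnit]
  have hram : Ideal.ramificationIdx' p P = j := by
    refine Ideal.ramificationIdx'_spec hmap.le fun h => ?_
    rw [hmap] at h
    rw [hP, hϖ.maximalIdeal_eq, Ideal.span_singleton_pow, Ideal.span_singleton_pow,
      Ideal.span_singleton_le_span_singleton, pow_succ] at h
    obtain ⟨c, hc⟩ := h
    have h1 : ϖ ^ j * 1 = ϖ ^ j * (ϖ * c) := by rw [mul_one, ← mul_assoc]; exact hc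
    exact hϖ.not_isUnit (IsUnit.of_mul_eq_one c
      (mul_left_cancel₀ (pow_ne_zero j hϖ.ne_zero) h1).symm)
  have hinert : Ideal.inertiaDeg' p P = 1 := by
    rw [Ideal.inertiaDeg'_algebraMap]
    let _ := Ideal.Quotient.field p
    have : IsAlgClosed (O ⧸ p) := ‹IsAlgClosed (IsLocalRing.ResidueField O)›
    have : Module.Finite (O ⧸ p) (O' ⧸ P) := Module.Finite.of_restrictScalars_finite O _ _
    have hb := IsAlgClosed.algebraMap_bijective_of_isIntegral (k := O ⧸ p) (K := O' ⧸ P)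
    rw [← (LinearEquiv.ofBijective (Algebra.linearMap (O ⧸ p) (O' ⧸ P)) hb).finrank_eq]
    exact Module.finrank_self _
  have := Ideal.ramificationIdx_mul_inertiaDeg_of_isLocalRing (S := O') K K' hp0
  rw [← this, hram, hinert, mul_one]

/-- In a totally ramified extension of degree divisible by `m` every element of the base field has
an `m`-th root up to units. -/
theorem exists_pow_mul_eq_unit {m : ℕ} (hm : m ∣ Module.finrank K K') {c : K} (hc : c ≠ 0) :
    ∃ (l : K') (u : O'ˣ), l ^ m * algebraMap K K' c = algebraMap O' K' u := by
  obtain ⟨_, _, _, _⟩ := isDiscreteValuationRing_integralClosure (O := O) K K' O'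
  obtain ⟨π, ϖ, u, hπ, hϖ0, hu⟩ := exists_totally_ramified_uniformizer (O := O) K K' O'
  obtain ⟨t, ht⟩ := hm
  -- The degree is mt and π is ϖ ^ (mt) up to a unit, so π ^ i is, up to a unit, the m-th power of ϖ
  -- ^ (ti).
  have key : ∀ a : O, a ≠ 0 → ∃ (i : ℕ) (v : O'ˣ),
      algebraMap O O' a * v = (ϖ ^ i) ^ m := by
    intro a ha
    obtain ⟨i, w, hw⟩ := IsDiscreteValuationRing.eq_unit_mul_pow_irreducible ha hπ
    refine ⟨t * i, u ^ i * (Units.map (algebraMap O O').toMonoidHom w)⁻¹, ?_⟩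
    rw [← pow_mul, show t * i * m = m * t * i by ring, pow_mul, ← ht, ← hu, mul_pow, hw, map_mul,
      map_pow]
    have e : algebraMap O O' w * ((Units.map (algebraMap O O').toMonoidHom w)⁻¹ : O'ˣ) = 1 :=
      Units.mul_inv (Units.map (algebraMap O O').toMonoidHom w)
    rw [Units.val_mul, Units.val_pow_eq_pow_val]
    linear_combination (algebraMap O O' π ^ i * (u : O') ^ i) * e
  obtain ⟨a, b, hb, rfl⟩ := IsFractionRing.div_surjective (A := O) c
  have hb0 : b ≠ 0 := nonZeroDivisors.ne_zero hb
  have ha0 : a ≠ 0 := fun h => hc (by rw [h, map_zero, zero_div])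
  obtain ⟨i, v, hv⟩ := key a ha0
  obtain ⟨j, w, hw⟩ := key b hb0
  have hinj := IsFractionRing.injective O' K'
  have hK : ∀ x : O, algebraMap K K' (algebraMap O K x) = algebraMap O' K' (algebraMap O O' x) :=
    fun x => by rw [← IsScalarTower.algebraMap_apply, ← IsScalarTower.algebraMap_apply]
  have hne : ∀ k, algebraMap O' K' (ϖ ^ k) ≠ 0 := fun k h =>
    pow_ne_zero k hϖ0 (hinj (h.trans (map_zero _).symm))
  have hw' := congrArg (algebraMap O' K') hw
  have hv' := congrArg (algebraMap O' K') hv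
  rw [map_mul, map_pow _ (ϖ ^ _)] at hw' hv'
  refine ⟨algebraMap O' K' (ϖ ^ j) / algebraMap O' K' (ϖ ^ i), w * v⁻¹, ?_⟩
  have hbn : algebraMap O' K' (algebraMap O O' b) ≠ 0 := by
    intro h
    rw [h, zero_mul] at hw'
    exact pow_ne_zero _ (hne j) hw'.symm
  have hvv : algebraMap O' K' v * algebraMap O' K' (v⁻¹ : O'ˣ) = 1 := by
    rw [← map_mul, Units.mul_inv, map_one]
  rw [map_div₀, hK, hK, div_pow, div_mul_div_comm, div_eq_iff (mul_ne_zero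
    (pow_ne_zero _ (hne i)) hbn), ← hw', ← hv', Units.val_mul, map_mul]
  linear_combination (- algebraMap O' K' (algebraMap O O' b) * algebraMap O' K' w *
    algebraMap O' K' (algebraMap O O' a)) * hvv

end ramification

/-! ### Base change of blocks -/

section ascend

variable {R : Type u} [CommRing R] (R' : Type u) [CommRing R'] [Algebra R R']
  {F : Type u} [Field F] [Algebra R F] (F' : Type u) [Field F'] [Algebra R F']
  [Algebra F F'] [IsScalarTower R F F'] [Algebra R' F'] [IsScalarTower R R' F'] {X : StarGroup R}

theorem StarAlg.ascend_of (x : X) :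
    ascend R' F' X (of F X x) = of F' (X.baseChange R') (X.bcMk R' (1, x)) := lift_of _ _ _

theorem StarGroup.bcMk_eq (c : R'ˣ) (x : X) :
    X.bcMk R' (c, x) = (X.baseChange R').unit c * X.bcMk R' (1, x) := by
  change _ = X.bcMk R' (c, 1) * _
  rw [← map_mul, Prod.mk_mul_mk, one_mul, mul_one]

theorem StarAlg.of_bcMk (c : R'ˣ) (x : X) :
    of F' (X.baseChange R') (X.bcMk R' (c, x)) =
      algebraMap R' F' c • ascend R' F' X (of F X x) := by
  rw [ascend_of, StarGroup.bcMk_eq, of_unit_mul]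

-- The units of `R'` are scalars in the base-changed algebra, so the image of `F_* X` spans it over
-- `F'`.
@[elab_as_elim]
theorem StarAlg.ascend_induction {P : StarAlg F' (X.baseChange R') → Prop}
    (a : StarAlg F' (X.baseChange R')) (hof : ∀ a : StarAlg F X, P (ascend R' F' X a))
    (hadd : ∀ a b, P a → P b → P (a + b)) (hsmul : ∀ (c : F') a, P a → P (c • a)) : P a := by
  induction a using induction_on with
  | hof x =>
    obtain ⟨⟨c, x⟩, rfl⟩ := X.bcMk_surjective R' x
    rw [of_bcMk R' (F := F) F']
    exact hsmul _ _ (hof _)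
  | hadd a b ha hb => exact hadd a b ha hb
  | hsmul c a ha => exact hsmul c a ha

theorem StarAlg.descend_of (c : R'ˣ) (x : X) :
    descend (S := F) R' F' X (of F' _ (X.bcMk R' (c, x))) =
      algebraMap R' F' (c : R') ⊗ₜ[F] of F X x := lift_of _ _ _

theorem StarAlg.descend_ascend (a : StarAlg F X) :
    descend R' F' X (ascend R' F' X a) = 1 ⊗ₜ[F] a := by
  induction a using induction_on with
  | hof x =>
    rw [ascend_of, descend_of, Units.val_one, map_one]
  | hadd a b ha hb => rw [map_add, map_add, ha, hb, TensorProduct.tmul_add]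
  | hsmul c a ha =>
    rw [map_smul, ← algebraMap_smul F' c, map_smul, ha, TensorProduct.smul_tmul',
      algebraMap_smul, TensorProduct.smul_tmul]

theorem StarAlg.extendForm_ascend (f : StarAlg F X →ₗ[F] F) (a : StarAlg F X) :
    extendForm R' F' f (ascend R' F' X a) = algebraMap F F' (f a) := by
  simp only [extendForm, LinearMap.comp_apply, AlgHom.toLinearMap_apply, descend_ascend,
    LinearMap.baseChange_tmul, LinearEquiv.coe_coe, TensorProduct.AlgebraTensorModule.rid_tmul]
  rw [Algebra.smul_def, mul_one]

variable {n : ℕ} (β : MatBlock F (StarAlg F X) n)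

/-- The extension of scalars of the projection onto a block. -/
def MatBlock.ascendπ : StarAlg F' (X.baseChange R') →ₐ[F'] Matrix (Fin n) (Fin n) F' :=
  (Algebra.TensorProduct.lift (Algebra.ofId F' (Matrix (Fin n) (Fin n) F'))
    ((Algebra.ofId F F').mapMatrix.comp β.π) (fun c _ => (Algebra.commutes c _ : Commute _ _))).comp
    (StarAlg.descend R' F' X)

theorem MatBlock.ascendπ_ascend (a : StarAlg F X) :
    β.ascendπ R' F' (StarAlg.ascend R' F' X a) = (β.π a).map (algebraMap F F') := by
  rw [ascendπ, AlgHom.comp_apply, StarAlg.descend_ascend]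
  refine (Algebra.TensorProduct.lift_tmul _ _ _ _ _).trans ?_
  rw [map_one, one_mul]
  rfl

/-- The extension of scalars of the inclusion of a block. -/
def MatBlock.ascendσ : Matrix (Fin n) (Fin n) F' →ₗ[F'] StarAlg F' (X.baseChange R') :=
  ∑ i, ∑ j, (Matrix.entryLinearMap F' F' i j).smulRight
    (StarAlg.ascend R' F' X (β.σ (Matrix.single i j 1)))

theorem MatBlock.ascendσ_map (m : Matrix (Fin n) (Fin n) F) :
    β.ascendσ R' F' (m.map (algebraMap F F')) = StarAlg.ascend R' F' X (β.σ m) := by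
  conv_rhs => rw [Matrix.matrix_eq_sum_single m]
  simp only [ascendσ, LinearMap.sum_apply, LinearMap.smulRight_apply, map_sum]
  refine Finset.sum_congr rfl fun i _ => Finset.sum_congr rfl fun j _ => ?_
  have h : β.σ (Matrix.single i j (m i j)) = m i j • β.σ (Matrix.single i j 1) := by
    rw [← map_smul, Matrix.smul_single, smul_eq_mul, mul_one]
  rw [h, map_smul]
  exact algebraMap_smul F' (m i j) _

/-- Matrix units have their coefficients in `F`. The identities defining a base-changed block are
thereby checked over `F`. -/
theorem Matrix.map_induction {P : Matrix (Fin n) (Fin n) F' → Prop} (m : Matrix (Fin n) (Fin n) F')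
    (hof : ∀ m : Matrix (Fin n) (Fin n) F, P (m.map (algebraMap F F')))
    (hadd : ∀ a b, P a → P b → P (a + b)) (hsmul : ∀ (c : F') a, P a → P (c • a)) : P m := by
  have h0 : P 0 := by simpa using hof 0
  rw [Matrix.matrix_eq_sum_single m]
  refine Finset.sum_induction _ P hadd h0 fun i _ => ?_
  refine Finset.sum_induction _ P hadd h0 fun j _ => ?_
  rw [← mul_one (m i j), ← smul_eq_mul, ← Matrix.smul_single]
  refine hsmul _ _ ?_
  have h := hof (Matrix.single i j 1)
  rwa [Matrix.map_single, map_one] at h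

/-- The extension of scalars of a block. -/
def MatBlock.ascend : MatBlock F' (StarAlg F' (X.baseChange R')) n where
  π := β.ascendπ R' F'
  σ := β.ascendσ R' F'
  π_σ m := by
    induction m using Matrix.map_induction (F := F) with
    | hof m => rw [ascendσ_map, ascendπ_ascend, β.π_σ]
    | hadd a b ha hb => rw [map_add, map_add, ha, hb]
    | hsmul c a ha => rw [map_smul, map_smul, ha]
  mul_σ a m := by
    refine StarAlg.ascend_induction R' (F := F) F' a (fun a => ?_) (fun a b ha hb => ?_)
      (fun c a ha => ?_)
    · induction m using Matrix.map_induction (F := F) with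
      | hof m =>
        rw [ascendσ_map, ascendπ_ascend, ← Matrix.map_mul, ascendσ_map, ← map_mul, β.mul_σ]
      | hadd b c hb hc => rw [map_add, mul_add, hb, hc, mul_add, map_add]
      | hsmul c b hb => rw [map_smul, mul_smul_comm, hb, mul_smul_comm, map_smul]
    · rw [add_mul, ha, hb, map_add (β.ascendπ R' F'), add_mul, map_add]
    · rw [smul_mul_assoc, ha, map_smul (β.ascendπ R' F'), smul_mul_assoc, map_smul]
  σ_mul m a := by
    refine StarAlg.ascend_induction R' (F := F) F' a (fun a => ?_) (fun a b ha hb => ?_)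
      (fun c a ha => ?_)
    · induction m using Matrix.map_induction (F := F) with
      | hof m =>
        rw [ascendσ_map, ascendπ_ascend, ← Matrix.map_mul, ascendσ_map, ← map_mul, β.σ_mul]
      | hadd b c hb hc => rw [map_add, add_mul, hb, hc, add_mul, map_add]
      | hsmul c b hb => rw [map_smul, smul_mul_assoc, hb, smul_mul_assoc, map_smul]
    · rw [mul_add, ha, hb, map_add (β.ascendπ R' F'), mul_add, map_add]
    · rw [mul_smul_comm, ha, map_smul (β.ascendπ R' F'), mul_smul_comm, map_smul]

theorem MatBlock.ascend_e : (β.ascend R' F').e = StarAlg.ascend R' F' X β.e := by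
  rw [e, e, ← ascendσ_map, Matrix.map_one _ (map_zero _) (map_one _)]
  rfl

theorem MatBlock.ascend_π_ascend (a : StarAlg F X) :
    (β.ascend R' F').π (StarAlg.ascend R' F' X a) = (β.π a).map (algebraMap F F') :=
  β.ascendπ_ascend R' F' a

theorem MatBlock.ascend_char : (β.ascend R' F').char = StarAlg.extendForm R' F' β.char := by
  refine LinearMap.ext fun a => ?_
  refine StarAlg.ascend_induction R' (F := F) F' a (fun a => ?_)
    (fun a b ha hb => by rw [map_add, map_add, ha, hb])
    (fun c a ha => by rw [map_smul, map_smul, ha])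
  rw [StarAlg.extendForm_ascend R' F' β.char a, char_apply, ascend_π_ascend, char_apply]
  exact (AddMonoidHom.map_trace (algebraMap F F') _).symm

theorem MatBlock.IsDecomposition.ascend {k : ℕ} {d : Fin k → ℕ}
    {β : (i : Fin k) → MatBlock F (StarAlg F X) (d i)} (h : MatBlock.IsDecomposition β) :
    MatBlock.IsDecomposition (fun i => (β i).ascend R' F') where
  sum_e := by
    rw [Finset.sum_congr rfl fun i _ => (β i).ascend_e R' F', ← map_sum, h.sum_e, map_one]
  π_e i j hij := by
    rw [(β j).ascend_e R' F', (β i).ascend_π_ascend R' F', h.π_e i j hij, Matrix.map_zero _ (map_zero _)]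

end ascend

/-! ### Orders of quotients -/

namespace StarGroup

variable {R : Type u} [CommRing R] (R' : Type u) [CommRing R'] [Algebra R R']

theorem bcOf_mem_units_iff {X : StarGroup R} (x : X) :
    X.bcOf R' x ∈ (X.baseChange R').units ↔ x ∈ X.units := by
  constructor
  · rintro ⟨c, hc⟩
    obtain ⟨d, hd⟩ := (QuotientGroup.eq (s := (antidiagonal R' X).range)).1 hc
    have h2 : X.unit d = 1⁻¹ * x := congrArg Prod.snd hd
    exact ⟨d, by rw [h2, inv_one, one_mul]⟩
  · rintro ⟨c, rfl⟩
    exact ⟨unitsMap R' R c, (bcMk_unit R' X c).symm⟩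

theorem bcMk_eq_bcOf_mul (X : StarGroup R) (c : R'ˣ) (x : X) :
    X.bcMk R' (c, x) = X.bcOf R' x * (X.baseChange R').unit c := by
  change _ = X.bcMk R' (1, x) * X.bcMk R' (c, 1)
  rw [← map_mul, Prod.mk_mul_mk, one_mul, mul_one]

/-- Base change enlarges only the central units, so it leaves the quotient unchanged. -/
theorem exists_baseChange_quo_equiv (X : StarGroup R) :
    ∃ E : X.quo ≃ (X.baseChange R').quo, ∀ x : X,
      E (QuotientGroup.mk x) = QuotientGroup.mk (X.bcOf R' x) :=
  exists_quotient_equiv (X.bcOf R')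
    (fun a b => by rw [← map_inv, ← map_mul, bcOf_mem_units_iff])
    (fun y => by
      obtain ⟨⟨c, x⟩, rfl⟩ := X.bcMk_surjective R' y
      exact ⟨x, by rw [bcMk_eq_bcOf_mul, inv_mul_cancel_left]; exact ⟨c, rfl⟩⟩)

instance finite_baseChange_quo (X : StarGroup R) [Finite X.quo] : Finite (X.baseChange R').quo := by
  obtain ⟨E, -⟩ := X.exists_baseChange_quo_equiv R'
  exact Finite.of_equiv _ E

theorem card_baseChange_quo (X : StarGroup R) :
    Nat.card (X.baseChange R').quo = Nat.card X.quo := by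
  obtain ⟨E, -⟩ := X.exists_baseChange_quo_equiv R'
  exact (Nat.card_congr E).symm

theorem Hom.comap_units {X Y : StarGroup R} (f : Hom X Y) (hf : Function.Injective f.toMonoidHom) :
    Y.units.comap f.toMonoidHom = X.units := by
  ext x
  constructor
  · rintro ⟨c, hc⟩
    exact ⟨c, hf (by rw [f.apply_unit, hc])⟩
  · rintro ⟨c, rfl⟩
    exact ⟨c, (f.apply_unit c).symm⟩

theorem Hom.units_le_range {X Y : StarGroup R} (f : Hom X Y) : Y.units ≤ f.toMonoidHom.range := by
  rintro _ ⟨c, rfl⟩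
  exact ⟨X.unit c, f.apply_unit c⟩

theorem Hom.card_quo {X Y : StarGroup R} (f : Hom X Y) (hf : Function.Injective f.toMonoidHom) :
    Nat.card Y.quo = Nat.card X.quo * f.toMonoidHom.range.index := by
  have h := Subgroup.relIndex_mul_index f.units_le_range
  rw [← Subgroup.index_comap, f.comap_units hf] at h
  exact h.symm

instance finite_sub_quo (X : StarGroup R) [Finite X.quo] (L : Subgroup X) (hL : X.units ≤ L) :
    Finite (X.sub L hL).quo := by
  have h : ((X.sub L hL).units) = X.units.comap L.subtype :=
    ((X.subHom L hL).comap_units Subtype.val_injective).symm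
  have : X.units.FiniteIndex := Subgroup.finiteIndex_of_finite_quotient
  have h2 : (X.units.comap L.subtype).FiniteIndex := inferInstanceAs (X.units.subgroupOf L).FiniteIndex
  change Finite (L ⧸ (X.sub L hL).units)
  rw [h]
  exact Subgroup.finite_quotient_of_finiteIndex

end StarGroup

/-! ### Units in an integrally closed ring -/

/-- Both `x` and `x⁻¹` are integral over `R`. This allows unit conditions on scalars and
determinants to be checked on powers. -/
theorem StarGroup.mem_range_unitsMap_of_pow {R F : Type u} [CommRing R] [Field F] [Algebra R F]
    [IsDomain R] [IsFractionRing R F] [IsIntegrallyClosed R] {m : ℕ} (hm : m ≠ 0) {x : Fˣ}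
    (h : x ^ m ∈ (unitsMap F R).range) : x ∈ (unitsMap F R).range := by
  have key : ∀ y : Fˣ, y ^ m ∈ (unitsMap F R).range → ∃ r : R, algebraMap R F r = y := by
    rintro y ⟨c, hc⟩
    refine IsIntegrallyClosed.isIntegral_iff.1 (IsIntegral.of_pow (Nat.pos_of_ne_zero hm) ?_)
    rw [← Units.val_pow_eq_pow_val, ← hc]
    exact isIntegral_algebraMap
  obtain ⟨r, hr⟩ := key x h
  obtain ⟨s, hs⟩ := key x⁻¹ (by rw [inv_pow]; exact inv_mem h)
  have hrs : r * s = 1 := IsFractionRing.injective R F (by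
    rw [map_mul, hr, hs, Units.mul_inv, map_one])
  exact ⟨⟨r, s, hrs, by rw [mul_comm, hrs]⟩, Units.ext hr⟩

/-! ### The corner algebra of a block -/

namespace MatBlock

variable {F A : Type u} [Field F] [Ring A] [Algebra F A] {n : ℕ} (β : MatBlock F A n)

theorem e_mul_mul_e (a : A) : β.e * a * β.e = β.σ (β.π a) := by
  rw [e_mul, mul_e, π_σ]

/-- The multiplicative map from matrices to the corner algebra of the block. -/
def toCornerHom (he : IsIdempotentElem β.e) : Matrix (Fin n) (Fin n) F →* he.Corner where
  toFun m := ⟨β.σ m, β.σ m, (β.e_mul_mul_e _).trans (by rw [π_σ])⟩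
  map_one' := rfl
  map_mul' m m' := Subtype.ext (β.σ_mul_σ m m').symm

theorem toCorner_eq (he : IsIdempotentElem β.e) (a : A) :
    toCorner he a = β.toCornerHom he (β.π a) := Subtype.ext (β.e_mul_mul_e a)

theorem toCornerHom_algebraMap (he : IsIdempotentElem β.e) (c : F) :
    β.toCornerHom he (algebraMap F _ c) = algebraMap F he.Corner c := by
  rw [Algebra.algebraMap_eq_smul_one, Algebra.algebraMap_eq_smul_one]
  exact Subtype.ext (map_smul β.σ c 1)

end MatBlock

/-! ### Existence of Clifford extensions -/

namespace MatBlock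

open StarGroup

variable {R : Type u} [CommRing R] {F : Type u} [Field F] [Algebra R F] {N H : StarGroup R}
  {n : ℕ} (β : MatBlock F (StarAlg F N) n)

/-- The matrix representation of `N` given by a block of its algebra. -/
def glHom : N.carrier →* GL (Fin n) F :=
  ((β.π : StarAlg F N →* Matrix (Fin n) (Fin n) F).comp (StarAlg.of F N)).toHomUnits

theorem glHom_val (x : N) : (β.glHom x).1 = β.π (StarAlg.of F N x) := rfl

theorem det_algebraMap_matrix (c : F) :
    (algebraMap F (Matrix (Fin n) (Fin n) F) c).det = c ^ n := by
  rw [Algebra.algebraMap_eq_smul_one, Matrix.det_smul, Matrix.det_one, mul_one, Fintype.card_fin]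

/-- The invertible scalar matrices with coefficients in `R`. -/
def scalarHom (R : Type u) [CommRing R] (F : Type u) [Field F] [Algebra R F] (n : ℕ) :
    Rˣ →* GL (Fin n) F :=
  (Units.map (algebraMap F (Matrix (Fin n) (Fin n) F) : F →* _)).comp (unitsMap F R)

theorem glHom_unit (c : Rˣ) : β.glHom (N.unit c) = scalarHom R F n c :=
  Units.ext (by rw [glHom_val, StarAlg.of_unit, AlgHom.commutes]; rfl)

theorem det_scalarHom (c : Rˣ) :
    Matrix.GeneralLinearGroup.det (scalarHom R F n c) = unitsMap F R c ^ n := by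
  refine Units.ext ?_
  change Matrix.det (algebraMap F (Matrix (Fin n) (Fin n) F) (algebraMap R F c)) = _
  rw [det_algebraMap_matrix]
  rfl

theorem scalarHom_central (c : Rˣ) (b : GL (Fin n) F) :
    scalarHom R F n c * b = b * scalarHom R F n c := Units.ext (Algebra.commutes _ _)

/-- Schur's lemma: the images of the elements of `N` span the matrix algebra. -/
theorem exists_scalar_of_commute {b : Matrix (Fin n) (Fin n) F}
    (h : ∀ x, b * β.π (StarAlg.of F N x) = β.π (StarAlg.of F N x) * b) :
    ∃ c : F, b = algebraMap F _ c := by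
  have h1 : ∀ a, b * β.π a = β.π a * b := fun a => by
    induction a using StarAlg.induction_on with
    | hof x => exact h x
    | hadd a a' ha ha' => rw [map_add, mul_add, add_mul, ha, ha']
    | hsmul c a ha => rw [map_smul, mul_smul_comm, smul_mul_assoc, ha]
  have h2 : b ∈ Subalgebra.center F (Matrix (Fin n) (Fin n) F) := by
    rw [Subalgebra.mem_center_iff]
    intro m
    rw [← β.π_σ m, h1]
  rw [Algebra.IsCentral.center_eq_bot] at h2
  obtain ⟨c, hc⟩ := h2
  exact ⟨c, hc.symm⟩

variable (i : StarGroup.Hom N H)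

/-- The pairs formed by an element of `H.quo` and an invertible matrix, with determinant in `Rˣ`,
having the same action on the image of `N`. -/
def cliffordSubgroup (hi : Function.Injective i.toMonoidHom) [i.toMonoidHom.range.Normal] :
    Subgroup (H.quo × GL (Fin n) F) where
  -- Over the identity of `H.quo` the commutation condition leaves the nonzero scalars; the
  -- determinant condition cuts them down to `Rˣ`.
  carrier := {z | Matrix.GeneralLinearGroup.det z.2 ∈ (unitsMap F R).range ∧
    ∀ (h : H) (x x' : N), QuotientGroup.mk h = z.1 →
      i.toMonoidHom x' = h * i.toMonoidHom x * h⁻¹ → z.2 * β.glHom x * z.2⁻¹ = β.glHom x'}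
  one_mem' := by
    refine ⟨by rw [Prod.snd_one, map_one]; exact one_mem _, fun h x x' hh hx => ?_⟩
    obtain ⟨c, rfl⟩ := (QuotientGroup.eq_one_iff h).1 hh
    rw [H.unit_central, mul_inv_cancel_right] at hx
    rw [hi hx, Prod.snd_one, one_mul, inv_one, mul_one]
  mul_mem' := by
    rintro ⟨q, b⟩ ⟨q', b'⟩ ⟨h1, h2⟩ ⟨h1', h2'⟩
    refine ⟨by rw [Prod.snd_mul, map_mul]; exact mul_mem h1 h1', fun h x x' hh hx => ?_⟩
    obtain ⟨k, rfl⟩ := QuotientGroup.mk_surjective q'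
    obtain ⟨y, hy⟩ := ‹i.toMonoidHom.range.Normal›.conj_mem _ ⟨x, rfl⟩ k
    have e1 := h2' k x y rfl hy
    have e2 := h2 (h * k⁻¹) y x' (by rw [QuotientGroup.mk_mul, hh]; exact mul_inv_cancel_right _ _)
      (by rw [hx, hy]; group)
    change b * b' * _ * (b * b')⁻¹ = _
    rw [← e2, ← e1]
    change _ = b * _ * b⁻¹
    group
  inv_mem' := by
    rintro ⟨q, b⟩ ⟨h1, h2⟩
    refine ⟨by rw [Prod.snd_inv, map_inv]; exact inv_mem h1, fun h x x' hh hx => ?_⟩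
    have e := h2 h⁻¹ x' x (by rw [QuotientGroup.mk_inv, hh]; exact inv_inv _) (by rw [hx]; group)
    change b⁻¹ * _ * b⁻¹⁻¹ = _
    rw [← e]
    change b⁻¹ * (b * _ * b⁻¹) * b⁻¹⁻¹ = _
    group

variable [IsDomain R] [IsFractionRing R F] [IsIntegrallyClosed R]

omit [IsDomain R] [IsIntegrallyClosed R] in
theorem scalarHom_injective (hn : n ≠ 0) : Function.Injective (scalarHom R F n) := by
  have : NeZero n := ⟨hn⟩
  intro c d h
  have h1 : algebraMap F (Matrix (Fin n) (Fin n) F) (algebraMap R F c) =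
    algebraMap F (Matrix (Fin n) (Fin n) F) (algebraMap R F d) := congrArg Units.val h
  exact Units.ext (IsFractionRing.injective R F (FaithfulSMul.algebraMap_injective _ _ h1))

/-- A power of `x` lies in `Rˣ` because `N.quo` is finite, so a power of the determinant does. -/
theorem det_glHom_mem [Finite N.quo] (x : N) :
    Matrix.GeneralLinearGroup.det (β.glHom x) ∈ (unitsMap F R).range := by
  refine mem_range_unitsMap_of_pow (m := Nat.card N.quo) Nat.card_pos.ne' ?_
  have h : x ^ Nat.card N.quo ∈ N.units := by
    rw [← QuotientGroup.eq_one_iff, QuotientGroup.mk_pow, pow_card_eq_one']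
  obtain ⟨c, hc⟩ := h
  rw [← map_pow, ← map_pow, ← hc, glHom_unit, det_scalarHom, ← map_pow]
  exact ⟨_, rfl⟩

variable {i} (hi : Function.Injective i.toMonoidHom) [i.toMonoidHom.range.Normal]

/-- The `R^*`-group of pairs formed by an element of `H.quo` and a matrix inducing the same
action on the image of `N`. -/
def cliffordGroup (hn : n ≠ 0) : StarGroup R where
  carrier := β.cliffordSubgroup i hi
  unit := ((1 : Rˣ →* H.quo).prod (scalarHom R F n)).codRestrict _ (fun c => by
    refine ⟨?_, fun h x x' hh hx => ?_⟩
    · change Matrix.GeneralLinearGroup.det (scalarHom R F n c) ∈ _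
      rw [det_scalarHom, ← map_pow]
      exact ⟨_, rfl⟩
    · obtain ⟨d, rfl⟩ := (QuotientGroup.eq_one_iff h).1 hh
      rw [H.unit_central, mul_inv_cancel_right] at hx
      change scalarHom R F n c * _ * (scalarHom R F n c)⁻¹ = _
      rw [hi hx, scalarHom_central, mul_inv_cancel_right])
  unit_injective := fun c d h => scalarHom_injective hn (congrArg (fun z => z.1.2) h)
  unit_central := fun c z => Subtype.ext (Prod.ext
    (by change 1 * z.1.1 = z.1.1 * 1; rw [one_mul, mul_one]) (scalarHom_central c _))

variable [Finite N.quo]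

/-- The embedding of `N` in the group of pairs. -/
def cliffordEmb (hn : n ≠ 0) : StarGroup.Hom N (β.cliffordGroup hi hn) where
  toMonoidHom := (((QuotientGroup.mk' H.units).comp i.toMonoidHom).prod β.glHom).codRestrict
    (β.cliffordSubgroup i hi) (fun y => by
      refine ⟨β.det_glHom_mem y, fun h x x' hh hx => ?_⟩
      obtain ⟨c, hc⟩ := QuotientGroup.eq.1 hh
      have h1 : h = i.toMonoidHom y * (H.unit c)⁻¹ := by rw [hc]; group
      have h2 : x' = y * x * y⁻¹ := hi (by
        rw [hx, h1, map_mul, map_mul, map_inv, ← map_inv H.unit, mul_assoc (i.toMonoidHom y),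
          H.unit_central, map_inv H.unit]
        group)
      rw [h2, map_mul, map_mul, map_inv]
      rfl)
  map_unit := fun c x => by
    refine Subtype.ext (Prod.ext ?_ ?_)
    · change QuotientGroup.mk' H.units (i.toMonoidHom (N.unit c * x)) =
        1 * QuotientGroup.mk' H.units (i.toMonoidHom x)
      rw [map_mul, i.apply_unit, map_mul]
      congr 1
      exact (QuotientGroup.eq_one_iff _).2 ⟨c, rfl⟩
    · change β.glHom (N.unit c * x) = scalarHom R F n c * β.glHom x
      rw [map_mul, glHom_unit]

-- The group of pairs is the required extension. By Schur's lemma an element over 1 is a scalar c,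
-- and c ^ n in `Rˣ` forces c in `Rˣ`; `hlift` gives the surjectivity onto `H.quo`, and the
-- projection to matrices gives `rho`.
include hi in
theorem exists_cliffordExtension (hn : n ≠ 0) {e : StarAlg F N} (heq : e = β.e)
    (he : IsIdempotentElem e)
    (hlift : ∀ h : H, ∃ b : GL (Fin n) F, Matrix.GeneralLinearGroup.det b ∈ (unitsMap F R).range ∧
      ∀ x x' : N, i.toMonoidHom x' = h * i.toMonoidHom x * h⁻¹ →
        b * β.glHom x * b⁻¹ = β.glHom x') : Nonempty (CliffordExtension i he) := by
  subst heq
  have hker : ∀ z : β.cliffordGroup hi hn, z.1.1 = 1 → z ∈ (β.cliffordGroup hi hn).units := by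
    intro z hz
    obtain ⟨c, hc⟩ := β.exists_scalar_of_commute (b := z.1.2.1) (fun x => by
      have h := z.2.2 1 x x (by rw [hz]; rfl) (by group)
      exact congrArg Units.val (mul_inv_eq_iff_eq_mul.1 h))
    have hdet : Matrix.det z.1.2.1 = c ^ n := by
      rw [hc, det_algebraMap_matrix]
    have hc0 : c ≠ 0 := by
      rintro rfl
      have h := (Matrix.GeneralLinearGroup.det z.1.2).ne_zero
      refine h ?_
      change Matrix.det z.1.2.1 = 0
      rw [hdet, zero_pow hn]
    have h2 : Units.mk0 c hc0 ^ n ∈ (unitsMap F R).range := by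
      have h3 := z.2.1
      have h4 : Matrix.GeneralLinearGroup.det z.1.2 = Units.mk0 c hc0 ^ n := Units.ext hdet
      rwa [h4] at h3
    obtain ⟨d, hd⟩ := mem_range_unitsMap_of_pow hn h2
    refine ⟨d, Subtype.ext (Prod.ext hz.symm (Units.ext ?_))⟩
    change algebraMap F _ (unitsMap F R d : F) = z.1.2.1
    rw [hd, hc]
    rfl
  refine ⟨{
    grp := β.cliffordGroup hi hn
    proj := (MonoidHom.fst _ _).comp (β.cliffordSubgroup i hi).subtype
    proj_surjective := fun q => ?_
    ker_proj := ?_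
    emb := β.cliffordEmb hi hn
    emb_injective := ?_
    proj_emb := fun x => rfl
    normalizes := fun y h x x' hy hx => ?_
    rho := (Units.map (β.toCornerHom he)).comp
      ((MonoidHom.snd _ _).comp (β.cliffordSubgroup i hi).subtype)
    rho_unit := fun c => β.toCornerHom_algebraMap he _
    rho_emb := fun x => (β.toCorner_eq he _).symm
    rho_conj := fun y h x x' hy hx => ?_ }⟩
  · obtain ⟨h, rfl⟩ := QuotientGroup.mk_surjective q
    obtain ⟨b, hb, hb'⟩ := hlift h
    refine ⟨⟨(QuotientGroup.mk h, b), hb, fun k x x' hk hx => ?_⟩, rfl⟩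
    obtain ⟨c, hc⟩ := QuotientGroup.eq.1 hk.symm
    have h1 : k = h * H.unit c := by rw [hc]; group
    refine hb' x x' ?_
    rw [hx, h1, mul_assoc h, H.unit_central]
    group
  · refine le_antisymm (fun z hz => hker z hz) ?_
    rintro _ ⟨c, rfl⟩
    rfl
  · rw [injective_iff_map_eq_one]
    intro x hx
    have h1 : (QuotientGroup.mk (i.toMonoidHom x) : H.quo) = 1 := congrArg (fun z => z.1.1) hx
    have h2 : β.glHom x = 1 := congrArg (fun z => z.1.2) hx
    have h3 : i.toMonoidHom x ∈ H.units := (QuotientGroup.eq_one_iff _).1 h1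
    replace h3 : x ∈ H.units.comap i.toMonoidHom := h3
    rw [i.comap_units hi] at h3
    obtain ⟨c, rfl⟩ := h3
    rw [glHom_unit, ← map_one (scalarHom R F n)] at h2
    rw [scalarHom_injective hn h2, map_one]
  · refine Subtype.ext (Prod.ext ?_ (y.2.2 h x x' hy.symm hx))
    change y.1.1 * QuotientGroup.mk (i.toMonoidHom x) * y.1.1⁻¹ = QuotientGroup.mk (i.toMonoidHom x')
    have hy' : y.1.1 = QuotientGroup.mk h := hy
    rw [hx, hy']
    rfl
  · have h1 := y.2.2 h x x' hy.symm hx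
    have h2 := congrArg (fun b => (Units.map (β.toCornerHom he) b).1) h1
    rw [toCorner_eq, toCorner_eq, ← glHom_val, ← glHom_val]
    refine Eq.trans ?_ h2
    rw [map_mul, map_mul, map_inv, Units.val_mul, Units.val_mul]
    rfl

end MatBlock

/-! ### Conjugates of a block of a normal subgroup -/

namespace StarGroup

variable {R : Type u} [CommRing R] {F : Type u} [Field F] [Algebra R F]
  {G : StarGroup R} {N : Subgroup G} [hNn : N.Normal] {hN : G.units ≤ N}

/-- Conjugation by an element of `G` on the normal subgroup `N`. -/
def conjHom (hN : G.units ≤ N) (g : G) : Hom (G.sub N hN) (G.sub N hN) where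
  toFun := conj hN g
  map_one' := Subtype.ext (by
    change g * 1 * g⁻¹ = 1
    rw [mul_one, mul_inv_cancel])
  map_mul' x y := Subtype.ext (by
    change g * (x.1 * y.1) * g⁻¹ = g * x.1 * g⁻¹ * (g * y.1 * g⁻¹)
    group)
  map_unit c x := Subtype.ext (by
    change g * (G.unit c * x.1) * g⁻¹ = G.unit c * (g * x.1 * g⁻¹)
    rw [← mul_assoc g, ← G.unit_central, mul_assoc, mul_assoc, mul_assoc])

theorem map_conjHom_of (g : G) (x : G.sub N hN) :
    StarAlg.map F (conjHom hN g) (StarAlg.of F _ x) = StarAlg.of F _ (conj hN g x) :=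
  StarAlg.map_of _ _

theorem map_conjHom_mul (g h : G) (a : StarAlg F (G.sub N hN)) :
    StarAlg.map F (conjHom hN (g * h)) a =
      StarAlg.map F (conjHom hN g) (StarAlg.map F (conjHom hN h) a) := by
  induction a using StarAlg.induction_on with
  | hof x =>
    rw [map_conjHom_of, map_conjHom_of, map_conjHom_of]
    exact congrArg _ (Subtype.ext (by simp [conj, mul_assoc]))
  | hadd a b ha hb => simp only [map_add, ha, hb]
  | hsmul c a ha => simp only [map_smul, ha]

theorem map_conjHom_of_mem (g : G.sub N hN) (a : StarAlg F (G.sub N hN)) :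
    StarAlg.map F (conjHom hN g.1) a = StarAlg.of F _ g * a * StarAlg.of F _ g⁻¹ := by
  induction a using StarAlg.induction_on with
  | hof x => rw [map_conjHom_of, ← map_mul, ← map_mul]; rfl
  | hadd a b ha hb => rw [map_add, ha, hb, mul_add, add_mul]
  | hsmul c a ha => rw [map_smul, ha, mul_smul_comm, smul_mul_assoc]

end StarGroup

namespace MatBlock

open StarGroup

variable {R : Type u} [CommRing R] {F : Type u} [Field F] [Algebra R F]
  {G : StarGroup R} {N : Subgroup G} [hNn : N.Normal] {hN : G.units ≤ N}
  {n : ℕ} (β : MatBlock F (StarAlg F (G.sub N hN)) n)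

/-- The representation twisted by `g` contains the block and has the same dimension, so the
intertwiner is a square matrix with a one-sided inverse, hence invertible. -/
theorem exists_conj_intertwiner {g : G} (h : β.π (StarAlg.map F (conjHom hN g) β.e) ≠ 0) :
    ∃ b : GL (Fin n) F, ∀ x, b * β.glHom x * b⁻¹ = β.glHom (conj hN g x) := by
  obtain ⟨b, c, hcb, hb⟩ := β.exists_intertwiner (β.π.comp (StarAlg.map F (conjHom hN g))) h
  refine ⟨⟨b, c, mul_eq_one_comm.1 hcb, hcb⟩, fun x => ?_⟩
  refine mul_inv_eq_iff_eq_mul.2 (Units.ext ?_)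
  refine (hb (StarAlg.of F _ x)).trans ?_
  rw [AlgHom.comp_apply, map_conjHom_of]
  rfl

theorem mem_stab_of_intertwiner {g : G} {b : GL (Fin n) F}
    (hb : ∀ x, b * β.glHom x * b⁻¹ = β.glHom (conj hN g x)) : g ∈ stab β.char := by
  intro x
  have h := congrArg (fun z : GL (Fin n) F => z.1.trace) (hb x)
  refine h.symm.trans ?_
  change (b.1 * β.π (StarAlg.of F _ x) * (b⁻¹).1).trace = _
  rw [Matrix.trace_mul_comm, ← mul_assoc, ← Units.val_mul, inv_mul_cancel, Units.val_one, one_mul]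
  rfl

theorem char_comp_conj {g : G} (hg : g ∈ stab β.char) :
    β.char ∘ₗ (StarAlg.map F (conjHom hN g)).toLinearMap = β.char :=
  StarAlg.hom_ext fun x => by
    change β.char (StarAlg.map F (conjHom hN g) (StarAlg.of F _ x)) = _
    rw [map_conjHom_of, hg x]

/-- As `g` fixes the character, the trace of this matrix is n, which is not zero. -/
theorem π_conj_e_ne_zero [CharZero F] (hn : n ≠ 0) {g : G} (hg : g ∈ stab β.char) :
    β.π (StarAlg.map F (conjHom hN g) β.e) ≠ 0 := fun h0 => by
  have h := LinearMap.congr_fun (β.char_comp_conj hg) β.e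
  rw [β.char_e, LinearMap.comp_apply, char_apply] at h
  refine Nat.cast_ne_zero.2 hn (h.symm.trans ?_)
  refine (congrArg Matrix.trace h0).trans ?_
  rw [Matrix.trace_zero]

theorem conj_e_mem_center (g : G) :
    StarAlg.map F (conjHom hN g) β.e ∈ Subalgebra.center F (StarAlg F (G.sub N hN)) := by
  refine StarAlg.mem_center_iff.2 fun x => ?_
  have h : x = conj hN g (conj hN g⁻¹ x) := Subtype.ext (by simp [conj, mul_assoc])
  rw [h, ← map_conjHom_of, ← map_mul, ← map_mul, StarAlg.mem_center_iff.1 β.e_mem_center]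

/-- The conjugates of the idempotent of a block by elements of the stabilizer of its character
coincide with it. -/
theorem conj_e_of_mem_stab [CharZero F] (hn : n ≠ 0) {g : G} (hg : g ∈ stab β.char) :
    StarAlg.map F (conjHom hN g) β.e = β.e := by
  -- One comparison of idempotents for every element of the stabilizer; the one for g⁻¹, transported
  -- by g, is the opposite comparison for g.
  have key : ∀ g : G, g ∈ stab β.char → β.e * StarAlg.map F (conjHom hN g) β.e = β.e := by
    intro g hg
    have h := (β.central_idempotent (β.conj_e_mem_center g)
      (β.e_isIdempotentElem.map _)).resolve_left (β.π_conj_e_ne_zero hn hg)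
    rw [β.e_mul, h]
    rfl
  have h1 := congrArg (StarAlg.map F (conjHom hN g)) (key g⁻¹ (inv_mem hg))
  have h2 : StarAlg.map F (conjHom hN (1 : G)) β.e = β.e := by
    have := map_conjHom_of_mem (1 : G.sub N hN) β.e
    rw [inv_one, map_one, one_mul, mul_one] at this
    exact this
  rw [map_mul, ← map_conjHom_mul, mul_inv_cancel, h2,
    ← Subalgebra.mem_center_iff.1 (β.conj_e_mem_center g), key g hg] at h1
  exact h1.symm

/-- The conjugates of the idempotent of a block by elements outside the stabilizer of its
character are orthogonal to it. -/
theorem e_mul_conj_e {g : G} (hg : g ∉ stab β.char) :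
    β.e * StarAlg.map F (conjHom hN g) β.e = 0 := by
  have h : β.π (StarAlg.map F (conjHom hN g) β.e) = 0 := by
    by_contra h
    obtain ⟨b, hb⟩ := β.exists_conj_intertwiner h
    exact hg (β.mem_stab_of_intertwiner hb)
  rw [β.e_mul, h, map_zero]

end MatBlock

open StarGroup in
theorem MatBlock.glHom_ascend {R : Type u} [CommRing R] (R' : Type u) [CommRing R'] [Algebra R R']
    {F : Type u} [Field F] [Algebra R F] (F' : Type u) [Field F'] [Algebra R F']
    [Algebra F F'] [IsScalarTower R F F'] [Algebra R' F'] [IsScalarTower R R' F'] {X : StarGroup R}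
    {n : ℕ} (β : MatBlock F (StarAlg F X) n) (c : R'ˣ) (x : X) :
    (β.ascend R' F').glHom (X.bcMk R' (c, x)) =
      scalarHom R' F' n c * Matrix.GeneralLinearGroup.map (algebraMap F F') (β.glHom x) := by
  refine Units.ext ?_
  rw [glHom_val, StarAlg.of_bcMk R' (F := F) F', map_smul, β.ascend_π_ascend R' F',
    Algebra.smul_def]
  rfl

/-! ### Existence over a totally ramified extension -/

section existence

open StarGroup MatBlock

variable {O : Type u} [CommRing O] [IsDomain O] [IsDiscreteValuationRing O]
    [IsAdicComplete (IsLocalRing.maximalIdeal O) O] [CharZero O]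
    [IsAlgClosed (IsLocalRing.ResidueField O)]
    {K : Type u} [Field K] [Algebra O K] [IsFractionRing O K]
    {G : StarGroup O} [Finite G.quo]
    (K' : Type u) [Field K'] [Algebra K K'] [Algebra O K'] [IsScalarTower O K K']
    [FiniteDimensional K K'] (hd : Nat.card G.quo ∣ Module.finrank K K')
    (O' : Type u) [CommRing O'] [Algebra O O'] [Algebra O' K'] [IsScalarTower O O' K']
    [IsIntegralClosure O' O K']
    {N : Subgroup G} [N.Normal] {hN : G.units ≤ N} {n : ℕ}
    (β : MatBlock K (StarAlg K (G.sub N hN)) n)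

-- An intertwiner `b₀` over `K` exists because `g` fixes the character. Its power of exponent m =
-- |G| is a scalar c, and the ramification of `K'` provides `l` with l ^ m c a unit of `O'`; the
-- matrix sought is `l b₀`.
include hd in
theorem MatBlock.exists_integral_intertwiner [CharZero K] (hn : n ≠ 0) {g : G}
    (hg : g ∈ stab β.char) :
    ∃ b : GL (Fin n) K', Matrix.GeneralLinearGroup.det b ∈ (unitsMap K' O').range ∧
      ∀ x, b * Matrix.GeneralLinearGroup.map (algebraMap K K') (β.glHom x) * b⁻¹ =
        Matrix.GeneralLinearGroup.map (algebraMap K K') (β.glHom (conj hN g x)) := by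
  obtain ⟨_, _, _, _⟩ := isDiscreteValuationRing_integralClosure (O := O) K K' O'
  obtain ⟨b₀, hb₀⟩ := β.exists_conj_intertwiner (β.π_conj_e_ne_zero hn hg)
  set m := Nat.card G.quo with hm
  have hpow : ∀ (k : ℕ) (x : G.sub N hN),
      b₀ ^ k * β.glHom x * (b₀ ^ k)⁻¹ = β.glHom (conj hN (g ^ k) x) := by
    intro k
    induction k with
    | zero =>
      intro x
      have h : conj hN (g ^ 0) x = x := Subtype.ext (by simp [conj])
      rw [h, pow_zero, one_mul, inv_one, mul_one]
    | succ k ih =>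
      intro x
      have h : conj hN (g ^ (k + 1)) x = conj hN (g ^ k) (conj hN g x) :=
        Subtype.ext (by simp only [conj, pow_succ]; group)
      rw [h, ← ih, ← hb₀, pow_succ]
      group
  -- Since g ^ m lies in the central units, it acts trivially on `N`, and Schur's lemma applies to
  -- `b₀ ^ m`.
  obtain ⟨d, hd'⟩ : g ^ m ∈ G.units := by
    rw [← QuotientGroup.eq_one_iff, QuotientGroup.mk_pow, hm, pow_card_eq_one']
  obtain ⟨c, hc⟩ := β.exists_scalar_of_commute (b := (b₀ ^ m).1) (fun x => by
    have h := hpow m x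
    have h2 : conj hN (g ^ m) x = x := Subtype.ext (by
      rw [← hd']
      change G.unit d * x.1 * (G.unit d)⁻¹ = x.1
      rw [G.unit_central, mul_inv_cancel_right])
    rw [h2] at h
    exact congrArg Units.val (mul_inv_eq_iff_eq_mul.1 h))
  have hdet : (b₀ ^ m).1.det = c ^ n := by rw [hc, det_algebraMap_matrix]
  have hc0 : c ≠ 0 := by
    rintro rfl
    rw [zero_pow hn] at hdet
    exact (Matrix.GeneralLinearGroup.det (b₀ ^ m)).ne_zero hdet
  obtain ⟨l, v, hlv⟩ := exists_pow_mul_eq_unit (O := O) K K' O' hd hc0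
  have hl0 : l ≠ 0 := by
    rintro rfl
    rw [zero_pow (by rw [hm]; exact Nat.card_pos.ne'), zero_mul] at hlv
    exact (v.isUnit.map (algebraMap O' K')).ne_zero hlv.symm
  let L : GL (Fin n) K' := Units.map (algebraMap K' (Matrix (Fin n) (Fin n) K') : K' →* _)
    (Units.mk0 l hl0)
  have hL : ∀ b : GL (Fin n) K', L * b = b * L := fun b => Units.ext (Algebra.commutes _ _)
  have hLdet : (Matrix.GeneralLinearGroup.det L) = Units.mk0 l hl0 ^ n :=
    Units.ext (det_algebraMap_matrix l)
  refine ⟨L * Matrix.GeneralLinearGroup.map (algebraMap K K') b₀, ?_, fun x => ?_⟩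
  · refine mem_range_unitsMap_of_pow (m := m) (by rw [hm]; exact Nat.card_pos.ne') ⟨v ^ n, ?_⟩
    have h1 : b₀.1.det ^ m = c ^ n := by rw [← hdet, Units.val_pow_eq_pow_val, Matrix.det_pow]
    refine Units.ext ?_
    rw [map_mul, hLdet, mul_pow, Units.val_mul, Units.val_pow_eq_pow_val, Units.val_pow_eq_pow_val,
      Units.val_mk0, Units.val_pow_eq_pow_val]
    refine Eq.trans ?_ (congrArg (fun z => (l ^ n) ^ m * z ^ m)
      (RingHom.map_det (algebraMap K K') b₀.1))
    rw [← map_pow, h1, map_pow (algebraMap K K'), pow_right_comm, ← mul_pow, hlv, map_pow]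
    rfl
  · have h1 : ∀ B y : GL (Fin n) K', L * B * y * (L * B)⁻¹ = L * (B * y * B⁻¹) * L⁻¹ :=
      fun B y => by group
    rw [h1, hL, mul_inv_cancel_right, ← hb₀, map_mul, map_mul, map_inv]

include hd in
theorem MatBlock.nonempty_cliffordExtension [CharZero K] (hn : n ≠ 0)
    (hν : IsAbsIrrChar β.char) (he : IsAssociatedIdempotent β.char β.e) :
    Nonempty (CliffordExtension (stabIncl O' hν) (he.ascend O' K')) := by
  obtain ⟨_, _, _, _⟩ := isDiscreteValuationRing_integralClosure (O := O) K K' O'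
  have hinj : Function.Injective (stabIncl O' hν).toMonoidHom :=
    bcMap_injective O' _ (Subgroup.inclusion_injective (le_stab hν))
  refine (β.ascend O' K').exists_cliffordExtension hinj hn (β.ascend_e O' K').symm
    (he.ascend O' K') fun h => ?_
  obtain ⟨⟨d, g⟩, rfl⟩ := bcMk_surjective O' _ h
  obtain ⟨b, hb, hb'⟩ := β.exists_integral_intertwiner K' hd O' hn g.2
  refine ⟨b, hb, fun x x' hx => ?_⟩
  obtain ⟨⟨c, x⟩, rfl⟩ := bcMk_surjective O' _ x
  have h1 : x' = bcMk O' _ (c, conj hN g.1 x) := hinj (by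
    rw [hx]
    refine Eq.trans ?_ (bcMap_bcMk O' (G.inclusion hN (units_le_stab β.char) (le_stab hν)) c
      (conj hN g.1 x)).symm
    refine (congrArg (fun z => bcMk O' _ (d, g) * z * (bcMk O' _ (d, g))⁻¹)
      (bcMap_bcMk O' (G.inclusion hN (units_le_stab β.char) (le_stab hν)) c x)).trans ?_
    rw [← map_inv, ← map_mul, ← map_mul]
    refine congrArg _ (Prod.ext ?_ rfl)
    change d * c * d⁻¹ = c
    rw [mul_comm d c, mul_inv_cancel_right])
  rw [h1, glHom_ascend, glHom_ascend, ← hb', ← mul_assoc, ← scalarHom_central, mul_assoc,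
    mul_assoc, mul_assoc]

end existence

/-! ### Generalities on induced algebras -/

namespace Ind

variable {F L X B : Type u} [Field F] [Group L] [Group X] [Ring B] [Algebra F B]
  {j : L →* X} {hj : Function.Injective j} {s : L →* Bˣ}

theorem ext_apply {f g : Ind F hj s} (h : ∀ u v, f.1 u v = g.1 u v) : f = g :=
  Subtype.ext (funext fun u => funext fun v => h u v)

theorem tmul_apply (x : X) (b : B) (y u v : X) :
    (tmul F hj s x b y).1 u v = extendZero j s (u⁻¹ * x) * b * extendZero j s (y * v) := rfl

theorem str_apply (x u v : X) : (str F hj s x).1 u v = extendZero j s (u⁻¹ * x * v) := rfl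

variable (F hj s) in
/-- The map `b ↦ x ⊗ b ⊗ y`. -/
def tmulₗ (x y : X) : B →ₗ[F] Ind F hj s where
  toFun b := tmul F hj s x b y
  map_add' b b' := ext_apply fun u v => by
    change _ * (b + b') * _ = _ * b * _ + _ * b' * _
    rw [mul_add, add_mul]
  map_smul' c b := ext_apply fun u v => by
    change _ * (c • b) * _ = c • (_ * b * _)
    rw [mul_smul_comm, smul_mul_assoc]

theorem tmulₗ_apply (x y : X) (b : B) : tmulₗ F hj s x y b = tmul F hj s x b y := rfl

theorem tmul_mul_apply_right (x y : X) (b : B) (l : L) :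
    tmul F hj s (x * j l) b y = tmul F hj s x (s l * b) y := by
  have h := tmul_mul_right_left (F := F) (hj := hj) (s := s) x y b l 1
  rwa [map_one, map_one, one_mul, Units.val_one, mul_one] at h

theorem extendZero_one {L X B : Type u} [Group L] [Group X] [Ring B] {j : L →* X}
    (hj : Function.Injective j) (s : L →* Bˣ) : extendZero j s 1 = 1 := by
  rw [← map_one j, extendZero_apply hj, map_one, Units.val_one]

theorem mul_str (f : Ind F hj s) (x u v : X) : (f * str F hj s x).1 u v = f.1 u (x * v) := by
  rw [mul_apply, finsum_eq_single _ (QuotientGroup.mk (x * v) : X ⧸ j.range), mul_summand_out]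
  · rw [str_apply, mul_assoc, inv_mul_cancel, extendZero_one hj s, mul_one]
  · intro q hq
    rw [str_apply, extendZero_of_notMem s, mul_zero]
    intro h
    refine hq ((QuotientGroup.out_eq' q).symm.trans (QuotientGroup.eq.2 ?_))
    rwa [← mul_assoc]

theorem str_mul_tmul (x a y : X) (b : B) :
    str F hj s x * tmul F hj s a b y = tmul F hj s (x * a) b y := by
  refine ext_apply fun u v => ?_
  rw [str_mul, tmul_apply, tmul_apply, mul_inv_rev, inv_inv, mul_assoc u⁻¹]

theorem tmul_mul_str (x a y : X) (b : B) :
    tmul F hj s a b y * str F hj s x = tmul F hj s a b (y * x) := by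
  refine ext_apply fun u v => ?_
  rw [mul_str, tmul_apply, tmul_apply, mul_assoc y]

theorem str_one : str F hj s 1 = 1 := rfl

theorem str_mul_str (x y : X) : str F hj s x * str F hj s y = str F hj s (x * y) := by
  refine ext_apply fun u v => ?_
  rw [str_mul, str_apply, str_apply, mul_inv_rev, inv_inv, mul_assoc u⁻¹]

theorem sum_apply {ι : Type*} (t : Finset ι) (f : ι → Ind F hj s) (u v : X) :
    (∑ a ∈ t, f a).1 u v = ∑ a ∈ t, (f a).1 u v := by
  rw [Submodule.coe_sum, Finset.sum_apply, Finset.sum_apply]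

theorem tmul_mul_tmul_one (x y : X) (b b' : B) :
    tmul F hj s x b 1 * tmul F hj s 1 b' y = tmul F hj s x (b * b') y := by
  rw [tmul_mul_tmul, mul_one, extendZero_one hj s, mul_one]

section finite

variable [Fintype (X ⧸ j.range)]

theorem sum_tmul_one : ∑ q : X ⧸ j.range, tmul F hj s q.out 1 q.out⁻¹ = 1 := by
  refine ext_apply fun u v => ?_
  rw [sum_apply, Finset.sum_eq_single (QuotientGroup.mk u)]
  · obtain ⟨l, hl⟩ := out_eq j u
    rw [hl, tmul_apply, ← str_one, str_apply, mul_one, inv_mul_cancel_left, mul_inv_rev,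
      extendZero_apply hj, ← map_inv, mul_assoc, extendZero_mul_left hj, ← mul_assoc, mul_one,
      ← Units.val_mul, ← map_mul, mul_inv_cancel, map_one, Units.val_one, one_mul]
  · intro q _ hq
    rw [tmul_apply, extendZero_of_notMem s, zero_mul, zero_mul]
    intro h
    exact hq ((QuotientGroup.out_eq' q).symm.trans (QuotientGroup.eq.2 h).symm)
  · exact fun h => absurd (Finset.mem_univ _) h

/-- An element of the induced algebra is a sum of elements `x ⊗ b ⊗ y`. -/
theorem eq_sum_tmul (f : Ind F hj s) :
    f = ∑ q : X ⧸ j.range, ∑ r : X ⧸ j.range, tmul F hj s q.out (f.1 q.out r.out) r.out⁻¹ := by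
  have key : ∀ (u v x y : X), (tmul F hj s x (f.1 x y) y⁻¹).1 u v =
      (tmul F hj s x 1 x⁻¹ : Ind F hj s).1 u x * f.1 x y *
        (tmul F hj s y 1 y⁻¹ : Ind F hj s).1 y v := by
    intro u v x y
    simp only [tmul_apply, inv_mul_cancel, extendZero_one hj s, mul_one,
      one_mul]
  refine ext_apply fun u v => ?_
  rw [sum_apply, Finset.sum_eq_single (QuotientGroup.mk u), sum_apply,
    Finset.sum_eq_single (QuotientGroup.mk v)]
  · obtain ⟨l, hl⟩ := out_eq j u
    obtain ⟨m, hm⟩ := out_eq j v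
    rw [hl, hm, tmul_apply, inv_mul_cancel_left, mul_inv_rev, mul_assoc (j m)⁻¹, inv_mul_cancel,
      mul_one, ← map_inv, extendZero_apply hj, extendZero_apply hj, f.2, ← mul_assoc, ← mul_assoc,
      ← Units.val_mul, ← map_mul, mul_inv_cancel, map_one, Units.val_one, one_mul, mul_assoc,
      ← Units.val_mul, ← map_mul, mul_inv_cancel, map_one, Units.val_one, mul_one]
  · intro q _ hq
    rw [tmul_apply, extendZero_of_notMem s (x := q.out⁻¹ * v), mul_zero]
    intro h
    exact hq ((QuotientGroup.out_eq' q).symm.trans (QuotientGroup.eq.2 h))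
  · exact fun h => absurd (Finset.mem_univ _) h
  · intro q _ hq
    rw [sum_apply]
    refine Finset.sum_eq_zero fun r _ => ?_
    rw [tmul_apply, extendZero_of_notMem s, zero_mul, zero_mul]
    intro h
    exact hq ((QuotientGroup.out_eq' q).symm.trans (QuotientGroup.eq.2 h).symm)
  · exact fun h => absurd (Finset.mem_univ _) h

end finite

variable [j.range.FiniteIndex]

@[elab_as_elim]
theorem induction_on {P : Ind F hj s → Prop} (f : Ind F hj s)
    (htmul : ∀ x b y, P (tmul F hj s x b y)) (hadd : ∀ f g, P f → P g → P (f + g)) : P f := by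
  let _ := Fintype.ofFinite (X ⧸ j.range)
  have h0 : P 0 := by
    have h := htmul 1 0 1
    rwa [← tmulₗ_apply, map_zero] at h
  rw [eq_sum_tmul f]
  exact Finset.sum_induction _ P hadd h0 fun q _ =>
    Finset.sum_induction _ P hadd h0 fun r _ => htmul _ _ _

/-- The linear form on the induced algebra defined by a linear form on `B`. -/
def form (T : B →ₗ[F] F) : Ind F hj s →ₗ[F] F :=
  letI := Fintype.ofFinite (X ⧸ j.range)
  ∑ q : X ⧸ j.range, T ∘ₗ LinearMap.proj q.out ∘ₗ LinearMap.proj q.out ∘ₗ (Ind F hj s).subtype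

theorem form_apply (T : B →ₗ[F] F) (f : Ind F hj s) :
    form T f = ∑ᶠ q : X ⧸ j.range, T (f.1 q.out q.out) := by
  let _ := Fintype.ofFinite (X ⧸ j.range)
  rw [finsum_eq_sum_of_fintype, form, LinearMap.sum_apply]
  rfl

/-- The form is the matrix trace followed by `T`, so the usual exchange of the two summations
applies. -/
theorem form_mul_comm {T : B →ₗ[F] F} (hT : ∀ a b, T (a * b) = T (b * a)) (f g : Ind F hj s) :
    form T (f * g) = form T (g * f) := by
  let _ := Fintype.ofFinite (X ⧸ j.range)
  rw [form_apply, form_apply, finsum_eq_sum_of_fintype, finsum_eq_sum_of_fintype]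
  simp only [mul_apply, finsum_eq_sum_of_fintype, map_sum]
  rw [Finset.sum_comm]
  exact Finset.sum_congr rfl fun q _ => Finset.sum_congr rfl fun r _ => hT _ _

theorem form_tmul_one {T : B →ₗ[F] F} (hT : ∀ a b, T (a * b) = T (b * a)) (b : B) :
    form T (tmul F hj s 1 b 1) = T b := by
  have hinv : ∀ (x : X), ∀ l ∈ j.range, T ((tmul F hj s 1 b 1).1 (x * l) (x * l)) =
      T ((tmul F hj s 1 b 1).1 x x) := by
    rintro x _ ⟨l, rfl⟩
    rw [(tmul F hj s 1 b 1).2, mul_assoc, hT, mul_assoc, ← Units.val_mul, ← map_mul,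
      mul_inv_cancel, map_one, Units.val_one, mul_one]
  rw [form_apply, finsum_quotient_eq_single (φ := fun x => T ((tmul F hj s 1 b 1).1 x x)) hinv 1]
  · rw [tmul_apply, inv_one, mul_one, extendZero_one hj s, one_mul, mul_one]
  · intro y hy
    rw [tmul_apply, extendZero_of_notMem s (x := 1 * y), mul_zero, map_zero]
    rwa [inv_one] at hy

/-- The diagonal entry of the matrix of `x` at z is the image of z⁻¹xz, or zero if this lies outside
the subgroup; hence the formula of induced characters. -/
theorem form_str (T : B →ₗ[F] F) (x : X) :
    form T (str F hj s x) = inducedFun j (fun l => T (s l)) x := by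
  rw [form_apply, inducedFun]
  refine finsum_congr fun q => ?_
  rw [str_apply, extendZero]
  split_ifs with h
  · rfl
  · exact map_zero T

end Ind

/-! ### The twisted group algebra over a conjugacy class of blocks -/

namespace StarAlg

variable {R : Type u} [CommRing R] {F : Type u} [Field F] [Algebra R F] {X Y : StarGroup R}

theorem unitForm_map (f : StarGroup.Hom X Y) (hf : Function.Injective f.toMonoidHom)
    (a : StarAlg F X) : unitForm F Y (map F f a) = unitForm F X a := by
  induction a using induction_on with
  | hof x =>
    rw [map_of]
    by_cases h : x ∈ X.units
    · obtain ⟨c, rfl⟩ := h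
      rw [f.apply_unit, unitForm_of_unit, unitForm_of_unit]
    · rw [unitForm_of_notMem F h, unitForm_of_notMem]
      rwa [← f.comap_units hf] at h
  | hadd a b ha hb => rw [map_add, map_add, map_add, ha, hb]
  | hsmul c a ha => rw [map_smul, map_smul, map_smul, ha]

theorem unitForm_map_mul {k : StarGroup.Hom X Y} {x : Y} (hx : x ∉ k.toMonoidHom.range)
    (a : StarAlg F X) : unitForm F Y (map F k a * of F Y x) = 0 := by
  induction a using induction_on with
  | hof y =>
    rw [map_of, ← map_mul, unitForm_of_notMem]
    intro h
    exact hx ((k.toMonoidHom.range.mul_mem_cancel_left ⟨y, rfl⟩).1 (k.units_le_range h))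
  | hadd a b ha hb => rw [map_add, add_mul, map_add, ha, hb, add_zero]
  | hsmul c a ha => rw [map_smul, smul_mul_assoc, map_smul, ha, smul_zero]

end StarAlg

namespace CliffordExtension

variable {R : Type u} [CommRing R] {F : Type u} [Field F] [Algebra R F]
  {N H : StarGroup R} {i : StarGroup.Hom N H} {e : StarAlg F N} {he : IsIdempotentElem e}
  [i.toMonoidHom.range.Normal] (E : CliffordExtension i he)

theorem redMk_eq_unit {z : E.pairs} {c : Rˣ} (h : E.redMk z = E.red.unit c) :
    z.1.1 ∈ i.toMonoidHom.range := by
  obtain ⟨n, hn⟩ := QuotientGroup.eq.1 h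
  have h1 : E.diffMk (z * E.embPair n) = E.diff.unit c := by
    rw [map_mul]
    exact (congrArg (E.diffMk z * ·) hn).trans (mul_inv_cancel_left _ _)
  obtain ⟨d, h2, -⟩ := (E.diffMk_eq_unit _ c).1 h1
  have h3 : z.1.1 * i.toMonoidHom n = H.unit (c * d) := h2
  rw [eq_mul_inv_of_mul_eq h3]
  exact mul_mem (i.units_le_range ⟨_, rfl⟩) (inv_mem ⟨n, rfl⟩)

theorem redMk_embPair (n : N) : E.redMk (E.embPair n) = 1 :=
  (QuotientGroup.eq_one_iff _).2 ⟨n, rfl⟩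

theorem struct_emb (n : N) : (E.struct (i.toMonoidHom n) : E.tensorAlg) = E.baseElem n := by
  rw [E.struct_apply _ _ (E.proj_emb n), E.rho_emb]
  exact congrArg (E.tensorMk _) ((congrArg (StarAlg.of F E.red) (E.redMk_embPair n)).trans
    (map_one _))

theorem baseElem_unit (c : Rˣ) :
    E.baseElem (N.unit c) = algebraMap F E.tensorAlg (algebraMap R F c) := by
  have h : toCorner he (StarAlg.of F N (N.unit c)) = algebraMap F he.Corner (algebraMap R F c) := by
    rw [← E.rho_emb, E.emb.apply_unit, E.rho_unit]
  rw [baseElem, h]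
  rfl

theorem struct_unit (c : Rˣ) :
    (E.struct (H.unit c) : E.tensorAlg) = algebraMap F E.tensorAlg (algebraMap R F c) := by
  rw [← baseElem_unit, ← struct_emb, i.apply_unit]

/-- The linear form on `F_* N e ⊗ F_* ((H * grp°) / N)` defined by two linear forms. -/
def tensorForm (ν : StarAlg F N →ₗ[F] F) (ζ : StarAlg F E.red →ₗ[F] F) : E.tensorAlg →ₗ[F] F :=
  (TensorProduct.lid F F).toLinearMap ∘ₗ TensorProduct.map (ν ∘ₗ cornerVal (F := F) he) ζ

theorem tensorForm_tensorMk (ν : StarAlg F N →ₗ[F] F) (ζ : StarAlg F E.red →ₗ[F] F)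
    (a : he.Corner) (c : StarAlg F E.red) :
    E.tensorForm ν ζ (E.tensorMk a c) = ν a.1 * ζ c := rfl

theorem tensorForm_struct (ν : StarAlg F N →ₗ[F] F) (ζ : StarAlg F E.red →ₗ[F] F) (h : H) :
    E.tensorForm ν ζ (E.struct h) = E.extTensorRes ν ζ h := by
  obtain ⟨y, hy⟩ := E.proj_surjective (QuotientGroup.mk h)
  rw [E.extTensorRes_apply ν ζ h y hy, E.struct_apply h y hy, tensorForm_tensorMk]
  rfl

@[elab_as_elim]
theorem tensor_induction {P : E.tensorAlg → Prop} (b : E.tensorAlg)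
    (htmul : ∀ a c, P (E.tensorMk a c)) (hadd : ∀ b b', P b → P b' → P (b + b')) : P b := by
  refine TensorProduct.induction_on b ?_ htmul hadd
  have h := htmul 0 0
  rwa [tensorMk, TensorProduct.zero_tmul] at h

theorem tensorForm_mul_comm {ν : StarAlg F N →ₗ[F] F} {ζ : StarAlg F E.red →ₗ[F] F}
    (hν : ∀ a b, ν (a * b) = ν (b * a)) (hζ : ∀ a b, ζ (a * b) = ζ (b * a)) (b b' : E.tensorAlg) :
    E.tensorForm ν ζ (b * b') = E.tensorForm ν ζ (b' * b) := by
  induction b using E.tensor_induction with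
  | hadd b c hb hc => rw [add_mul, mul_add, map_add, map_add, hb, hc]
  | htmul a c =>
    induction b' using E.tensor_induction with
    | hadd b c hb hc => rw [add_mul, mul_add, map_add, map_add, hb, hc]
    | htmul a' c' =>
      rw [← tensorMk_mul, ← tensorMk_mul, tensorForm_tensorMk, tensorForm_tensorMk, hζ]
      exact congrArg (· * _) (hν _ _)

end CliffordExtension

/-- The data of an `R^*`-group `X` with a subgroup `H` and a normal `R^*`-subgroup `N` in `H`, on
which `x` in `X` acts through `α x`, such that `e` is fixed by `H` and orthogonal to its other
conjugates. -/
structure IsCliffordDatum {R : Type u} [CommRing R] {F : Type u} [Field F] [Algebra R F]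
    {N H X : StarGroup R} (i : StarGroup.Hom N H) (j : StarGroup.Hom H X) (k : StarGroup.Hom N X)
    (α : X → StarGroup.Hom N N) (e : StarAlg F N) : Prop where
  injective_left : Function.Injective i.toMonoidHom
  apply_eq : ∀ y, k.toMonoidHom y = j.toMonoidHom (i.toMonoidHom y)
  apply_conj : ∀ x y, k.toMonoidHom ((α x).toMonoidHom y) = x * k.toMonoidHom y * x⁻¹
  map_eq : ∀ x ∈ j.toMonoidHom.range, StarAlg.map F (α x) e = e
  mul_map_eq : ∀ x ∉ j.toMonoidHom.range, e * StarAlg.map F (α x) e = 0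

namespace IsCliffordDatum

variable {R : Type u} [CommRing R] {F : Type u} [Field F] [Algebra R F]
  {N H X : StarGroup R} {i : StarGroup.Hom N H} {j : StarGroup.Hom H X} {k : StarGroup.Hom N X}
  {α : X → StarGroup.Hom N N} {e : StarAlg F N} (D : IsCliffordDatum i j k α e)
  (hj : Function.Injective j.toMonoidHom)

include D

theorem map_conj (x : X) (a : StarAlg F N) : StarAlg.map F k (StarAlg.map F (α x) a) =
    StarAlg.of F X x * StarAlg.map F k a * StarAlg.of F X x⁻¹ := by
  induction a using StarAlg.induction_on with
  | hof y => rw [StarAlg.map_of, StarAlg.map_of, StarAlg.map_of, D.apply_conj, map_mul, map_mul]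
  | hadd a b ha hb => rw [map_add, map_add, map_add, ha, hb, mul_add, add_mul]
  | hsmul c a ha => rw [map_smul, map_smul, map_smul, ha, mul_smul_comm, smul_mul_assoc]

/-- The subgroup fixes `e`, so the conjugates of `e` depend only on cosets, and the trace does not
depend on representatives. -/
theorem conj_mul (x : X) (l : X) (hl : l ∈ j.toMonoidHom.range) :
    StarAlg.of F X (x * l) * StarAlg.map F k e * StarAlg.of F X (x * l)⁻¹ =
      StarAlg.of F X x * StarAlg.map F k e * StarAlg.of F X x⁻¹ := by
  have h := D.map_conj l e
  rw [D.map_eq l hl] at h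
  rw [mul_inv_rev, map_mul, map_mul]
  conv_rhs => rw [h]
  simp only [mul_assoc]

/-- The trace of the idempotent. -/
def trace (_ : IsCliffordDatum i j k α e) : StarAlg F X :=
  ∑ᶠ q : X.carrier ⧸ j.toMonoidHom.range,
    StarAlg.of F X q.out * StarAlg.map F k e * StarAlg.of F X q.out⁻¹

variable [j.toMonoidHom.range.FiniteIndex]

theorem trace_mem_center : D.trace ∈ Subalgebra.center F (StarAlg F X) := by
  refine StarAlg.mem_center_iff.2 fun x => ?_
  rw [trace]
  conv_rhs => rw [← finsum_quotient_mul_left x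
    (φ := fun y => StarAlg.of F X y * StarAlg.map F k e * StarAlg.of F X y⁻¹) D.conj_mul]
  let _ := Fintype.ofFinite (X.carrier ⧸ j.toMonoidHom.range)
  rw [finsum_eq_sum_of_fintype, finsum_eq_sum_of_fintype, Finset.mul_sum, Finset.sum_mul]
  refine Finset.sum_congr rfl fun q _ => ?_
  simp only [mul_inv_rev, map_mul, mul_assoc]
  rw [← map_mul, inv_mul_cancel, map_one, mul_one]

/-- By orthogonality only the coset of 1 contributes to the product with the image of `e`;
centrality of the trace carries this to the other conjugates. The square of `e` remains because
idempotency is not assumed here. -/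
theorem trace_mul (x : X) :
    D.trace * (StarAlg.of F X x * StarAlg.map F k e * StarAlg.of F X x⁻¹) =
      StarAlg.of F X x * (StarAlg.map F k e * StarAlg.map F k e) * StarAlg.of F X x⁻¹ := by
  have h1 : ∀ y, y ∉ j.toMonoidHom.range →
      (StarAlg.of F X y * StarAlg.map F k e * StarAlg.of F X y⁻¹) * StarAlg.map F k e = 0 := by
    intro y hy
    have hy' : y⁻¹ ∉ j.toMonoidHom.range := fun h => hy (inv_mem_iff.1 h)
    have h2 := congrArg (StarAlg.map F k) (D.mul_map_eq _ hy')
    rw [map_mul, D.map_conj, inv_inv, map_zero] at h2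
    have h3 := congrArg (fun z => StarAlg.of F X y * z * StarAlg.of F X y⁻¹) h2
    simp only [mul_zero, zero_mul] at h3
    rw [← h3]
    simp only [mul_assoc]
    rw [← map_mul, mul_inv_cancel, map_one, mul_one]
  have h4 : D.trace * StarAlg.map F k e = StarAlg.map F k e * StarAlg.map F k e := by
    let _ := Fintype.ofFinite (X.carrier ⧸ j.toMonoidHom.range)
    rw [trace, finsum_eq_sum_of_fintype, Finset.sum_mul, ← finsum_eq_sum_of_fintype,
      finsum_quotient_eq_single (φ := fun y => (StarAlg.of F X y * StarAlg.map F k e *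
        StarAlg.of F X y⁻¹) * StarAlg.map F k e) (fun y l hl => by rw [D.conj_mul y l hl]) 1]
    · rw [inv_one, map_one, one_mul, mul_one]
    · intro y hy
      rw [inv_one, one_mul] at hy
      exact h1 y hy
  have h5 := StarAlg.mem_center_iff.1 D.trace_mem_center x
  rw [← mul_assoc, ← mul_assoc, ← h5, mul_assoc (StarAlg.of F X x), h4]

variable (he : IsIdempotentElem e)
include he

theorem trace_mul_map : D.trace * StarAlg.map F k e = StarAlg.map F k e := by
  have h := D.trace_mul 1
  rwa [inv_one, map_one, one_mul, mul_one, one_mul, mul_one, ← map_mul, he.eq] at h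

theorem trace_isIdempotentElem : IsIdempotentElem D.trace := by
  let _ := Fintype.ofFinite (X.carrier ⧸ j.toMonoidHom.range)
  have h : ∀ q : X.carrier ⧸ j.toMonoidHom.range, D.trace * (StarAlg.of F X q.out *
      StarAlg.map F k e * StarAlg.of F X q.out⁻¹) =
      StarAlg.of F X q.out * StarAlg.map F k e * StarAlg.of F X q.out⁻¹ := fun q => by
    rw [D.trace_mul, ← map_mul, he.eq]
  rw [IsIdempotentElem]
  conv_lhs => rhs; rw [trace, finsum_eq_sum_of_fintype]
  rw [Finset.mul_sum, Finset.sum_congr rfl fun q _ => h q, trace, finsum_eq_sum_of_fintype]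

end IsCliffordDatum

namespace CliffordExtension

variable {R : Type u} [CommRing R] {F : Type u} [Field F] [Algebra R F]
  {N H X : StarGroup R} {i : StarGroup.Hom N H} {e : StarAlg F N} {he : IsIdempotentElem e}
  [i.toMonoidHom.range.Normal] (E : CliffordExtension i he)
  {j : StarGroup.Hom H X} (hj : Function.Injective j.toMonoidHom)
  [j.toMonoidHom.range.FiniteIndex]

/-- The structural homomorphism from the group algebra to the induced algebra. -/
def toInd : StarAlg F X →ₐ[F] Ind F hj E.struct :=
  StarAlg.lift
    { toFun := Ind.str F hj E.struct
      map_one' := rfl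
      map_mul' := fun x y => (Ind.str_mul_str x y).symm } (fun c => by
    rw [Algebra.algebraMap_eq_smul_one]
    refine Ind.ext_apply fun u v => ?_
    change extendZero j.toMonoidHom E.struct (u⁻¹ * X.unit c * v) =
      algebraMap R F c • extendZero j.toMonoidHom E.struct (u⁻¹ * 1 * v)
    rw [← X.unit_central, ← j.apply_unit, mul_assoc, extendZero_mul_left hj, E.struct_unit,
      mul_one, Algebra.smul_def])

theorem toInd_of (x : X) : E.toInd hj (StarAlg.of F X x) = Ind.str F hj E.struct x :=
  StarAlg.lift_of _ _ _

variable {hj} {k : StarGroup.Hom N X} {α : X → StarGroup.Hom N N} (D : IsCliffordDatum i j k α e)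

include D

/-- For y in `N`, u⁻¹yv = (u⁻¹v)(v⁻¹yv): moving y to the right of v replaces it by a conjugate,
which acts through the first tensor factor. -/
theorem toInd_map (a : StarAlg F N) (u v : X) : (E.toInd hj (StarAlg.map F k a)).1 u v =
    extendZero j.toMonoidHom E.struct (u⁻¹ * v) *
      E.tensorMk (toCorner he (StarAlg.map F (α v⁻¹) a)) 1 := by
  induction a using StarAlg.induction_on with
  | hof y =>
    rw [StarAlg.map_of, StarAlg.map_of, toInd_of, Ind.str_apply]
    have h : u⁻¹ * k.toMonoidHom y * v =
        u⁻¹ * v * j.toMonoidHom (i.toMonoidHom ((α v⁻¹).toMonoidHom y)) := by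
      rw [← D.apply_eq, D.apply_conj]
      group
    rw [h, extendZero_mul_right hj, E.struct_emb]
    rfl
  | hadd a b ha hb =>
    have h : toCorner he (StarAlg.map F (α v⁻¹) (a + b)) =
        toCorner he (StarAlg.map F (α v⁻¹) a) + toCorner he (StarAlg.map F (α v⁻¹) b) :=
      Subtype.ext (by
        change e * StarAlg.map F (α v⁻¹) (a + b) * e = _ * _ * _ + _ * _ * _
        rw [map_add, mul_add, add_mul])
    rw [h, tensorMk, TensorProduct.add_tmul, map_add, map_add]
    exact (congrArg₂ (· + ·) ha hb).trans (mul_add _ _ _).symm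
  | hsmul c a ha =>
    have h : toCorner he (StarAlg.map F (α v⁻¹) (c • a)) =
        c • toCorner he (StarAlg.map F (α v⁻¹) a) :=
      Subtype.ext (by
        change e * StarAlg.map F (α v⁻¹) (c • a) * e = c • (_ * _ * _)
        rw [map_smul, mul_smul_comm, smul_mul_assoc])
    rw [h, tensorMk, ← TensorProduct.smul_tmul', map_smul, map_smul]
    exact (congrArg (c • ·) ha).trans (mul_smul_comm _ _ _).symm

/-- If v is outside the subgroup, the conjugate of `e` by v⁻¹ is orthogonal to `e` and the (u, v)
entry vanishes; otherwise this conjugate is `e` itself. -/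
theorem toInd_idem : E.toInd hj (StarAlg.map F k e) = Ind.tmul F hj E.struct 1 1 1 := by
  refine Ind.ext_apply fun u v => ?_
  rw [E.toInd_map D, Ind.tmul_apply, mul_one, one_mul, mul_one]
  by_cases hv : v ∈ j.toMonoidHom.range
  · have h : toCorner he e = 1 := Subtype.ext (by
      change e * e * e = e
      rw [he.eq, he.eq])
    rw [D.map_eq _ (inv_mem hv), h, tensorMk_one, mul_one]
    obtain ⟨l, rfl⟩ := hv
    rw [extendZero_mul_right hj, extendZero_apply hj]
  · have h : toCorner he (StarAlg.map F (α v⁻¹) e) = 0 := Subtype.ext (by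
      change e * _ * e = 0
      rw [D.mul_map_eq _ (fun h => hv (inv_mem_iff.1 h)), zero_mul])
    rw [h, tensorMk, TensorProduct.zero_tmul, extendZero_of_notMem _ hv, mul_zero]
    exact mul_zero _

theorem toInd_trace : E.toInd hj D.trace = 1 := by
  let _ := Fintype.ofFinite (X.carrier ⧸ j.toMonoidHom.range)
  rw [IsCliffordDatum.trace, finsum_eq_sum_of_fintype, map_sum, ← Ind.sum_tmul_one]
  refine Finset.sum_congr rfl fun q _ => ?_
  rw [map_mul, map_mul, toInd_of, toInd_of, E.toInd_idem D, Ind.str_mul_tmul, Ind.tmul_mul_str,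
    mul_one, one_mul]

theorem toInd_mul_idem (y : N) : E.toInd hj (StarAlg.of F X (k.toMonoidHom y) * StarAlg.map F k e) =
    Ind.tmul F hj E.struct 1 (E.baseElem y) 1 := by
  rw [map_mul, toInd_of, E.toInd_idem D, Ind.str_mul_tmul, mul_one, D.apply_eq]
  have h := Ind.tmul_mul_apply_right (F := F) (hj := hj) (s := E.struct) 1 1 1 (i.toMonoidHom y)
  rwa [one_mul, mul_one, E.struct_emb] at h

/-- The image contains 1 ⊗ (ne ⊗ 1) ⊗ 1 for n in `N`, hence all of the first tensor factor, and 1 ⊗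
s ⊗ 1 for s the image of an element of `H`. Together these give the second tensor factor, and
translations by `X` give the rest. -/
theorem toInd_surjective : Function.Surjective (E.toInd hj) := by
  have h0 : Ind.tmul F hj E.struct 1 1 1 ∈ (E.toInd hj).range := ⟨_, E.toInd_idem D⟩
  have hmul : ∀ b b', Ind.tmul F hj E.struct 1 b 1 ∈ (E.toInd hj).range →
      Ind.tmul F hj E.struct 1 b' 1 ∈ (E.toInd hj).range →
      Ind.tmul F hj E.struct 1 (b * b') 1 ∈ (E.toInd hj).range := by
    intro b b' hb hb'
    rw [← Ind.tmul_mul_tmul_one]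
    exact mul_mem hb hb'
  have hadd : ∀ b b', Ind.tmul F hj E.struct 1 b 1 ∈ (E.toInd hj).range →
      Ind.tmul F hj E.struct 1 b' 1 ∈ (E.toInd hj).range →
      Ind.tmul F hj E.struct 1 (b + b') 1 ∈ (E.toInd hj).range := by
    intro b b' hb hb'
    rw [← Ind.tmulₗ_apply, map_add]
    exact add_mem hb hb'
  have hsmul : ∀ (c : F) b, Ind.tmul F hj E.struct 1 b 1 ∈ (E.toInd hj).range →
      Ind.tmul F hj E.struct 1 (c • b) 1 ∈ (E.toInd hj).range := by
    intro c b hb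
    rw [← Ind.tmulₗ_apply, map_smul]
    exact Subalgebra.smul_mem _ hb c
  have h1 : ∀ a : he.Corner, Ind.tmul F hj E.struct 1 (E.tensorMk a 1) 1 ∈ (E.toInd hj).range := by
    rintro ⟨_, r, rfl⟩
    change Ind.tmul F hj E.struct 1 (E.tensorMk (toCorner he r) 1) 1 ∈ _
    induction r using StarAlg.induction_on with
    | hof y => exact ⟨_, E.toInd_mul_idem D y⟩
    | hadd a b ha hb =>
      have h : E.tensorMk (toCorner he (a + b)) 1 =
          E.tensorMk (toCorner he a) 1 + E.tensorMk (toCorner he b) 1 := by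
        have h : toCorner he (a + b) = toCorner he a + toCorner he b := Subtype.ext (by
          change e * (a + b) * e = e * a * e + e * b * e
          rw [mul_add, add_mul])
        rw [h]
        exact TensorProduct.add_tmul _ _ _
      rw [h]
      exact hadd _ _ ha hb
    | hsmul c a ha =>
      have h : E.tensorMk (toCorner he (c • a)) 1 = c • E.tensorMk (toCorner he a) 1 := by
        have h : toCorner he (c • a) = c • toCorner he a := Subtype.ext (by
          change e * (c • a) * e = c • (e * a * e)
          rw [mul_smul_comm, smul_mul_assoc])
        rw [h]
        exact (TensorProduct.smul_tmul' _ _ _).symm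
      rw [h]
      exact hsmul _ _ ha
  have h2 : ∀ h : H, Ind.tmul F hj E.struct 1 (E.struct h) 1 ∈ (E.toInd hj).range := by
    intro h
    have h3 := Ind.tmul_mul_apply_right (F := F) (hj := hj) (s := E.struct) 1 1 1 h
    rw [one_mul, mul_one] at h3
    rw [← h3]
    have h4 := Ind.str_mul_tmul (F := F) (hj := hj) (s := E.struct) (j.toMonoidHom h) 1 1 1
    rw [mul_one] at h4
    rw [← h4]
    exact mul_mem ⟨_, E.toInd_of hj _⟩ h0
  have h3 : ∀ c : StarAlg F E.red, Ind.tmul F hj E.struct 1 (E.tensorMk 1 c) 1 ∈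
      (E.toInd hj).range := by
    intro c
    induction c using StarAlg.induction_on with
    | hof x =>
      obtain ⟨x, rfl⟩ := QuotientGroup.mk_surjective x
      obtain ⟨⟨⟨h, y⟩, hz⟩, rfl⟩ := E.diffMk_surjective x
      have h4 := E.struct_apply h y hz.symm
      -- The image of h is rho(y) ⊗ (h, y); as rho(y) is invertible in the first factor it can be
      -- divided out.
      have h5 : E.tensorMk 1 (StarAlg.of F E.red (E.redMk (E.pair h y hz.symm))) =
          E.tensorMk ((E.rho y)⁻¹ : (he.Corner)ˣ) 1 * (E.struct h : E.tensorAlg) := by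
        rw [h4, ← tensorMk_mul, Units.inv_mul, one_mul]
      refine Eq.subst (motive := fun b => Ind.tmul F hj E.struct 1 b 1 ∈ (E.toInd hj).range)
        h5.symm (hmul _ _ (h1 _) (h2 h))
    | hadd a b ha hb =>
      have h : E.tensorMk 1 (a + b) = E.tensorMk 1 a + E.tensorMk 1 b :=
        TensorProduct.tmul_add _ _ _
      rw [h]
      exact hadd _ _ ha hb
    | hsmul c a ha =>
      have h : E.tensorMk 1 (c • a) = c • E.tensorMk 1 a := TensorProduct.tmul_smul _ _ _
      rw [h]
      exact hsmul _ _ ha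
  have h4 : ∀ b, Ind.tmul F hj E.struct 1 b 1 ∈ (E.toInd hj).range := by
    intro b
    induction b using E.tensor_induction with
    | hadd b b' hb hb' => exact hadd _ _ hb hb'
    | htmul a c =>
      have h := hmul _ _ (h1 a) (h3 c)
      rwa [← tensorMk_mul, one_mul, mul_one] at h
  intro f
  change f ∈ (E.toInd hj).range
  induction f using Ind.induction_on with
  | hadd f g hf hg => exact add_mem hf hg
  | htmul x b y =>
    have h : Ind.tmul F hj E.struct x b y =
        E.toInd hj (StarAlg.of F X x) * Ind.tmul F hj E.struct 1 b 1 *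
          E.toInd hj (StarAlg.of F X y) := by
      rw [toInd_of, toInd_of, Ind.str_mul_tmul, Ind.tmul_mul_str, mul_one, one_mul]
    rw [h]
    exact mul_mem (mul_mem ⟨_, rfl⟩ (h4 b)) ⟨_, rfl⟩

omit D in
theorem unitForm_redMk {z : E.pairs} (hz : z.1.1 ∉ i.toMonoidHom.range) :
    StarAlg.unitForm F E.red (StarAlg.of F E.red (E.redMk z)) = 0 := by
  refine StarAlg.unitForm_of_notMem F ?_
  rintro ⟨c, hc⟩
  exact hz (E.redMk_eq_unit hc.symm)

variable [CharZero F] [Finite N.quo] {n : ℕ} (β : MatBlock F (StarAlg F N) n) (hn : n ≠ 0)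
  (hβ : β.e = e)

-- The terms at a coset q on both sides are the values of two functions at q⁻¹xq, and these
-- functions agree: on `N` by `unitForm_e_mul`, and outside `N` because both vanish.
include hn hβ in
theorem form_toInd_of (x : X) :
    Ind.form (E.tensorForm β.char (StarAlg.unitForm F E.red)) (E.toInd hj (StarAlg.of F X x)) =
      (Nat.card N.quo : F) / n * StarAlg.unitForm F X (D.trace * StarAlg.of F X x) := by
  have hk : Function.Injective k.toMonoidHom := fun y z hyz => D.injective_left (hj (by
    rw [← D.apply_eq, ← D.apply_eq, hyz]))
  have key : ∀ w : X, E.tensorForm β.char (StarAlg.unitForm F E.red)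
      (extendZero j.toMonoidHom E.struct w) =
      (Nat.card N.quo : F) / n * StarAlg.unitForm F X (StarAlg.map F k e * StarAlg.of F X w) := by
    intro w
    by_cases hw : w ∈ k.toMonoidHom.range
    · obtain ⟨y, rfl⟩ := hw
      rw [← StarAlg.map_of, ← map_mul, StarAlg.unitForm_map k hk, D.apply_eq,
        extendZero_apply hj, E.struct_emb, baseElem, tensorForm_tensorMk, StarAlg.unitForm_one,
        mul_one]
      change β.char (e * StarAlg.of F N y * e) = _
      rw [← hβ, β.unitForm_e_mul hn, β.e_mul_mul_e, β.char_apply, β.π_σ, β.char_apply]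
    · rw [StarAlg.unitForm_map_mul hw, mul_zero]
      by_cases hw' : w ∈ j.toMonoidHom.range
      · obtain ⟨h, rfl⟩ := hw'
        obtain ⟨y, hy⟩ := E.proj_surjective (QuotientGroup.mk h)
        rw [extendZero_apply hj, E.struct_apply h y hy, tensorForm_tensorMk, E.unitForm_redMk,
          mul_zero]
        rintro ⟨y', hy'⟩
        exact hw ⟨y', by rw [D.apply_eq, hy']; rfl⟩
      · rw [extendZero_of_notMem _ hw', map_zero]
  let _ := Fintype.ofFinite (X.carrier ⧸ j.toMonoidHom.range)
  rw [toInd_of, Ind.form_apply, finsum_eq_sum_of_fintype, IsCliffordDatum.trace,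
    finsum_eq_sum_of_fintype, Finset.sum_mul, map_sum, Finset.mul_sum]
  refine Finset.sum_congr rfl fun q _ => ?_
  rw [Ind.str_apply, key, mul_assoc (StarAlg.of F X q.out), mul_assoc (StarAlg.of F X q.out),
    StarAlg.unitForm_mul_comm F (StarAlg.of F X q.out)]
  simp only [map_mul, mul_assoc]

include hn hβ in
theorem form_toInd (a : StarAlg F X) :
    Ind.form (E.tensorForm β.char (StarAlg.unitForm F E.red)) (E.toInd hj a) =
      (Nat.card N.quo : F) / n * StarAlg.unitForm F X (D.trace * a) := by
  induction a using StarAlg.induction_on with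
  | hof x => exact E.form_toInd_of D β hn hβ x
  | hadd a b ha hb => rw [map_add, map_add, ha, hb, mul_add, map_add, mul_add]
  | hsmul c a ha =>
    rw [map_smul, map_smul, ha, mul_smul_comm, map_smul, smul_eq_mul, smul_eq_mul, mul_left_comm]

-- By `form_toInd`, an element of the kernel becomes, after multiplication by the trace, orthogonal
-- to everything for the nondegenerate form `unitForm`.
include hn hβ in
theorem trace_mul_eq_zero [Finite X.quo] {a : StarAlg F X} (ha : E.toInd hj a = 0) :
    D.trace * a = 0 := by
  refine StarAlg.eq_zero_of_unitForm_mul _ fun b => ?_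
  have h1 : (Nat.card N.quo : F) / n ≠ 0 :=
    div_ne_zero (Nat.cast_ne_zero.2 Nat.card_pos.ne') (Nat.cast_ne_zero.2 hn)
  refine (mul_eq_zero.1 ?_).resolve_left h1
  rw [← mul_assoc, Subalgebra.mem_center_iff.1 D.trace_mem_center, mul_assoc,
    ← E.form_toInd (hj := hj) D β hn hβ, map_mul, ha, mul_zero, map_zero]

include hn hβ in
/-- The direct factor of the algebra of `X` defined by the conjugates of the idempotent is
isomorphic to the induced algebra. -/
theorem exists_corner_equiv [Finite X.quo] (hf : IsIdempotentElem D.trace) :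
    ∃ Φ : hf.Corner ≃ₐ[F] Ind F hj E.struct, ∀ a, Φ (toCorner hf a) = E.toInd hj a := by
  let φ : hf.Corner →ₐ[F] Ind F hj E.struct :=
    { toFun := fun a => E.toInd hj a.1
      map_one' := E.toInd_trace D
      map_mul' := fun a b => map_mul (E.toInd hj) a.1 b.1
      map_zero' := map_zero (E.toInd hj)
      map_add' := fun a b => map_add (E.toInd hj) a.1 b.1
      commutes' := fun c => by
        rw [Algebra.algebraMap_eq_smul_one, Algebra.algebraMap_eq_smul_one]
        refine (map_smul (E.toInd hj) c D.trace).trans ?_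
        rw [E.toInd_trace D] }
  have h1 : ∀ a, φ (toCorner hf a) = E.toInd hj a := fun a => by
    change E.toInd hj (D.trace * a * D.trace) = _
    rw [map_mul, map_mul, E.toInd_trace D, one_mul, mul_one]
  refine ⟨AlgEquiv.ofBijective φ ⟨?_, fun b => ?_⟩, h1⟩
  · rw [injective_iff_map_eq_zero]
    intro a ha
    obtain ⟨r, hr⟩ := a.2
    have h2 := E.trace_mul_eq_zero D β hn hβ ha
    refine Subtype.ext ?_
    rw [← hr] at h2 ⊢
    dsimp only at h2 ⊢
    rwa [← mul_assoc, ← mul_assoc, hf.eq] at h2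
  · obtain ⟨a, rfl⟩ := E.toInd_surjective D b
    exact ⟨_, h1 a⟩

end CliffordExtension

/-! ### The algebra of a group over a block of a normal subgroup -/

namespace StarGroup

variable {R : Type u} [CommRing R] (R' : Type u) [CommRing R'] [Algebra R R']
  {F : Type u} [Field F] [Algebra R F] (F' : Type u) [Field F'] [Algebra R F']
  [Algebra F F'] [IsScalarTower R F F'] [Algebra R' F'] [IsScalarTower R R' F']

theorem map_bcMap_ascend {X Y : StarGroup R} (f : Hom X Y) (a : StarAlg F X) :
    StarAlg.map F' (bcMap R' f) (StarAlg.ascend R' F' X a) =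
      StarAlg.ascend R' F' Y (StarAlg.map F f a) := by
  induction a using StarAlg.induction_on with
  | hof x =>
    rw [StarAlg.ascend_of R' F' x, StarAlg.map_of, StarAlg.map_of, StarAlg.ascend_of R' F']
    rfl
  | hadd a b ha hb => simp only [map_add, ha, hb]
  | hsmul c a ha =>
    rw [map_smul (StarAlg.ascend R' F' X), ← algebraMap_smul F' c,
      map_smul (StarAlg.map F' (bcMap R' f)), ha, algebraMap_smul, map_smul, map_smul]

variable {R'} in
theorem bcMk_mem_range {X : StarGroup R} {L : Subgroup X} {hL : X.units ≤ L} {c : R'ˣ} {x : X} :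
    X.bcMk R' (c, x) ∈ (bcMap R' (X.subHom L hL)).toMonoidHom.range ↔ x ∈ L := by
  constructor
  · rintro ⟨y, hy⟩
    obtain ⟨⟨d, l⟩, rfl⟩ := bcMk_surjective R' _ y
    rw [bcMap_bcMk] at hy
    obtain ⟨u, hu⟩ := (QuotientGroup.eq (s := (antidiagonal R' X).range)).1 hy
    have h2 : X.unit u = l.1⁻¹ * x := congrArg Prod.snd hu
    exact (L.mul_mem_cancel_left (inv_mem l.2)).1 (h2 ▸ hL ⟨u, rfl⟩)
  · intro hx
    exact ⟨bcMk R' (X.sub L hL) (c, ⟨x, hx⟩), rfl⟩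

variable {G : StarGroup R} {N : Subgroup G} [hNn : N.Normal] {hN : G.units ≤ N} {n : ℕ}
  (β : MatBlock F (StarAlg F (G.sub N hN)) n)

/-- The conjugation action of `G^{R'}` on `N^{R'}`. -/
def bcConj (hN : G.units ≤ N) (x : G.baseChange R') :
    Hom ((G.sub N hN).baseChange R') ((G.sub N hN).baseChange R') :=
  bcMap R' (conjHom hN (G.bcMk_surjective R' x).choose.2)

theorem isCliffordDatum [CharZero F] (hn : n ≠ 0) (hν : IsAbsIrrChar β.char) :
    IsCliffordDatum (stabIncl R' hν) (stabHom R' β.char) (bcMap R' (G.subHom N hN))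
      (bcConj R' hN) (StarAlg.ascend R' F' (G.sub N hN) β.e) where
  injective_left := bcMap_injective R' _ (Subgroup.inclusion_injective (le_stab hν))
  apply_eq y := by
    obtain ⟨⟨c, y⟩, rfl⟩ := bcMk_surjective R' _ y
    rfl
  apply_conj x y := by
    obtain ⟨⟨c, y⟩, rfl⟩ := bcMk_surjective R' _ y
    have h := (G.bcMk_surjective R' x).choose_spec
    rw [bcConj]
    generalize (G.bcMk_surjective R' x).choose = z at h ⊢
    obtain ⟨d, g⟩ := z
    subst h
    refine (bcMap_bcMk R' (G.subHom N hN) c (conj hN g y)).trans ?_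
    refine Eq.trans ?_ (congrArg (fun z => G.bcMk R' (d, g) * z * (G.bcMk R' (d, g))⁻¹)
      (bcMap_bcMk R' (G.subHom N hN) c y)).symm
    rw [← map_inv, ← map_mul, ← map_mul]
    refine congrArg _ (Prod.ext ?_ rfl)
    change c = d * c * d⁻¹
    rw [mul_comm d c, mul_inv_cancel_right]
  map_eq x hx := by
    have h := (G.bcMk_surjective R' x).choose_spec
    rw [bcConj]
    generalize (G.bcMk_surjective R' x).choose = z at h ⊢
    obtain ⟨d, g⟩ := z
    subst h
    rw [ map_bcMap_ascend, β.conj_e_of_mem_stab hn (bcMk_mem_range.1 hx)]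
  mul_map_eq x hx := by
    have h := (G.bcMk_surjective R' x).choose_spec
    rw [bcConj]
    generalize (G.bcMk_surjective R' x).choose = z at h ⊢
    obtain ⟨d, g⟩ := z
    subst h
    rw [ map_bcMap_ascend, ← map_mul,
      β.e_mul_conj_e (fun h => hx (bcMk_mem_range.2 h)), map_zero]

/-- The cosets of the stabilizer in `G` correspond to those of its base change, and the summands
depend only on cosets. -/
theorem idemTrace_eq_trace [CharZero F] (hn : n ≠ 0) (hν : IsAbsIrrChar β.char) :
    idemTrace R' F' β.char β.e = (isCliffordDatum R' F' β hn hν).trace := by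
  rw [IsCliffordDatum.trace]
  refine Eq.trans ?_ (finsum_quotient_out (L := stab β.char)
    (φ := fun x => StarAlg.of F' _ x * StarAlg.map F' (bcMap R' (G.subHom N hN))
      (StarAlg.ascend R' F' (G.sub N hN) β.e) * StarAlg.of F' _ x⁻¹) (G.bcOf R') (fun a b => ?_)
    (fun y => ?_) (IsCliffordDatum.conj_mul (isCliffordDatum R' F' β hn hν)))
  · refine finsum_congr fun q => ?_
    rw [map_inv]
    rfl
  · rw [← map_inv, ← map_mul]
    exact bcMk_mem_range
  · obtain ⟨⟨c, g⟩, rfl⟩ := G.bcMk_surjective R' y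
    refine ⟨g, ?_⟩
    change (G.bcMk R' (1, g))⁻¹ * G.bcMk R' (c, g) ∈ _
    rw [← map_inv, ← map_mul]
    refine bcMk_mem_range.2 ?_
    change g⁻¹ * g ∈ _
    rw [inv_mul_cancel]
    exact one_mem _

theorem exists_idemTrace_corner_equiv [CharZero F] [Finite G.quo] (hn : n ≠ 0)
    (hν : IsAbsIrrChar β.char) (he : IsAssociatedIdempotent β.char β.e)
    (E : CliffordExtension (stabIncl R' hν) (he.ascend R' F')) :
    ∃ hf : IsIdempotentElem (idemTrace R' F' β.char β.e),
      idemTrace R' F' β.char β.e ∈ Subalgebra.center F' (StarAlg F' (G.baseChange R')) ∧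
      ∃ Φ : hf.Corner ≃ₐ[F'] Ind F' (stabHom_injective R' β.char) E.struct,
        (∀ x : G.baseChange R',
          Φ (toCorner hf (StarAlg.of F' _ x)) = Ind.str F' _ E.struct x) ∧
        ∀ y : (G.sub N hN).baseChange R',
          (Φ.symm (Ind.tmul F' _ E.struct 1 (E.baseElem y) 1)).1 =
          StarAlg.of F' _ ((bcMap R' (G.subHom N hN)).toMonoidHom y) * idemIn F' β.e := by
  have : CharZero F' := charZero_of_injective_algebraMap (algebraMap F F').injective
  have D := isCliffordDatum R' F' β hn hν
  have hD : idemTrace R' F' β.char β.e = D.trace := idemTrace_eq_trace R' F' β hn hν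
  have hc := D.trace_mem_center
  have hi := D.trace_isIdempotentElem (he.ascend R' F')
  rw [hD]
  obtain ⟨Φ, hΦ⟩ := E.exists_corner_equiv (hj := stabHom_injective R' β.char) D
    (β.ascend R' F') hn (β.ascend_e R' F') hi
  refine ⟨hi, hc, Φ, fun x => (hΦ _).trans (E.toInd_of _ x), fun y => ?_⟩
  have h := E.toInd_mul_idem (hj := stabHom_injective R' β.char) D y
  rw [← h, ← hΦ, Φ.symm_apply_apply]
  change D.trace * _ * D.trace = _
  have h1 := D.trace_mul_map (he.ascend R' F')
  rw [← Subalgebra.mem_center_iff.1 hc] at h1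
  rw [← Subalgebra.mem_center_iff.1 hc, mul_assoc (StarAlg.of F' _ _), h1, mul_assoc, h1]
  rfl

end StarGroup

/-! ### Blocks of corner algebras -/

namespace MatBlock

section corner

variable {F A C : Type*} [Field F] [Ring A] [Algebra F A] [Ring C] [Algebra F C]

/-- The data identifying `C` with the corner `ε A ε`. -/
structure IsCorner (ι : C →ₗ[F] A) (κ : A →ₗ[F] C) : Prop where
  map_mul : ∀ c c', ι (c * c') = ι c * ι c'
  left_inv : ∀ c, κ (ι c) = c
  right_inv : ∀ a, ι (κ a) = ι 1 * a * ι 1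

variable {ι : C →ₗ[F] A} {κ : A →ₗ[F] C} (hC : IsCorner ι κ)

include hC

theorem IsCorner.isIdempotentElem : IsIdempotentElem (ι 1) := by
  rw [IsIdempotentElem, ← hC.map_mul, mul_one]

theorem IsCorner.one_mul (c : C) : ι 1 * ι c = ι c := by rw [← hC.map_mul, _root_.one_mul]

theorem IsCorner.mul_one (c : C) : ι c * ι 1 = ι c := by rw [← hC.map_mul, _root_.mul_one]

theorem IsCorner.injective : Function.Injective ι := Function.LeftInverse.injective hC.left_inv

theorem IsCorner.mul_apply (c : C) (a : A) : c * κ a = κ (ι c * a) := hC.injective (by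
  rw [hC.map_mul, hC.right_inv, hC.right_inv, ← mul_assoc, ← mul_assoc, ← mul_assoc, hC.mul_one,
    hC.one_mul])

theorem IsCorner.apply_mul (c : C) (a : A) : κ a * c = κ (a * ι c) := hC.injective (by
  rw [hC.map_mul, hC.right_inv, hC.right_inv, mul_assoc, mul_assoc, mul_assoc, hC.one_mul,
    mul_assoc, hC.mul_one])

variable {d r : ℕ} (γ : MatBlock F A d) {P : Matrix (Fin d) (Fin r) F} {Q : Matrix (Fin r) (Fin d) F}
  (hQP : Q * P = 1) (hPQ : P * Q = γ.π (ι 1))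

/-- The block of a corner algebra defined by a block. -/
def ofCorner : MatBlock F C r where
  -- Compression by the rank factorization `P * Q` of the idempotent identifies the corner of the d
  -- × d matrices with the r × r matrices.
  π := AlgHom.ofLinearMap
    { toFun := fun c => Q * γ.π (ι c) * P
      map_add' := fun c c' => by rw [map_add, map_add, Matrix.mul_add, Matrix.add_mul]
      map_smul' := fun t c => by
        rw [map_smul, map_smul, Matrix.mul_smul, Matrix.smul_mul, RingHom.id_apply] }
    (by
      change Q * γ.π (ι 1) * P = 1
      rw [← hPQ, ← Matrix.mul_assoc, hQP, Matrix.one_mul, hQP])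
    (fun c c' => by
      change Q * γ.π (ι (c * c')) * P = Q * γ.π (ι c) * P * (Q * γ.π (ι c') * P)
      have h : Q * γ.π (ι c) * P * (Q * γ.π (ι c') * P) =
          Q * (γ.π (ι c) * (P * Q) * γ.π (ι c')) * P := by simp only [Matrix.mul_assoc]
      rw [h, hPQ, ← map_mul, hC.mul_one, ← map_mul, hC.map_mul])
  σ :=
    { toFun := fun m => κ (γ.σ (P * m * Q))
      map_add' := fun m m' => by rw [Matrix.mul_add, Matrix.add_mul, map_add, map_add]
      map_smul' := fun t m => by
        rw [Matrix.mul_smul, Matrix.smul_mul, map_smul, map_smul, RingHom.id_apply] }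
  π_σ m := by
    change Q * γ.π (ι (κ (γ.σ (P * m * Q)))) * P = m
    rw [hC.right_inv, map_mul, map_mul, γ.π_σ, ← hPQ]
    have h : Q * (P * Q * (P * m * Q) * (P * Q)) * P =
        (Q * P) * (Q * P) * m * (Q * P) * (Q * P) := by simp only [Matrix.mul_assoc]
    rw [h, hQP, Matrix.one_mul, Matrix.one_mul, Matrix.mul_one, Matrix.mul_one]
  mul_σ c m := by
    change c * κ (γ.σ (P * m * Q)) = κ (γ.σ (P * (Q * γ.π (ι c) * P * m) * Q))
    have h : P * (Q * γ.π (ι c) * P * m) * Q = (P * Q) * γ.π (ι c) * (P * m * Q) := by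
      simp only [Matrix.mul_assoc]
    rw [hC.mul_apply, γ.mul_σ, h, hPQ, ← map_mul, hC.one_mul]
  σ_mul m c := by
    change κ (γ.σ (P * m * Q)) * c = κ (γ.σ (P * (m * (Q * γ.π (ι c) * P)) * Q))
    have h : P * (m * (Q * γ.π (ι c) * P)) * Q = (P * m * Q) * (γ.π (ι c) * (P * Q)) := by
      simp only [Matrix.mul_assoc]
    rw [hC.apply_mul, γ.σ_mul, h, hPQ, ← map_mul, hC.mul_one]

theorem ofCorner_π (c : C) : (ofCorner hC γ hQP hPQ).π c = Q * γ.π (ι c) * P := rfl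

theorem ofCorner_e : (ofCorner hC γ hQP hPQ).e = κ (γ.e * ι 1) := by
  change κ (γ.σ (P * 1 * Q)) = _
  rw [Matrix.mul_one, hPQ, e_mul]

theorem ofCorner_char (c : C) : (ofCorner hC γ hQP hPQ).char c = γ.char (ι c) := by
  rw [char_apply, ofCorner_π, Matrix.trace_mul_comm, ← Matrix.mul_assoc, hPQ, ← map_mul,
    hC.one_mul, char_apply]

/-- A decomposition of an algebra in blocks determines one of any corner algebra. -/
theorem IsDecomposition.exists_corner {k : ℕ} {d : Fin k → ℕ}
    {γ : (i : Fin k) → MatBlock F A (d i)} (h : IsDecomposition γ) :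
    ∃ (r : Fin k → ℕ) (δ : (i : Fin k) → MatBlock F C (r i)), IsDecomposition δ ∧
      ∀ i c, (δ i).char c = (γ i).char (ι c) := by
  -- The size `r i` is the rank of the corner idempotent in the i-th block. It may be zero, and the
  -- set of indices is left unchanged.
  have h1 := fun i => Matrix.exists_rank_factorization ((γ i).π (ι 1))
    (hC.isIdempotentElem.map (γ i).π)
  choose r P Q hQP hPQ using h1
  refine ⟨r, fun i => ofCorner hC (γ i) (hQP i) (hPQ i), ⟨?_, fun i j hij => ?_⟩,
    fun i c => ofCorner_char _ _ _ _ c⟩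
  · rw [Finset.sum_congr rfl fun i _ => ofCorner_e hC (γ i) (hQP i) (hPQ i), ← map_sum,
      ← Finset.sum_mul, h.sum_e, _root_.one_mul, hC.left_inv]
  · rw [ofCorner_e, ofCorner_π, hC.right_inv, map_mul, map_mul, map_mul, h.π_e i j hij,
      zero_mul, mul_zero, zero_mul, Matrix.mul_zero, Matrix.zero_mul]

end corner

/-- An algebra decomposed in blocks is a direct product of matrix algebras. -/
theorem IsDecomposition.nonempty_algEquiv {F A : Type*} [Field F] [Ring A] [Algebra F A] {k : ℕ}
    {d : Fin k → ℕ} {γ : (i : Fin k) → MatBlock F A (d i)} (h : IsDecomposition γ) :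
    Nonempty (A ≃ₐ[F] ((i : Fin k) → Matrix (Fin (d i)) (Fin (d i)) F)) := by
  refine ⟨AlgEquiv.ofBijective (AlgHom.pi fun i => (γ i).π) ⟨?_, fun m => ?_⟩⟩
  · rw [injective_iff_map_eq_zero]
    intro a ha
    have h1 : ∀ i, (γ i).π a = 0 := fun i => congrFun ha i
    rw [← one_mul a, ← h.sum_e, Finset.sum_mul]
    exact Finset.sum_eq_zero fun i _ => by rw [(γ i).e_mul, h1, map_zero]
  · refine ⟨∑ j, (γ j).σ (m j), funext fun i => ?_⟩
    change (γ i).π (∑ j, (γ j).σ (m j)) = m i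
    rw [map_sum, Finset.sum_eq_single i, (γ i).π_σ]
    · intro j _ hj
      have h1 : (γ j).σ (m j) = (γ j).e * (γ j).σ (m j) := by rw [(γ j).e_mul, (γ j).π_σ]
      rw [h1, map_mul, h.π_e i j hj.symm, zero_mul]
    · exact fun h => absurd (Finset.mem_univ _) h

/-- Two symmetric linear forms on a matrix algebra are equal if they coincide at a primitive
idempotent. -/
theorem _root_.Matrix.symmetric_form_ext {F : Type*} [Field F] {n : ℕ}
    {φ ψ : Matrix (Fin n) (Fin n) F →ₗ[F] F} (hφ : ∀ a b, φ (a * b) = φ (b * a))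
    (hψ : ∀ a b, ψ (a * b) = ψ (b * a)) (t : Fin n)
    (h : φ (Matrix.single t t 1) = ψ (Matrix.single t t 1)) : φ = ψ := by
  -- From E_ab = E_at E_tb, symmetry gives the value of E_tb E_at, which is E_tt if a = b and 0
  -- otherwise.
  have key : ∀ {χ : Matrix (Fin n) (Fin n) F →ₗ[F] F}, (∀ a b, χ (a * b) = χ (b * a)) → ∀ a b,
      χ (Matrix.single a b 1) = if b = a then χ (Matrix.single t t 1) else 0 := by
    intro χ hχ a b
    have h1 : (Matrix.single a b 1 : Matrix (Fin n) (Fin n) F) =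
        Matrix.single a t 1 * Matrix.single t b 1 := by simp
    rw [h1, hχ]
    split_ifs with hab
    · subst hab
      simp
    · rw [Matrix.single_mul_single_of_ne _ _ _ _ hab, map_zero]
  refine LinearMap.ext fun m => ?_
  rw [Matrix.matrix_eq_sum_single m, map_sum, map_sum]
  refine Finset.sum_congr rfl fun a _ => ?_
  rw [map_sum, map_sum]
  refine Finset.sum_congr rfl fun b _ => ?_
  rw [← mul_one (m a b), ← smul_eq_mul, ← Matrix.smul_single, map_smul, map_smul, key hφ, key hψ, h]

end MatBlock

/-! ### Symmetric forms on an induced algebra -/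

namespace Ind

variable {F L X B : Type u} [Field F] [Group L] [Group X] [Ring B] [Algebra F B]
  {j : L →* X} {hj : Function.Injective j} {s : L →* Bˣ} [j.range.FiniteIndex]

-- Cyclic permutation of the outer factors brings every generator into the corner 1 ⊗ B ⊗ 1, so a
-- symmetric form is determined there.
omit [j.range.FiniteIndex] in
theorem symmetric_form_tmul {φ : Ind F hj s →ₗ[F] F} (hφ : ∀ a b, φ (a * b) = φ (b * a))
    (x y : X) (b : B) :
    φ (tmul F hj s x b y) = φ (tmul F hj s 1 (extendZero j s (y * x) * b) 1) := by
  have h1 := tmul_mul_str (F := F) (hj := hj) (s := s) y x 1 b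
  rw [one_mul] at h1
  have h2 := tmul_mul_tmul_one (F := F) (hj := hj) (s := s) (y * x) 1 b 1
  rw [mul_one] at h2
  rw [← h1, hφ, str_mul_tmul, ← h2, hφ, tmul_mul_tmul, one_mul, one_mul]

theorem symmetric_form_ext {φ ψ : Ind F hj s →ₗ[F] F} (hφ : ∀ a b, φ (a * b) = φ (b * a))
    (hψ : ∀ a b, ψ (a * b) = ψ (b * a))
    (h : ∀ b, φ (tmul F hj s 1 b 1) = ψ (tmul F hj s 1 b 1)) : φ = ψ := by
  refine LinearMap.ext fun f => ?_
  induction f using induction_on with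
  | htmul x b y => rw [symmetric_form_tmul hφ, symmetric_form_tmul hψ, h]
  | hadd f g hf hg => rw [map_add, map_add, hf, hg]

/-- Multiplication on both sides by matrices supported at the coset of 1 extracts the (1, 1) entry.
-/
theorem tmul_one_mul_mul (b b' : B) (f : Ind F hj s) :
    tmul F hj s 1 b 1 * f * tmul F hj s 1 b' 1 = tmul F hj s 1 (b * f.1 1 1 * b') 1 := by
  induction f using induction_on with
  | htmul x c y =>
    rw [tmul_mul_tmul, tmul_mul_tmul, tmul_apply, inv_one, one_mul, mul_one]
    simp only [mul_assoc]
  | hadd f g hf hg =>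
    rw [mul_add, add_mul, hf, hg]
    change tmulₗ F hj s 1 1 _ + tmulₗ F hj s 1 1 _ = tmulₗ F hj s 1 1 (_ * (f.1 1 1 + g.1 1 1) * _)
    rw [← map_add, mul_add, add_mul]

end Ind

/-! ### Blocks of the reduced group -/

namespace MatBlock

variable {F A : Type u} [Field F] [Ring A] [Algebra F A] {n : ℕ} (β : MatBlock F A n)

/-- The linear map from matrices to the corner algebra of the block. -/
def cornerσ (he : IsIdempotentElem β.e) : Matrix (Fin n) (Fin n) F →ₗ[F] he.Corner where
  toFun := β.toCornerHom he
  map_add' m m' := Subtype.ext (map_add β.σ m m')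
  map_smul' c m := Subtype.ext (map_smul β.σ c m)

theorem cornerσ_mul (he : IsIdempotentElem β.e) (m m' : Matrix (Fin n) (Fin n) F) :
    β.cornerσ he (m * m') = β.cornerσ he m * β.cornerσ he m' := map_mul (β.toCornerHom he) m m'

theorem coe_cornerσ (he : IsIdempotentElem β.e) (m : Matrix (Fin n) (Fin n) F) :
    (β.cornerσ he m).1 = β.σ m := rfl

theorem cornerσ_π (he : IsIdempotentElem β.e) (a : he.Corner) :
    β.cornerσ he (β.π a.1) = a := by
  obtain ⟨_, r, rfl⟩ := a
  refine Subtype.ext ?_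
  change β.σ (β.π (β.e * r * β.e)) = β.e * r * β.e
  rw [β.e_mul_mul_e, β.π_σ]

end MatBlock

namespace CliffordExtension

variable {R : Type u} [CommRing R] {F : Type u} [Field F] [Algebra R F]
  {N H X : StarGroup R} {i : StarGroup.Hom N H} {n : ℕ} {β : MatBlock F (StarAlg F N) n}
  {he : IsIdempotentElem β.e} [i.toMonoidHom.range.Normal] (E : CliffordExtension i he)
  {j : StarGroup.Hom H X} (hj : Function.Injective j.toMonoidHom)
  [j.toMonoidHom.range.FiniteIndex] (t : Fin n)

/-- The map `c ↦ ε ⊗ c`, where `ε` is a diagonal matrix unit of the block. -/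
def unitTensor : StarAlg F E.red →ₗ[F] E.tensorAlg where
  toFun c := E.tensorMk (β.cornerσ he (Matrix.single t t 1)) c
  map_add' _ _ := TensorProduct.tmul_add _ _ _
  map_smul' _ _ := TensorProduct.tmul_smul _ _ _

theorem unitTensor_apply (c : StarAlg F E.red) :
    E.unitTensor t c = E.tensorMk (β.cornerσ he (Matrix.single t t 1)) c := rfl

theorem unitTensor_mul (c c' : StarAlg F E.red) :
    E.unitTensor t (c * c') = E.unitTensor t c * E.unitTensor t c' := by
  rw [unitTensor_apply, unitTensor_apply, unitTensor_apply, ← tensorMk_mul, ← β.cornerσ_mul,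
    Matrix.single_mul_single_same, one_mul]

/-- The coefficient in `F_* ((H * grp°) / N)` of a diagonal matrix unit of the block. -/
def unitCoeff : E.tensorAlg →ₗ[F] StarAlg F E.red :=
  (TensorProduct.lid F (StarAlg F E.red)).toLinearMap ∘ₗ
    TensorProduct.map (Matrix.entryLinearMap F F t t ∘ₗ β.π.toLinearMap ∘ₗ
      cornerVal (F := F) he) LinearMap.id

theorem unitCoeff_tensorMk (a : he.Corner) (c : StarAlg F E.red) :
    E.unitCoeff t (E.tensorMk a c) = β.π a.1 t t • c := rfl

theorem unitCoeff_unitTensor (c : StarAlg F E.red) : E.unitCoeff t (E.unitTensor t c) = c := by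
  rw [unitTensor_apply, unitCoeff_tensorMk, β.coe_cornerσ, β.π_σ, Matrix.single_apply_same, one_smul]

theorem unitTensor_unitCoeff (b : E.tensorAlg) :
    E.unitTensor t (E.unitCoeff t b) = E.unitTensor t 1 * b * E.unitTensor t 1 := by
  induction b using E.tensor_induction with
  | hadd b b' hb hb' => rw [map_add, map_add, hb, hb', mul_add, add_mul]
  | htmul a c =>
    have h : (Matrix.single t t 1 : Matrix (Fin n) (Fin n) F) * β.π a.1 * Matrix.single t t 1 =
        β.π a.1 t t • Matrix.single t t 1 := by
      rw [Matrix.single_mul_mul_single, Matrix.smul_single, one_mul, mul_one, smul_eq_mul, mul_one]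
    rw [unitCoeff_tensorMk, map_smul, unitTensor_apply, unitTensor_apply, ← tensorMk_mul,
      ← tensorMk_mul, one_mul, mul_one, ← β.cornerσ_π he a, ← β.cornerσ_mul, ← β.cornerσ_mul,
      β.coe_cornerσ, β.π_σ, h, map_smul]
    exact TensorProduct.smul_tmul' _ _ _

/-- The algebra of the reduced group is a corner of the induced algebra. -/
theorem isCorner_unitTensor : MatBlock.IsCorner
    (Ind.tmulₗ F hj E.struct 1 1 ∘ₗ E.unitTensor t)
    (E.unitCoeff t ∘ₗ LinearMap.proj 1 ∘ₗ LinearMap.proj 1 ∘ₗ (Ind F hj E.struct).subtype) where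
  map_mul c c' := by
    simp only [LinearMap.comp_apply, Ind.tmulₗ_apply]
    rw [Ind.tmul_mul_tmul_one, E.unitTensor_mul]
  left_inv c := by
    simp only [LinearMap.comp_apply, Ind.tmulₗ_apply, Submodule.subtype_apply,
      LinearMap.proj_apply]
    rw [Ind.tmul_apply, inv_one, one_mul, Ind.extendZero_one hj, one_mul, mul_one,
      E.unitCoeff_unitTensor]
  right_inv f := by
    simp only [LinearMap.comp_apply, Ind.tmulₗ_apply, Submodule.subtype_apply,
      LinearMap.proj_apply]
    rw [Ind.tmul_one_mul_mul, E.unitTensor_unitCoeff]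

/-- By symmetry it suffices to compare the forms on 1 ⊗ (a ⊗ c) ⊗ 1. For fixed c this is a symmetric
form in the matrix a, hence a multiple of the trace, and its value at the diagonal unit is ζ(c). -/
theorem form_unique {φ : Ind F hj E.struct →ₗ[F] F} (hφ : ∀ a b, φ (a * b) = φ (b * a))
    {ζ : StarAlg F E.red →ₗ[F] F} (hζ : ∀ a b, ζ (a * b) = ζ (b * a))
    (h : ∀ c, φ (Ind.tmul F hj E.struct 1 (E.unitTensor t c) 1) = ζ c) :
    φ = Ind.form (E.tensorForm β.char ζ) := by
  have hT := E.tensorForm_mul_comm (ν := β.char) β.char_mul_comm hζ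
  refine Ind.symmetric_form_ext hφ (Ind.form_mul_comm hT) fun b => ?_
  induction b using E.tensor_induction with
  | hadd b b' hb hb' =>
    rw [← Ind.tmulₗ_apply, map_add, map_add, map_add, Ind.tmulₗ_apply, Ind.tmulₗ_apply, hb, hb']
  | htmul a c =>
    rw [Ind.form_tmul_one hT, tensorForm_tensorMk, ← β.cornerσ_π he a, β.coe_cornerσ, β.char_apply,
      β.π_σ]
    generalize β.π a.1 = m
    let ψ : Matrix (Fin n) (Fin n) F →ₗ[F] F :=
      { toFun := fun m => φ (Ind.tmul F hj E.struct 1 (E.tensorMk (β.cornerσ he m) c) 1)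
        map_add' := fun m m' => by
          rw [map_add, tensorMk, TensorProduct.add_tmul, ← Ind.tmulₗ_apply]
          exact (congrArg φ (map_add (Ind.tmulₗ F hj E.struct 1 1) _ _)).trans (map_add φ _ _)
        map_smul' := fun s m => by
          rw [map_smul, tensorMk, ← TensorProduct.smul_tmul', ← Ind.tmulₗ_apply]
          exact (congrArg φ (map_smul (Ind.tmulₗ F hj E.struct 1 1) s _)).trans (map_smul φ _ _) }
    have hψ : ∀ a b, ψ (a * b) = ψ (b * a) := by
      intro a b
      have h1 : ∀ x y : he.Corner, φ (Ind.tmul F hj E.struct 1 (E.tensorMk (x * y) c) 1) =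
          φ (Ind.tmul F hj E.struct 1 (E.tensorMk (y * x) c) 1) := by
        intro x y
        have h2 := E.tensorMk_mul x y c 1
        have h3 := E.tensorMk_mul y x 1 c
        rw [mul_one] at h2
        rw [one_mul] at h3
        rw [h2, h3, ← Ind.tmul_mul_tmul_one, hφ, Ind.tmul_mul_tmul_one]
      change φ (Ind.tmul F hj E.struct 1 (E.tensorMk (β.cornerσ he (a * b)) c) 1) =
        φ (Ind.tmul F hj E.struct 1 (E.tensorMk (β.cornerσ he (b * a)) c) 1)
      rw [β.cornerσ_mul, β.cornerσ_mul, h1]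
    have h4 : ψ = (ζ c) • Matrix.traceLinearMap (Fin n) F F := by
      refine Matrix.symmetric_form_ext hψ (fun a b => ?_) t ?_
      · rw [LinearMap.smul_apply, LinearMap.smul_apply, Matrix.traceLinearMap_apply,
          Matrix.traceLinearMap_apply, Matrix.trace_mul_comm]
      · rw [LinearMap.smul_apply, Matrix.traceLinearMap_apply, Matrix.trace_single_eq_same,
          smul_eq_mul, mul_one]
        exact h c
    have h5 := LinearMap.congr_fun h4 m
    rw [LinearMap.smul_apply, Matrix.traceLinearMap_apply, smul_eq_mul, mul_comm] at h5
    exact h5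

variable {hj} {k : StarGroup.Hom N X} {α : X → StarGroup.Hom N N}
  (D : IsCliffordDatum i j k α β.e) [CharZero F] [Finite N.quo] [Finite X.quo]

include D

theorem exists_isCorner_toInd (hn : n ≠ 0) :
    ∃ ι : Ind F hj E.struct →ₗ[F] StarAlg F X, ι 1 = D.trace ∧
      MatBlock.IsCorner ι (E.toInd hj).toLinearMap := by
  have hf := D.trace_isIdempotentElem he
  obtain ⟨Φ, hΦ⟩ := E.exists_corner_equiv (hj := hj) D β hn rfl hf
  have hval : ∀ a, E.toInd hj (Φ.symm a).1 = a := fun a => by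
    obtain ⟨r, hr⟩ := (Φ.symm a).2
    have h1 : Φ.symm a = toCorner hf r := Subtype.ext hr.symm
    have h2 := hΦ r
    rw [← h1, Φ.apply_symm_apply] at h2
    rw [h1]
    change E.toInd hj (D.trace * r * D.trace) = _
    rw [map_mul, map_mul, E.toInd_trace D, one_mul, mul_one, ← h2]
  have h1 : (Φ.symm 1).1 = D.trace := by
    rw [map_one]
    rfl
  refine ⟨cornerVal (F := F) hf ∘ₗ Φ.symm.toLinearMap, h1, ⟨fun c c' => ?_, hval, fun a => ?_⟩⟩
  · change (Φ.symm (c * c')).1 = (Φ.symm c).1 * (Φ.symm c').1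
    rw [map_mul]
    rfl
  · change (Φ.symm (E.toInd hj a)).1 = (Φ.symm 1).1 * a * (Φ.symm 1).1
    rw [h1, ← hΦ, Φ.symm_apply_apply]
    rfl

/-- The blocks of the algebra of the reduced group determined by those of the algebra of the
whole group. -/
theorem exists_blocks_red (hj : Function.Injective j.toMonoidHom) (hn : n ≠ 0) {m : ℕ}
    {d : Fin m → ℕ} {γ : (l : Fin m) → MatBlock F (StarAlg F X) (d l)}
    (hγ : MatBlock.IsDecomposition γ) :
    ∃ (r : Fin m → ℕ) (δ : (l : Fin m) → MatBlock F (StarAlg F E.red) (r l)),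
      MatBlock.IsDecomposition δ ∧ ∀ l, (γ l).char (StarAlg.map F k β.e) = n * r l ∧
        (r l ≠ 0 → d l = j.toMonoidHom.range.index * (n * r l) ∧
          ∀ x, (γ l).char (StarAlg.of F X x) =
            inducedFun j.toMonoidHom (E.extTensorRes β.char (δ l).char) x) := by
  -- Two successive corners: the induced algebra in the algebra of `X`, cut by the trace of the
  -- idempotent, then the algebra of the reduced group in the induced algebra, cut by a diagonal
  -- matrix unit.
  obtain ⟨ι, hι1, hι⟩ := E.exists_isCorner_toInd (hj := hj) D hn
  obtain ⟨d', γ', hγ', h1⟩ := hγ.exists_corner hι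
  obtain ⟨r, δ, hδ, h2⟩ := hγ'.exists_corner (E.isCorner_unitTensor hj ⟨0, Nat.pos_of_ne_zero hn⟩)
  refine ⟨r, δ, hδ, fun l => ?_⟩
  have h3 : (γ' l).char = Ind.form (E.tensorForm β.char (δ l).char) :=
    E.form_unique hj ⟨0, Nat.pos_of_ne_zero hn⟩ (γ' l).char_mul_comm (δ l).char_mul_comm
      fun c => (h2 l c).symm
  have h4 : ∀ a, (γ l).char (D.trace * a * D.trace) =
      Ind.form (E.tensorForm β.char (δ l).char) (E.toInd hj a) := fun a => by
    rw [← hι1, ← hι.right_inv, ← h1, h3]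
    rfl
  have h5 : (γ l).char (StarAlg.map F k β.e) = n * r l := by
    have h6 := D.trace_mul_map he
    have h7 := h4 (StarAlg.map F k β.e)
    rw [h6, Subalgebra.mem_center_iff.1 D.trace_mem_center, h6] at h7
    rw [h7, E.toInd_idem D, Ind.form_tmul_one
      (E.tensorForm_mul_comm β.char_mul_comm (δ l).char_mul_comm)]
    refine (E.tensorForm_tensorMk β.char (δ l).char 1 1).trans ?_
    rw [(δ l).char_one]
    exact congrArg (· * _) β.char_e
  refine ⟨h5, fun hr => ?_⟩
  -- If the compressed block is not zero, the central idempotent cannot act as 0 on block l, so it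
  -- acts as 1 there and compression by it loses nothing.
  have h8 : (γ l).π D.trace = 1 := by
    refine ((γ l).central_idempotent D.trace_mem_center
      (D.trace_isIdempotentElem he)).resolve_left fun h0 => ?_
    rw [← D.trace_mul_map he, MatBlock.char_apply, map_mul, h0, zero_mul, Matrix.trace_zero] at h5
    exact mul_ne_zero (Nat.cast_ne_zero.2 hn) (Nat.cast_ne_zero.2 hr) h5.symm
  refine ⟨?_, fun x => ?_⟩
  · let _ := Fintype.ofFinite (X.carrier ⧸ j.toMonoidHom.range)
    have h9 := h4 1
    have h10 : E.tensorForm β.char (δ l).char 1 = n * r l := by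
      refine (E.tensorForm_tensorMk β.char (δ l).char 1 1).trans ?_
      rw [(δ l).char_one]
      exact congrArg (· * _) β.char_e
    rw [MatBlock.char_apply, map_mul, map_mul, h8, one_mul, mul_one, map_one, Matrix.trace_one,
      Fintype.card_fin, map_one, Ind.form_apply, finsum_eq_sum_of_fintype,
      Finset.sum_congr rfl (g := fun _ => (n * r l : F)) fun q _ => ?_] at h9
    · rw [Finset.sum_const, Finset.card_univ, nsmul_eq_mul, ← Nat.card_eq_fintype_card] at h9
      exact_mod_cast h9
    · rw [← Ind.str_one, Ind.str_apply, mul_one, inv_mul_cancel, Ind.extendZero_one hj, h10]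
  · have h9 := h4 (StarAlg.of F X x)
    rw [MatBlock.char_apply, map_mul, map_mul, h8, one_mul, mul_one, E.toInd_of, Ind.form_str] at h9
    refine h9.trans (congrArg (fun f => inducedFun j.toMonoidHom f x) (funext fun h => ?_))
    exact E.tensorForm_struct _ _ _

end CliffordExtension

/-! ### The order of the reduced group -/

namespace CliffordExtension

variable {R : Type u} [CommRing R] {F : Type u} [Field F] [Algebra R F]
  {N H : StarGroup R} {i : StarGroup.Hom N H} {e : StarAlg F N} {he : IsIdempotentElem e}
  [i.toMonoidHom.range.Normal] (E : CliffordExtension i he)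

theorem redMk_surjective : Function.Surjective E.redMk :=
  (QuotientGroup.mk'_surjective _).comp E.diffMk_surjective

theorem redMk_mem_units_iff (z : E.pairs) :
    E.redMk z ∈ E.red.units ↔ z.1.1 ∈ i.toMonoidHom.range := by
  constructor
  · rintro ⟨c, hc⟩
    exact E.redMk_eq_unit hc.symm
  · rintro ⟨n, hn⟩
    have h1 : (z * (E.embPair n)⁻¹).1.1 = 1 := by
      change z.1.1 * (i.toMonoidHom n)⁻¹ = 1
      rw [hn, mul_inv_cancel]
    obtain ⟨c, -, hc⟩ := E.redMk_of_fst_eq_one _ h1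
    rw [map_mul, map_inv, E.redMk_embPair, inv_one, mul_one] at hc
    exact ⟨_, hc.symm⟩

/-- An element of the reduced group lies in `Rˣ` exactly when its first component comes from `N`, so
choosing lifts to `grp` identifies the cosets; a bijection is enough to compare orders. -/
theorem exists_red_quo_equiv :
    ∃ g : H → E.red, ∃ f : H.carrier ⧸ i.toMonoidHom.range ≃ E.red.quo,
      ∀ h : H, f (QuotientGroup.mk h) = QuotientGroup.mk (g h) := by
  choose y hy using fun h : H => E.proj_surjective (QuotientGroup.mk h)
  refine ⟨fun h => E.redMk (E.pair h (y h) (hy h)), exists_quotient_equiv _ (fun a b => ?_)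
    fun x => ?_⟩
  · rw [← map_inv, ← map_mul, redMk_mem_units_iff]
    rfl
  · obtain ⟨z, rfl⟩ := E.redMk_surjective x
    refine ⟨z.1.1, ?_⟩
    rw [← map_inv, ← map_mul, redMk_mem_units_iff]
    change z.1.1⁻¹ * z.1.1 ∈ _
    rw [inv_mul_cancel]
    exact one_mem _

theorem card_quo_eq (hi : Function.Injective i.toMonoidHom) :
    Nat.card H.quo = Nat.card N.quo * Nat.card E.red.quo := by
  obtain ⟨_, f, -⟩ := E.exists_red_quo_equiv
  rw [i.card_quo hi, ← Nat.card_congr f]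
  rfl

theorem finite_red_quo [Finite H.quo] (hi : Function.Injective i.toMonoidHom) :
    Finite E.red.quo := by
  have h : Nat.card E.red.quo ≠ 0 := fun h0 => by
    have h1 := E.card_quo_eq hi
    rw [h0, mul_zero] at h1
    exact Nat.card_pos.ne' h1
  exact Nat.finite_of_card_ne_zero h

end CliffordExtension

/-! ### Irreducible characters and blocks -/

section irr

variable {R : Type u} [CommRing R] {F : Type u} [Field F] [CharZero F] [Algebra R F]
  {X : StarGroup R} {k : ℕ} {d : Fin k → ℕ} {β : (i : Fin k) → MatBlock F (StarAlg F X) (d i)}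

/-- The irreducible characters are parametrized by the blocks. -/
def MatBlock.IsDecomposition.irrEquiv (h : MatBlock.IsDecomposition β) :
    {i // d i ≠ 0} ≃ Irr F X :=
  Equiv.ofBijective (fun i => ⟨(β i).char, (β i).isIrrChar_char i.2⟩)
    ⟨fun i _ hij => Subtype.ext (h.char_injective i.2 (congrArg Subtype.val hij)), fun χ => by
      obtain ⟨i, hi, hχ⟩ := h.exists_eq_char χ.2
      exact ⟨⟨i, hi⟩, Subtype.ext hχ.symm⟩⟩

theorem MatBlock.IsDecomposition.irrEquiv_apply (h : MatBlock.IsDecomposition β)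
    (i : {i // d i ≠ 0}) : (h.irrEquiv i).1 = (β i).char := rfl

theorem MatBlock.IsDecomposition.exists_irrOver_equiv (h : MatBlock.IsDecomposition β)
    {N : Subgroup X} {hN : X.units ≤ N} {n : ℕ} (hn : n ≠ 0)
    (β₀ : MatBlock F (StarAlg F (X.sub N hN)) n) {r : Fin k → ℕ}
    (hr : ∀ i, (β i).char (StarAlg.map F (X.subHom N hN) β₀.e) ≠ 0 ↔ r i ≠ 0)
    (hd : ∀ i, r i ≠ 0 → d i ≠ 0) :
    ∃ f : {i // r i ≠ 0} ≃ IrrOver β₀.char, ∀ i, (f i).1 = (β i).char := by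
  have h1 : ∀ i, r i ≠ 0 → (β i).char ∈ IrrOver β₀.char := fun i hi =>
    (β₀.mem_irrOver_iff hn ((β i).isIrrChar_char (hd i hi))).2 ((hr i).2 hi)
  refine ⟨Equiv.ofBijective (fun i => ⟨(β i).char, h1 i i.2⟩)
    ⟨fun i j hij => Subtype.ext (h.char_injective (hd i i.2) (congrArg Subtype.val hij)),
      fun χ => ?_⟩, fun i => rfl⟩
  obtain ⟨i, hi, hχ⟩ := h.exists_eq_char χ.2.1
  have h2 := (β₀.mem_irrOver_iff hn χ.2.1).1 χ.2
  rw [hχ] at h2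
  exact ⟨⟨i, (hr i).1 h2⟩, Subtype.ext hχ.symm⟩

end irr

/-! ### The residue characteristic -/

section residue

variable {O : Type u} [CommRing O] [IsLocalRing O] (p : ℕ)
  [CharP (IsLocalRing.ResidueField O) p]

theorem not_isUnit_natCast_of_charP_residueField : ¬ IsUnit (p : O) := fun h => by
  have h1 := h.map (IsLocalRing.residue O)
  rw [map_natCast, CharP.cast_eq_zero] at h1
  exact not_isUnit_zero h1

theorem isUnit_natCast_of_charP_residueField {m : ℕ} (hm : ¬ p ∣ m) : IsUnit (m : O) := by
  by_contra h
  have h1 := (IsLocalRing.residue_eq_zero_iff _).2 ((IsLocalRing.mem_maximalIdeal _).2 h)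
  rw [map_natCast] at h1
  exact hm ((CharP.cast_eq_zero_iff _ p m).1 h1)

end residue

/-! ### The Clifford correspondence and the additivity of defects -/

theorem CliffordExtension.exists_blocks_red_of_eq {R : Type u} [CommRing R] {F : Type u} [Field F]
    [CharZero F] [Algebra R F] {N H X : StarGroup R} [Finite N.quo] [Finite X.quo]
    {i : StarGroup.Hom N H} {n : ℕ} {β : MatBlock F (StarAlg F N) n} {e : StarAlg F N}
    (hβ : β.e = e) {he : IsIdempotentElem e} [i.toMonoidHom.range.Normal]
    (E : CliffordExtension i he) {j : StarGroup.Hom H X} [j.toMonoidHom.range.FiniteIndex]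
    {k : StarGroup.Hom N X} {α : X → StarGroup.Hom N N} (D : IsCliffordDatum i j k α e)
    (hj : Function.Injective j.toMonoidHom) (hn : n ≠ 0) {m : ℕ} {d : Fin m → ℕ}
    {γ : (l : Fin m) → MatBlock F (StarAlg F X) (d l)} (hγ : MatBlock.IsDecomposition γ) :
    ∃ (r : Fin m → ℕ) (δ : (l : Fin m) → MatBlock F (StarAlg F E.red) (r l)),
      MatBlock.IsDecomposition δ ∧ ∀ l, (γ l).char (StarAlg.map F k e) = n * r l ∧
        (r l ≠ 0 → d l = j.toMonoidHom.range.index * (n * r l) ∧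
          ∀ x, (γ l).char (StarAlg.of F X x) =
            inducedFun j.toMonoidHom (E.extTensorRes β.char (δ l).char) x) := by
  -- The idempotent of a base-changed block equals the image of the original idempotent only by a
  -- theorem, so the equality is kept as a hypothesis and substituted here.
  subst hβ
  exact E.exists_blocks_red D hj hn hγ

/-- The Clifford correspondence in terms of blocks. -/
theorem StarGroup.exists_clifford_blocks {R : Type u} [CommRing R] (R' : Type u) [CommRing R']
    [Algebra R R'] {F : Type u} [Field F] [CharZero F] [Algebra R F] (F' : Type u) [Field F']
    [Algebra R F'] [Algebra F F'] [IsScalarTower R F F'] [Algebra R' F'] [IsScalarTower R R' F']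
    {G : StarGroup R} [Finite G.quo] {N : Subgroup G} [N.Normal] {hN : G.units ≤ N} {n : ℕ}
    (hn : n ≠ 0) (β : MatBlock F (StarAlg F (G.sub N hN)) n) (hν : IsAbsIrrChar β.char)
    (he : IsAssociatedIdempotent β.char β.e)
    (E : CliffordExtension (stabIncl R' hν) (he.ascend R' F')) {m : ℕ} {d : Fin m → ℕ}
    {γ : (l : Fin m) → MatBlock F (StarAlg F G) (d l)} (hγ : MatBlock.IsDecomposition γ) :
    ∃ (r : Fin m → ℕ) (δ : (l : Fin m) → MatBlock F' (StarAlg F' E.red) (r l)),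
      MatBlock.IsDecomposition δ ∧ ∀ l,
        ((γ l).char (StarAlg.map F (G.subHom N hN) β.e) ≠ 0 ↔ r l ≠ 0) ∧
        (r l ≠ 0 → d l = (stabHom R' β.char).toMonoidHom.range.index * (n * r l) ∧
          ∀ (c : R'ˣ) (x : G), algebraMap R' F' c * algebraMap F F' ((γ l).char (StarAlg.of F G x)) =
            inducedFun (stabHom R' β.char).toMonoidHom
              (E.extTensorRes (StarAlg.extendForm R' F' β.char) (δ l).char) (G.bcMk R' (c, x))) := by
  have : CharZero F' := charZero_of_injective_algebraMap (algebraMap F F').injective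
  -- The blocks of the algebra of `G` over `F` are extended to `F'` first, then compressed to the
  -- algebra of the reduced group.
  obtain ⟨r, δ, hδ, h⟩ := E.exists_blocks_red_of_eq (β := β.ascend R' F') (β.ascend_e R' F')
    (isCliffordDatum R' F' β hn hν) (stabHom_injective R' β.char) hn (hγ.ascend R' F')
  refine ⟨r, δ, hδ, fun l => ⟨?_, fun hr => ⟨((h l).2 hr).1, fun c x => ?_⟩⟩⟩
  · have h1 := (h l).1
    rw [(γ l).ascend_char R' F', map_bcMap_ascend, StarAlg.extendForm_ascend R' F'] at h1
    rw [← (map_ne_zero (algebraMap F F')), h1]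
    refine ⟨fun h2 h3 => h2 (by rw [h3, Nat.cast_zero, mul_zero]), fun h2 => ?_⟩
    exact mul_ne_zero (Nat.cast_ne_zero.2 hn) (Nat.cast_ne_zero.2 h2)
  · have h1 := ((h l).2 hr).2 (G.bcMk R' (c, x))
    rw [(γ l).ascend_char R' F', β.ascend_char R' F'] at h1
    rw [← h1]
    exact (StarAlg.extendForm_of R' F' _ c x).symm

theorem proposition4p12 (p : ℕ) [Fact p.Prime]
    (O : Type u) [CommRing O] [IsDomain O] [IsDiscreteValuationRing O]
    [IsAdicComplete (IsLocalRing.maximalIdeal O) O] [CharZero O]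
    [IsAlgClosed (IsLocalRing.ResidueField O)] [CharP (IsLocalRing.ResidueField O) p]
    (K : Type u) [Field K] [Algebra O K] [IsFractionRing O K]
    (G : StarGroup O) [Finite G.quo]
    (K' : Type u) [Field K'] [Algebra K K'] [Algebra O K'] [IsScalarTower O K K']
    [FiniteDimensional K K'] (_ : Nat.card G.quo ∣ Module.finrank K K')
    (O' : Type u) [CommRing O'] [Algebra O O'] [Algebra O' K'] [IsScalarTower O O' K']
    [IsIntegralClosure O' O K']
    (N : Subgroup G) [N.Normal] (hN : G.units ≤ N)
    (ν : StarAlg K (G.sub N hN) →ₗ[K] K) (hν : IsAbsIrrChar ν) :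
    (∃ e : StarAlg K (G.sub N hN), IsAssociatedIdempotent ν e) ∧
    ∀ (e : StarAlg K (G.sub N hN)) (he : IsAssociatedIdempotent ν e),
      Nonempty (CliffordExtension (StarGroup.stabIncl O' hν) (he.ascend O' K')) ∧
      ∀ E : CliffordExtension (StarGroup.stabIncl O' hν) (he.ascend O' K'),
        (∃ hf : IsIdempotentElem (StarGroup.idemTrace O' K' ν e),
          StarGroup.idemTrace O' K' ν e ∈ Subalgebra.center K' (StarAlg K' (G.baseChange O')) ∧
          ∃ Φ : hf.Corner ≃ₐ[K'] Ind K' (StarGroup.stabHom_injective O' ν) E.struct,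
            (∀ x : G.baseChange O',
              Φ (toCorner hf (StarAlg.of K' _ x)) = Ind.str K' _ E.struct x) ∧
            ∀ y : (G.sub N hN).baseChange O',
              (Φ.symm (Ind.tmul K' _ E.struct 1 (E.baseElem y) 1)).1 =
              StarAlg.of K' _ ((StarGroup.bcMap O' (G.subHom N hN)).toMonoidHom y) *
                StarGroup.idemIn K' e) ∧
        (IsSplittingFor K G →
          IsSplittingFor K' E.red ∧
          ∃ Ψ : Irr K' E.red ≃ IrrOver ν, ∀ ζ : Irr K' E.red,
            (∀ (c : O'ˣ) (x : G),
              algebraMap O' K' c * algebraMap K K' ((Ψ ζ).1 (StarAlg.of K G x)) =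
                inducedFun (StarGroup.stabHom O' ν).toMonoidHom
                  (E.extTensorRes (StarAlg.extendForm O' K' ν) ζ.1) (G.bcMk O' (c, x))) ∧
            ∃ dν dζ dχ : ℕ, HasDefect p ν dν ∧ HasDefect p ζ.1 dζ ∧
              HasDefect p (Ψ ζ).1 dχ ∧ dχ = dν + dζ) := by
  have hO := IsFractionRing.injective O K
  have : CharZero K := charZero_of_injective_algebraMap hO
  obtain ⟨n, hn, β, rfl⟩ := hν.exists_block
  have hd : Nat.card G.quo ∣ Module.finrank K K' := by assumption
  refine ⟨⟨β.e, β.isAssociatedIdempotent hn⟩, fun e he => ?_⟩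
  obtain rfl := he.eq_e hn
  refine ⟨β.nonempty_cliffordExtension K' hd O' hn hν he, fun E =>
    ⟨StarGroup.exists_idemTrace_corner_equiv O' K' β hn hν he E, ?_⟩⟩
  rintro ⟨m, d, ⟨Θ⟩⟩
  obtain ⟨_, _, _, _⟩ := isDiscreteValuationRing_integralClosure (O := O) K K' O'
  have : CharZero K' := charZero_of_injective_algebraMap (algebraMap K K').injective
  have hγ := MatBlock.isDecomposition_ofPi Θ
  obtain ⟨r, δ, hδ, h⟩ := StarGroup.exists_clifford_blocks O' K' hn β hν he E hγ
  have hi : Function.Injective (StarGroup.stabIncl O' hν).toMonoidHom :=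
    StarGroup.bcMap_injective O' _ (Subgroup.inclusion_injective (StarGroup.le_stab hν))
  have hfin : Finite E.red.quo := E.finite_red_quo hi
  -- The order of G as the product of those of N and of H/N and of the index of H.
  have hcard : Nat.card G.quo = Nat.card (G.sub N hN).quo * Nat.card E.red.quo *
      (StarGroup.stabHom O' β.char).toMonoidHom.range.index := by
    rw [← G.card_baseChange_quo O', (StarGroup.stabHom O' β.char).card_quo
      (StarGroup.stabHom_injective O' β.char), E.card_quo_eq hi, StarGroup.card_baseChange_quo]
  have hpos := (Nat.card_pos (α := G.quo)).ne'
  have hd0 : ∀ l, r l ≠ 0 → d l ≠ 0 := fun l hl => by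
    rw [((h l).2 hl).1]
    refine mul_ne_zero (fun h0 => hpos ?_) (mul_ne_zero hn hl)
    rw [hcard, h0, mul_zero]
  obtain ⟨f, hf⟩ := hγ.exists_irrOver_equiv hn β (fun l => (h l).1) hd0
  -- Both sets of characters are indexed by the l with `r l ≠ 0`.
  refine ⟨⟨m, r, hδ.nonempty_algEquiv⟩, hδ.irrEquiv.symm.trans f, fun ζ => ?_⟩
  obtain ⟨⟨l, hl⟩, rfl⟩ := hδ.irrEquiv.surjective ζ
  rw [Equiv.trans_apply, Equiv.symm_apply_apply, hf, hδ.irrEquiv_apply]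
  obtain ⟨h1, h2⟩ := (h l).2 hl
  refine ⟨h2, ?_⟩
  have hp := not_isUnit_natCast_of_charP_residueField (O := O) p
  have hu : ∀ m : ℕ, ¬ p ∣ m → IsUnit (m : O) :=
    fun m hm => isUnit_natCast_of_charP_residueField p hm
  have hint : Algebra.IsIntegral O O' := IsIntegralClosure.isIntegral_algebra O K'
  have hinj : Function.Injective (algebraMap O O') := by
    have h3 : Function.Injective (algebraMap O K') := by
      rw [IsScalarTower.algebraMap_eq O K K']
      exact (algebraMap K K').injective.comp hO
    rw [IsScalarTower.algebraMap_eq O O' K', RingHom.coe_comp] at h3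
    exact h3.of_comp
  -- An injective integral extension reflects units.
  have hp' : ¬ IsUnit (p : O') := fun h3 => hp (by
    rw [← map_natCast (algebraMap O O')] at h3
    exact ((algebraMap_isIntegral_iff.mpr hint).isLocalHom hinj).map_nonunit _ h3)
  have hu' : ∀ m : ℕ, ¬ p ∣ m → IsUnit (m : O') := fun m hm => by
    rw [← map_natCast (algebraMap O O')]
    exact (hu m hm).map _
  obtain ⟨dν, hdν, eν⟩ := β.exists_hasDefect hn p hp hu
  obtain ⟨dζ, hdζ, eζ⟩ := (δ l).exists_hasDefect hl p hp' hu'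
  obtain ⟨dχ, hdχ, eχ⟩ := (MatBlock.ofPi Θ l).exists_hasDefect (hd0 l hl) p hp hu
  refine ⟨dν, dζ, dχ, hdν, hdζ, hdχ, ?_⟩
  -- The valuations of degree and order differ by the defect for each of ν, ζ and χ; in the
  -- difference for χ the contribution of the index cancels.
  have hc := hcard ▸ hpos
  obtain ⟨hc1, hc2⟩ := mul_ne_zero_iff.1 hc
  obtain ⟨hc3, hc4⟩ := mul_ne_zero_iff.1 hc1
  rw [h1, hcard, padicValNat.mul hc2 (mul_ne_zero hn hl), padicValNat.mul hn hl,
    padicValNat.mul hc1 hc2, padicValNat.mul hc3 hc4] at eχ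
  omega

end
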